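/- Let $n>d_1>\dots>d_\ell>0$ be integers with $\ell\ge 1$, put $m=d_1$, and let $\mathscr D_d$ be the variety of flags $V_\ell\subset\dots\subset V_1\subset\mathbb R^n$ with $\dim V_i=d_i$, with its $O(n)$-invariant measure of total mass $1$. A matrix $X\in M_{n,m}(\mathbb R)$ with orthonormal columns marks the flag whose $i$-th space is spanned by its first $d_i$ columns. Let $O(\underline m)\subset O(m)$ be the subgroup of block diagonal matrices with blocks of sizes $d_\ell,\ d_{\ell-1}-d_\ell,\dots,d_1-d_2$. For a partition $\mu$ of degree $|\mu|$ (sum of the parts) and depth $\lfloor\mu\rfloor$ (number of nonzero parts), let $\mathbb S^\mu(\mathbb R^k)\subset(\mathbb R^k)^{\otimes|\mu|}$ be the Schur module, that is, the image of the Young symmetrizer of $\mu$; let $\mathbb S^{[\mu]}(\mathbb R^n)$ be the $O(n)$-module of the traceless tensors in $\mathbb S^\mu(\mathbb R^n)$; let $N^\mu=\mathbb S^\mu(\mathbb R^m)^{O(\underline m)}$ and $n_\mu=\dim N^\mu$. For $v\in\mathbb S^{[\mu]}(\mathbb R^n)$ and $w\in N^\mu$, let $\phi(v\otimes w)$ be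 the function on $\mathscr D_d$ whose value at the flag marked by $X$ is $\langle v,X^{\otimes|\mu|}w\rangle$. For an integer $t\ge 0$, let $\mathscr P_t$ be the $O(n)$-module of functions on $\mathscr D_d$ spanned by all the $\phi(v\otimes w)$ with $|\mu|\le t$ and $\lfloor\mu\rfloor\le m$. These are the polynomial functions of degree at most $t$, that is, the realisation of $\bigoplus_{|\mu|\le t,\ \lfloor\mu\rfloor\le m}\mathbb S^{[\mu]}(\mathbb R^n)^{\oplus n_\mu}$ as a space of functions on $\mathscr D_d$. A finite set $\mathcal D\subset\mathscr D_d$ is a vexillar $t$-design if $\int_{\mathscr D_d}f(\Delta)\,d\Delta=\frac1{|\mathcal D|}\sum_{\Delta\in\mathcal D}f(\Delta)$ for every $f\in\mathscr P_t$. **Theorem.** Let $G$ be a finite subgroup of $O(n)$. 1. The trivial representation of $G$ occurs exactly once in the space $\mathscr P_t$ if and only if, for every flag $\Delta_0\in\mathscr D_d$, the orbit $G\cdot\Delta_0$ is a vexillar $t$-design. 2. If moreover $2m\le n$, then the trivial representation of $G$ occurs exactly once in the abstract (external) direct sum $\bigoplus_{|\mu|\le t,\ \lfloor\mu\rfloor\le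 m}\mathbb S^{[\mu]}(\mathbb R^n)^{\oplus n_\mu}$ if and only if, for every flag $\Delta_0\in\mathscr D_d$, the orbit $G\cdot\Delta_0$ is a vexillar $t$-design. -/

import Mathlib

open MeasureTheory Matrix
open scoped DirectSum

noncomputable section

namespace Vexillar

/-! ### The orthogonal group -/

/-- The orthogonal group `O(n)`. -/
abbrev O (n : ℕ) := Matrix.orthogonalGroup (Fin n) ℝ

/-- The Borel σ-algebra of `O(n)`. -/
instance (n : ℕ) : MeasurableSpace (O n) := borel _

instance (n : ℕ) : BorelSpace (O n) := ⟨rfl⟩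

theorem O.transpose_mul_self {n : ℕ} (g : O n) : (g : Matrix (Fin n) (Fin n) ℝ)ᵀ * g = 1 :=
  Matrix.mem_unitaryGroup_iff'.1 g.2

theorem O.coe_inv {n : ℕ} (g : O n) :
    ((g⁻¹ : O n) : Matrix (Fin n) (Fin n) ℝ) = (g : Matrix (Fin n) (Fin n) ℝ)ᵀ := rfl

instance (n : ℕ) : CompactSpace (O n) := by
  have hK : IsCompact (Set.pi Set.univ fun _ : Fin n =>
      Set.pi Set.univ fun _ : Fin n => Set.Icc (-1 : ℝ) 1) :=
    isCompact_univ_pi fun _ => isCompact_univ_pi fun _ => isCompact_Icc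
  have hc : IsClosed {A : Matrix (Fin n) (Fin n) ℝ | Aᵀ * A = 1} :=
    isClosed_eq (by fun_prop) continuous_const
  suffices h : IsCompact {A | A ∈ Matrix.orthogonalGroup (Fin n) ℝ} from
    isCompact_iff_compactSpace.1 h
  refine IsCompact.of_isClosed_subset (s := Set.pi Set.univ fun _ : Fin n =>
      Set.pi Set.univ fun _ : Fin n => Set.Icc (-1 : ℝ) 1) hK ?_ ?_
  · have : {A | A ∈ Matrix.orthogonalGroup (Fin n) ℝ} =
        {A : Matrix (Fin n) (Fin n) ℝ | Aᵀ * A = 1} := by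
      ext A; exact Matrix.mem_unitaryGroup_iff'
    rw [this]; exact hc
  · intro A hA i _ j _
    have := entry_norm_bound_of_unitary (𝕜 := ℝ) hA i j
    exact abs_le.1 this

/-- The Haar probability measure of `O(n)`. -/
def haarO (n : ℕ) : Measure (O n) := Measure.haarMeasure ⊤

/-! ### Flags -/

/-- The shape `d = (d_1, …, d_ℓ)` (here `ℓ = len + 1 ≥ 1`, indexed from `0`) of a flag of `ℝⁿ`:
`n > d_1 > ⋯ > d_ℓ > 0`. -/
structure FlagShape (n : ℕ) where
  len : ℕ
  dim : Fin (len + 1) → ℕ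
  strictAnti : StrictAnti dim
  pos : ∀ i, 0 < dim i
  lt : ∀ i, dim i < n

variable {n : ℕ}

/-- The largest dimension `m = d_1` occurring in the flags of shape `s`. -/
def FlagShape.top (s : FlagShape n) : ℕ := s.dim 0

theorem FlagShape.dim_le_top (s : FlagShape n) (i : Fin (s.len + 1)) : s.dim i ≤ s.top :=
  s.strictAnti.antitone (Fin.zero_le i)

/-- The flag variety: flags `0 ⊊ V_ℓ ⊊ ⋯ ⊊ V_1 ⊊ ℝⁿ` with `dim V_i = d_i`. -/
@[ext] structure Flag (s : FlagShape n) where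
  space : Fin (s.len + 1) → Submodule ℝ (Fin n → ℝ)
  antitone : Antitone space
  finrank_eq : ∀ i, Module.finrank ℝ (space i) = s.dim i

/-- The linear automorphism of `ℝⁿ` given by an orthogonal matrix. -/
def orthEquiv (g : O n) : (Fin n → ℝ) ≃ₗ[ℝ] (Fin n → ℝ) :=
  LinearEquiv.ofLinearMap (Matrix.mulVecLin (g : Matrix (Fin n) (Fin n) ℝ))
    (Matrix.mulVecLin ((g⁻¹ : O n) : Matrix (Fin n) (Fin n) ℝ))
    (by rw [← Matrix.mulVecLin_mul, ← Submonoid.coe_mul, mul_inv_cancel]; simp)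
    (by rw [← Matrix.mulVecLin_mul, ← Submonoid.coe_mul, inv_mul_cancel]; simp)

instance (s : FlagShape n) : MulAction (O n) (Flag s) where
  smul g Δ :=
    { space := fun i => (Δ.space i).map (Matrix.mulVecLin (g : Matrix (Fin n) (Fin n) ℝ))
      antitone := fun _ _ h => Submodule.map_mono (Δ.antitone h)
      finrank_eq := fun i => (LinearEquiv.finrank_map_eq (orthEquiv g) (Δ.space i)).trans
        (Δ.finrank_eq i) }
  one_smul Δ := by
    refine Flag.ext (funext fun i => ?_)
    change (Δ.space i).map (Matrix.mulVecLin ((1 : O n) : Matrix (Fin n) (Fin n) ℝ)) = _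
    simp
  mul_smul g h Δ := by
    refine Flag.ext (funext fun i => ?_)
    change (Δ.space i).map (Matrix.mulVecLin ((g * h : O n) : Matrix (Fin n) (Fin n) ℝ)) =
      ((Δ.space i).map (Matrix.mulVecLin (h : Matrix (Fin n) (Fin n) ℝ))).map
        (Matrix.mulVecLin (g : Matrix (Fin n) (Fin n) ℝ))
    rw [Submonoid.coe_mul, Matrix.mulVecLin_mul, Submodule.map_comp]

theorem Flag.smul_space {s : FlagShape n} (g : O n) (Δ : Flag s) (i : Fin (s.len + 1)) :
    (g • Δ).space i = (Δ.space i).map (Matrix.mulVecLin (g : Matrix (Fin n) (Fin n) ℝ)) := rfl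

/-- The `n × m` matrices with orthonormal columns. -/
def Frame (s : FlagShape n) := {X : Matrix (Fin n) (Fin s.top) ℝ // Xᵀ * X = 1}

/-- The span of the first `d_i` columns of a frame. -/
def Frame.span {s : FlagShape n} (X : Frame s) (i : Fin (s.len + 1)) :
    Submodule ℝ (Fin n → ℝ) :=
  Submodule.span ℝ (Set.range fun j : {j : Fin s.top // (j : ℕ) < s.dim i} => X.1.col j)

theorem Frame.linearIndependent {s : FlagShape n} (X : Frame s) :
    LinearIndependent ℝ X.1.col := by
  rw [← Matrix.mulVec_injective_iff]
  intro v w h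
  have := congrArg (X.1ᵀ *ᵥ ·) h
  simpa [Matrix.mulVec_mulVec, X.2] using this

theorem Frame.finrank_span {s : FlagShape n} (X : Frame s) (i : Fin (s.len + 1)) :
    Module.finrank ℝ (X.span i) = s.dim i := by
  have h : LinearIndependent ℝ
      (fun j : {j : Fin s.top // (j : ℕ) < s.dim i} => X.1.col j) :=
    X.linearIndependent.comp _ Subtype.val_injective
  rw [Frame.span, finrank_span_eq_card h, Fintype.card_subtype]
  have := s.dim_le_top i
  simp [Fin.card_filter_val_lt, this]

/-- The flag marked by a frame: its `i`-th space is spanned by the first `d_i` columns. -/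
def Flag.ofFrame {s : FlagShape n} (X : Frame s) : Flag s where
  space := X.span
  antitone := fun _ _ h => Submodule.span_mono (by
    rintro _ ⟨j, rfl⟩
    exact ⟨⟨j.1, j.2.trans_le (s.strictAnti.antitone h)⟩, rfl⟩)
  finrank_eq := X.finrank_span

/-- Left multiplication of a frame by an orthogonal matrix. -/
def Frame.mul {s : FlagShape n} (g : O n) (X : Frame s) : Frame s :=
  ⟨(g : Matrix (Fin n) (Fin n) ℝ) * X.1, by
    rw [Matrix.transpose_mul, Matrix.mul_assoc, ← Matrix.mul_assoc _ _ X.1,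
      O.transpose_mul_self, Matrix.one_mul, X.2]⟩

theorem Flag.smul_ofFrame {s : FlagShape n} (g : O n) (X : Frame s) :
    g • Flag.ofFrame X = Flag.ofFrame (Frame.mul g X) := by
  refine Flag.ext (funext fun i => ?_)
  rw [Flag.smul_space]
  change Submodule.map _ (Submodule.span ℝ _) = Submodule.span ℝ _
  rw [Submodule.map_span, ← Set.range_comp]
  rfl

/-- The frame made of the first `m` vectors of the canonical basis. -/
def Frame.standard (s : FlagShape n) : Frame s :=
  ⟨Matrix.of fun i j => if (i : ℕ) = j then 1 else 0, by
    ext j k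
    have hj : (j : ℕ) < n := j.2.trans (s.lt 0)
    rw [Matrix.mul_apply, Finset.sum_eq_single ⟨j, hj⟩]
    · simp [Matrix.one_apply, Fin.ext_iff]
    · intro i _ hi
      have : (i : ℕ) ≠ j := fun h => hi (Fin.ext h)
      simp [this]
    · simp⟩

/-- The standard flag, spanned by the first vectors of the canonical basis. -/
def Flag.standard (s : FlagShape n) : Flag s := Flag.ofFrame (Frame.standard s)

/-- The quotient σ-algebra of the flag variety, seen as a quotient of `O(n)`. -/
instance (s : FlagShape n) : MeasurableSpace (Flag s) :=
  MeasurableSpace.map (fun g : O n => g • Flag.standard s) inferInstance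

/-- The `O(n)`-invariant measure of total mass one on the flag variety. -/
def flagMeasure (s : FlagShape n) : Measure (Flag s) :=
  (haarO n).map fun g => g • Flag.standard s

/-! ### Tensors of shape `μ` and Schur modules -/

/-- The boxes of a Young diagram. -/
abbrev Box (μ : YoungDiagram) := {b : ℕ × ℕ // b ∈ μ.cells}

/-- The tensor power of `ℝᵏ` whose factors are indexed by the boxes of `μ`; the coordinate of
index `T` is the coefficient of the tableau `T` inscribed with vectors of the canonical basis. -/
abbrev Tensor (μ : YoungDiagram) (k : ℕ) := (Box μ → Fin k) → ℝ

variable {μ : YoungDiagram} {k l p : ℕ}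

/-- The action `A ⊗ ⋯ ⊗ A` of a `k × l` matrix on tensors. -/
def tensorMap (μ : YoungDiagram) (A : Matrix (Fin k) (Fin l) ℝ) :
    Tensor μ l →ₗ[ℝ] Tensor μ k where
  toFun t := fun T => ∑ S : Box μ → Fin l, (∏ b, A (T b) (S b)) * t S
  map_add' t u := by
    funext T; simp [mul_add, Finset.sum_add_distrib]
  map_smul' c t := by
    funext T; simp only [Pi.smul_apply, smul_eq_mul, RingHom.id_apply, Finset.mul_sum]
    exact Finset.sum_congr rfl fun S _ => by ring

/-- The permutation of the tensor factors by `σ`. -/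
def permMap (σ : Equiv.Perm (Box μ)) : Tensor μ k →ₗ[ℝ] Tensor μ k :=
  LinearMap.funLeft ℝ ℝ fun T => T ∘ σ

open scoped Classical in
/-- The sum over the permutations of the boxes that preserve each row. -/
def rowSym (μ : YoungDiagram) (k : ℕ) : Tensor μ k →ₗ[ℝ] Tensor μ k :=
  ∑ σ : Equiv.Perm (Box μ) with ∀ b, (σ b).1.1 = b.1.1, permMap σ

open scoped Classical in
/-- The alternating sum over the permutations of the boxes that preserve each column. -/
def colAlt (μ : YoungDiagram) (k : ℕ) : Tensor μ k →ₗ[ℝ] Tensor μ k :=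
  ∑ σ : Equiv.Perm (Box μ) with ∀ b, (σ b).1.2 = b.1.2, ((σ.sign : ℤ) : ℝ) • permMap σ

/-- The Schur module `S^μ(ℝᵏ)`: the image of the tensors under the Young symmetrizer of `μ`. -/
def schur (μ : YoungDiagram) (k : ℕ) : Submodule ℝ (Tensor μ k) :=
  LinearMap.range (colAlt μ k ∘ₗ rowSym μ k)

/-- The traceless tensors: all contractions of two factors vanish. Equivalently, the tensors
orthogonal to all those obtained by inserting `∑ᵢ eᵢ ⊗ eᵢ` in two boxes. -/
def traceless (μ : YoungDiagram) (k : ℕ) : Submodule ℝ (Tensor μ k) where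
  carrier := {t | ∀ (b c : Box μ), b ≠ c → ∀ T : Box μ → Fin k,
    ∑ i, t (Function.update (Function.update T b i) c i) = 0}
  zero_mem' := by intro b c _ T; simp
  add_mem' := by
    intro t u ht hu b c h T
    simp [Finset.sum_add_distrib, ht b c h T, hu b c h T]
  smul_mem' := by
    intro r t ht b c h T
    simp [← Finset.mul_sum, ht b c h T]

/-- The `O(k)`-module `S^[μ](ℝᵏ)`: the traceless part of the Schur module `S^μ(ℝᵏ)`. -/
def orthSchur (μ : YoungDiagram) (k : ℕ) : Submodule ℝ (Tensor μ k) := schur μ k ⊓ traceless μ k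

theorem tensorMap_mul (A : Matrix (Fin k) (Fin l) ℝ) (B : Matrix (Fin l) (Fin p) ℝ) :
    tensorMap μ (A * B) = tensorMap μ A ∘ₗ tensorMap μ B := by
  refine LinearMap.ext fun t => funext fun T => ?_
  simp only [tensorMap, LinearMap.coe_mk, AddHom.coe_mk, LinearMap.comp_apply, Matrix.mul_apply,
    Finset.prod_univ_sum, Fintype.piFinset_univ, Finset.mul_sum, Finset.sum_mul]
  rw [Finset.sum_comm]
  exact Finset.sum_congr rfl fun _ _ => Finset.sum_congr rfl fun _ _ => by
    rw [Finset.prod_mul_distrib]; ring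

theorem tensorMap_one : tensorMap μ (1 : Matrix (Fin k) (Fin k) ℝ) = LinearMap.id := by
  refine LinearMap.ext fun t => funext fun T => ?_
  simp only [tensorMap, LinearMap.coe_mk, AddHom.coe_mk, LinearMap.id_apply]
  rw [Finset.sum_eq_single T]
  · simp
  · intro S _ hS
    obtain ⟨b, hb⟩ := Function.ne_iff.1 hS
    rw [Finset.prod_eq_zero (Finset.mem_univ b), zero_mul]
    exact Matrix.one_apply_ne hb.symm
  · simp

theorem tensorMap_perm (A : Matrix (Fin k) (Fin l) ℝ) (σ : Equiv.Perm (Box μ)) :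
    tensorMap μ A ∘ₗ permMap σ = permMap σ ∘ₗ tensorMap μ A := by
  refine LinearMap.ext fun t => funext fun T => ?_
  simp only [tensorMap, permMap, LinearMap.coe_mk, AddHom.coe_mk, LinearMap.comp_apply,
    LinearMap.funLeft_apply]
  refine Fintype.sum_equiv (Equiv.arrowCongr σ.symm (Equiv.refl _)) _ _ fun S => ?_
  have : (∏ b, A (T b) (S b)) = ∏ b, A (T (σ b)) (S (σ b)) :=
    (Equiv.prod_comp σ fun b => A (T b) (S b)).symm
  rw [this]
  rfl

theorem tensorMap_mem_schur (A : Matrix (Fin k) (Fin l) ℝ) {t : Tensor μ l}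
    (ht : t ∈ schur μ l) : tensorMap μ A t ∈ schur μ k := by
  obtain ⟨u, rfl⟩ := ht
  refine ⟨tensorMap μ A u, ?_⟩
  have hp : ∀ (σ : Equiv.Perm (Box μ)) (w : Tensor μ l),
      tensorMap μ A (permMap σ w) = permMap σ (tensorMap μ A w) := fun σ w =>
    LinearMap.congr_fun (tensorMap_perm A σ) w
  simp only [LinearMap.comp_apply, colAlt, rowSym, LinearMap.sum_apply, LinearMap.smul_apply,
    map_sum, map_smul, hp]

theorem tensorMap_mem_traceless (g : O k) {t : Tensor μ k} (ht : t ∈ traceless μ k) :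
    tensorMap μ (g : Matrix (Fin k) (Fin k) ℝ) t ∈ traceless μ k := by
  classical
  intro b c hbc T
  set A : Matrix (Fin k) (Fin k) ℝ := (g : Matrix (Fin k) (Fin k) ℝ) with hA
  have horth : ∀ x y, ∑ i, A i x * A i y = if x = y then 1 else 0 := fun x y => by
    have := congrFun (congrFun (O.transpose_mul_self g) x) y
    simpa [Matrix.mul_apply, Matrix.one_apply] using this
  let R : (Box μ → Fin k) → ℝ := fun S => ∏ a ∈ (Finset.univ.erase b).erase c, A (T a) (S a)
  have hcm : c ∈ (Finset.univ : Finset (Box μ)).erase b := by simp [hbc.symm]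
  have hprod : ∀ (S : Box μ → Fin k) (i : Fin k),
      (∏ a, A (Function.update (Function.update T b i) c i a) (S a)) =
        R S * (A i (S b) * A i (S c)) := by
    intro S i
    rw [← Finset.mul_prod_erase Finset.univ _ (Finset.mem_univ b),
      ← Finset.mul_prod_erase _ _ hcm]
    have : ∏ a ∈ (Finset.univ.erase b).erase c,
        A (Function.update (Function.update T b i) c i a) (S a) = R S :=
      Finset.prod_congr rfl fun a ha => by
        simp only [Finset.mem_erase] at ha
        rw [Function.update_of_ne ha.1, Function.update_of_ne ha.2.1]
    rw [this, Function.update_self, Function.update_of_ne hbc, Function.update_self]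
    ring
  simp only [tensorMap, LinearMap.coe_mk, AddHom.coe_mk, hprod]
  rw [Finset.sum_comm]
  have h1 : ∀ S : Box μ → Fin k, ∑ i, R S * (A i (S b) * A i (S c)) * t S =
      if S b = S c then R S * t S else 0 := by
    intro S
    rw [← Finset.sum_mul, ← Finset.mul_sum, horth]
    split_ifs <;> simp
  simp only [h1]
  rw [← Finset.sum_filter]
  rw [← Finset.sum_fiberwise (Finset.univ.filter fun S : Box μ → Fin k => S b = S c)
    (fun S => Function.update (Function.update S b (T b)) c (T b))]
  refine Finset.sum_eq_zero fun S₀ _ => ?_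
  by_cases h0 : Function.update (Function.update S₀ b (T b)) c (T b) = S₀
  · have key : ∑ S ∈ (Finset.univ.filter fun S : Box μ → Fin k => S b = S c) with
        Function.update (Function.update S b (T b)) c (T b) = S₀, R S * t S =
        ∑ i, R S₀ * t (Function.update (Function.update S₀ b i) c i) := by
      have hR : ∀ i, R (Function.update (Function.update S₀ b i) c i) = R S₀ := fun i =>
        Finset.prod_congr rfl fun a ha => by
          simp only [Finset.mem_erase] at ha
          rw [Function.update_of_ne ha.1, Function.update_of_ne ha.2.1]
      have hback : ∀ (i : Fin k), Function.update (Function.update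
          (Function.update (Function.update S₀ b i) c i) b (T b)) c (T b) = S₀ := by
        intro i
        conv_rhs => rw [← h0]
        funext a
        by_cases hac : a = c
        · subst hac; simp
        · by_cases hab : a = b
          · subst hab; simp [hac]
          · simp [hac, hab]
      refine Finset.sum_bij' (fun S _ => S b)
        (fun i _ => Function.update (Function.update S₀ b i) c i) ?_ ?_ ?_ ?_ ?_
      · intro S _; simp
      · intro i _
        simp only [Finset.mem_filter, Finset.mem_univ, true_and]
        exact ⟨by simp [hbc], hback i⟩
      · intro S hS
        simp only [Finset.mem_filter, Finset.mem_univ, true_and] at hS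
        obtain ⟨hSbc, rfl⟩ := hS
        funext a
        by_cases hac : a = c
        · subst hac; simp [hSbc]
        · by_cases hab : a = b
          · subst hab; simp [hac]
          · simp [hac, hab]
      · intro i _; simp [hbc]
      · intro S hS
        simp only [Finset.mem_filter, Finset.mem_univ, true_and] at hS
        obtain ⟨hSbc, hS0⟩ := hS
        have : Function.update (Function.update S₀ b (S b)) c (S b) = S := by
          rw [← hS0]
          funext a
          by_cases hac : a = c
          · subst hac; simp [hSbc]
          · by_cases hab : a = b
            · subst hab; simp [hac]
            · simp [hac, hab]
        have h2 := hR (S b)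
        rw [this] at h2 ⊢
        rw [h2]
    rw [key, ← Finset.mul_sum, ht b c hbc S₀, mul_zero]
  · refine Finset.sum_eq_zero fun S hS => ?_
    simp only [Finset.mem_filter, Finset.mem_univ, true_and] at hS
    refine absurd ?_ h0
    rw [← hS.2]
    funext a
    by_cases hac : a = c
    · subst hac; simp
    · by_cases hab : a = b
      · subst hab; simp [hac]
      · simp [hac, hab]

/-- The action of `O(k)` on tensors. -/
def tensorRep (μ : YoungDiagram) (k : ℕ) : Representation ℝ (O k) (Tensor μ k) where
  toFun g := tensorMap μ (g : Matrix (Fin k) (Fin k) ℝ)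
  map_one' := tensorMap_one
  map_mul' _ _ := tensorMap_mul _ _

theorem tensorRep_mem_orthSchur (g : O k) {t : Tensor μ k} (ht : t ∈ orthSchur μ k) :
    tensorMap μ (g : Matrix (Fin k) (Fin k) ℝ) t ∈ orthSchur μ k :=
  ⟨tensorMap_mem_schur _ ht.1, tensorMap_mem_traceless g ht.2⟩

/-- The representation of `O(k)` on `S^[μ](ℝᵏ)`. -/
def orthSchurRep (μ : YoungDiagram) (k : ℕ) : Representation ℝ (O k) (orthSchur μ k) :=
  (tensorRep μ k).subrepresentation (orthSchur μ k) fun g _ ht => tensorRep_mem_orthSchur g ht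

/-! ### Polynomial functions on the flag variety -/

/-- The subgroup `O(m_1) × ⋯ × O(m_ℓ)` of block diagonal matrices of `O(m)`: the entry `(j, k)`
vanishes as soon as some `d_i` separates the indices `j` and `k`. -/
def IsBlockDiagonal (s : FlagShape n) (h : O s.top) : Prop :=
  ∀ j k : Fin s.top, (∃ i, ¬ ((j : ℕ) < s.dim i ↔ (k : ℕ) < s.dim i)) →
    (h : Matrix (Fin s.top) (Fin s.top) ℝ) j k = 0

/-- The space `N^μ` of the vectors of `S^μ(ℝᵐ)` invariant under `O(m_1) × ⋯ × O(m_ℓ)`. -/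
def blockInvariants (s : FlagShape n) (μ : YoungDiagram) : Submodule ℝ (Tensor μ s.top) where
  carrier := {w | w ∈ schur μ s.top ∧
    ∀ h : O s.top, IsBlockDiagonal s h → tensorRep μ s.top h w = w}
  zero_mem' := ⟨zero_mem _, fun _ _ => map_zero _⟩
  add_mem' := fun ha hb => ⟨add_mem ha.1 hb.1, fun h hh => by
    rw [map_add, ha.2 h hh, hb.2 h hh]⟩
  smul_mem' := fun c _ ha => ⟨Submodule.smul_mem _ c ha.1, fun h hh => by
    rw [map_smul, ha.2 h hh]⟩

/-- The multiplicity `n_μ = dim N^μ`. -/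
def blockMult (s : FlagShape n) (μ : YoungDiagram) : ℕ := Module.finrank ℝ (blockInvariants s μ)

/-- The polynomial function `φ(v ⊗ w) : X ↦ ⟨v, (X ⊗ ⋯ ⊗ X) w⟩` on the `n × m` matrices. For `v`
and `w` obtained from inscribed tableaux it is a combination of products of minors of `X`. -/
def schurPoly (v : Tensor μ n) (w : Tensor μ k) (X : Matrix (Fin n) (Fin k) ℝ) : ℝ :=
  ∑ T : Box μ → Fin n, v T * tensorMap μ X w T

/-- The space `φ(S^[μ](ℝⁿ) ⊗ N^μ)` of polynomial functions on the `n × m` matrices. -/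
def polyComponent (s : FlagShape n) (μ : YoungDiagram) :
    Submodule ℝ (Matrix (Fin n) (Fin s.top) ℝ → ℝ) :=
  Submodule.span ℝ {P | ∃ v ∈ orthSchur μ n, ∃ w ∈ blockInvariants s μ, P = schurPoly v w}

/-- The functions induced on the flag variety by the elements of `φ(S^[μ](ℝⁿ) ⊗ N^μ)`: the value
at a flag is the value of the polynomial at any frame that marks the flag. -/
def flagComponent (s : FlagShape n) (μ : YoungDiagram) : Submodule ℝ (Flag s → ℝ) where
  carrier := {f | ∃ P ∈ polyComponent s μ, ∀ X : Frame s, f (Flag.ofFrame X) = P X.1}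
  zero_mem' := ⟨0, zero_mem _, fun _ => rfl⟩
  add_mem' := by
    rintro f f' ⟨P, hP, h⟩ ⟨P', hP', h'⟩
    exact ⟨P + P', add_mem hP hP', fun X => by simp [h, h']⟩
  smul_mem' := by
    rintro c f ⟨P, hP, h⟩
    exact ⟨c • P, Submodule.smul_mem _ c hP, fun X => by simp [h]⟩

/-- The index set of the partitions `μ` of degree at most `t` and of depth at most `m`; the rows
of the Young diagram are the parts of the partition. -/
abbrev Shapes (s : FlagShape n) (t : ℕ) := {μ : YoungDiagram // μ.card ≤ t ∧ μ.colLen 0 ≤ s.top}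

/-- The space of the polynomial functions of degree at most `t` on the flag variety, that is
`⨁ S^[μ](ℝⁿ)^{⊕ n_μ}` realised by `φ` as a space of functions. -/
def flagPolynomials (s : FlagShape n) (t : ℕ) : Submodule ℝ (Flag s → ℝ) :=
  ⨆ μ : Shapes s t, flagComponent s μ.1

/-- The action of `O(n)` on the functions on the flag variety: `(g f)(Δ) = f(g⁻¹ Δ)`. -/
def flagFunctionRep (s : FlagShape n) : Representation ℝ (O n) (Flag s → ℝ) where
  toFun g := LinearMap.funLeft ℝ ℝ fun Δ => g⁻¹ • Δ
  map_one' := by ext f Δ; simp [LinearMap.funLeft_apply]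
  map_mul' g h := by ext f Δ; simp [LinearMap.funLeft_apply, mul_smul]

theorem schurPoly_mul (A : Matrix (Fin n) (Fin n) ℝ) (v : Tensor μ n) (w : Tensor μ k)
    (X : Matrix (Fin n) (Fin k) ℝ) :
    schurPoly v w (A * X) = schurPoly (tensorMap μ Aᵀ v) w X := by
  simp only [schurPoly, tensorMap_mul, LinearMap.comp_apply]
  generalize tensorMap μ X w = u
  simp only [tensorMap, LinearMap.coe_mk, AddHom.coe_mk, Finset.mul_sum, Finset.sum_mul,
    Matrix.transpose_apply]
  rw [Finset.sum_comm]
  exact Finset.sum_congr rfl fun _ _ => Finset.sum_congr rfl fun _ _ => by ring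

theorem flagFunctionRep_mem_component (s : FlagShape n) (μ : YoungDiagram) (g : O n)
    {f : Flag s → ℝ} (hf : f ∈ flagComponent s μ) :
    flagFunctionRep s g f ∈ flagComponent s μ := by
  obtain ⟨P, hP, h⟩ := hf
  refine ⟨fun X => P (((g⁻¹ : O n) : Matrix (Fin n) (Fin n) ℝ) * X), ?_, fun X => ?_⟩
  · have : polyComponent s μ ≤ (polyComponent s μ).comap (LinearMap.funLeft ℝ ℝ
        fun X : Matrix (Fin n) (Fin s.top) ℝ =>
          ((g⁻¹ : O n) : Matrix (Fin n) (Fin n) ℝ) * X) := by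
      refine Submodule.span_le.2 ?_
      rintro _ ⟨v, hv, w, hw, rfl⟩
      refine Submodule.subset_span ⟨_, tensorRep_mem_orthSchur g hv, w, hw, ?_⟩
      funext X
      rw [LinearMap.funLeft_apply, schurPoly_mul, O.coe_inv, Matrix.transpose_transpose]
    exact this hP
  · change f (g⁻¹ • Flag.ofFrame X) = _
    rw [Flag.smul_ofFrame, h]
    rfl

/-- The representation of `O(n)` on the polynomial functions of degree at most `t`. -/
def flagPolynomialRep (s : FlagShape n) (t : ℕ) : Representation ℝ (O n) (flagPolynomials s t) :=
  (flagFunctionRep s).subrepresentation (flagPolynomials s t) fun g => iSup_le fun μ _ hf =>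
    Submodule.mem_iSup_of_mem μ (flagFunctionRep_mem_component s μ.1 g hf)

/-- The external direct sum `⨁ S^[μ](ℝⁿ)^{⊕ n_μ}` over the partitions `μ` of degree at most `t`
and of depth at most `m`. -/
def SchurSum (s : FlagShape n) (t : ℕ) : Type :=
  ⨁ i : (Σ μ : Shapes s t, Fin (blockMult s μ.1)), orthSchur i.1.1 n

instance (s : FlagShape n) (t : ℕ) : AddCommGroup (SchurSum s t) :=
  inferInstanceAs (AddCommGroup
    (⨁ i : (Σ μ : Shapes s t, Fin (blockMult s μ.1)), orthSchur i.1.1 n))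

instance (s : FlagShape n) (t : ℕ) : Module ℝ (SchurSum s t) :=
  inferInstanceAs (Module ℝ
    (⨁ i : (Σ μ : Shapes s t, Fin (blockMult s μ.1)), orthSchur i.1.1 n))

/-- The representation of `O(n)` on `⨁ S^[μ](ℝⁿ)^{⊕ n_μ}`. -/
def schurSumRep (s : FlagShape n) (t : ℕ) : Representation ℝ (O n) (SchurSum s t) :=
  Representation.directSum
    fun i : (Σ μ : Shapes s t, Fin (blockMult s μ.1)) => orthSchurRep i.1.1 n

/-- The number of occurrences of the trivial representation of a finite group `G` in a real
representation, that is the dimension of the space of fixed vectors. -/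
def trivialMult {G V : Type*} [Group G] [AddCommGroup V] [Module ℝ V]
    (ρ : Representation ℝ G V) : ℕ :=
  Module.finrank ℝ ρ.invariants

/-- The vexillar `t`-designs: finite sets of flags such that the average over the set of any
polynomial function of degree at most `t` is its integral over the flag variety. -/
def IsVexillarDesign (s : FlagShape n) (t : ℕ) (D : Set (Flag s)) : Prop :=
  D.Finite ∧ ∀ f ∈ flagPolynomials s t,
    ∫ Δ, f Δ ∂(flagMeasure s) = (1 / (D.ncard : ℝ)) * ∑ᶠ Δ ∈ D, f Δ

end Vexillar

end

/-! Statement 1 is an averaging argument. The constants are invariant polynomial functions, coming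
from the empty partition, so the trivial representation occurs once exactly when every `G`-invariant
polynomial function is constant (`InvariantsConstant`). If so, the sum of the `G`-translates of `f`
is constant, and comparing its integral with its sum over an orbit gives the design identity.
Conversely, an invariant `f` is constant on each orbit, so the design identity equates each of its
values with its integral (`invariantsConstant_iff_isVexillarDesign`).

For statement 2, multiplicity one in the external sum means that no `S^[μ](ℝⁿ)` with `μ ≠ ∅` and
`n_μ ≠ 0` has a nonzero `G`-fixed vector (`NoFixedVectors`). This gives `InvariantsConstant` by
averaging `v` in `φ(v ⊗ w)`. Conversely, a fixed `v` and a nonzero `w ∈ N^μ` give an invariant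
function `φ(v ⊗ w)`, which is then constant, and `v = 0` has to be deduced
(`eq_zero_of_schurPoly_const`). As `2m ≤ n`, the frame `E` of the first `m` basis vectors and the
frame `E'` of the last `m` are orthogonal, so `aE + bE'` is a frame whenever `a² + b² = 1`. A form
of positive degree that is constant on this circle vanishes at the isotropic matrix `Z = E + iE'`.
Rotating by `g ∈ O(n)`, one finds `v` orthogonal to every `g Z w`. Now `Z w` is traceless because
`ZᵀZ = 0`, and nonzero because `EᵀZ = 1`; irreducibility of the traceless module excludes this
unless `v = 0`.

Irreducibility enters in the following form: two nonzero `O(n)`-stable subspaces of `weylModule`, a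
space containing the complexified `S^[μ](ℝⁿ)`, are never orthogonal
(`IsOrthogonalStable.exists_star_dotProduct_ne_zero`). A unitary change of basis makes the form
split, so that tableaux become weight vectors. A stable subspace contains a highest weight vector,
found by minimising the sum of the entries of the tableaux. The Casimir operator is a scalar on
`weylModule` (`casimir_eq_smul`), and its value separates dominant weights comparable in the
dominance order (`eq_of_casimirValue_eq`), so the highest weight is `μ`. Alternation along columns
then determines the vector up to a factor (`exists_mem_isRowTab`): both subspaces contain the same
line. -/

namespace Vexillar

/-! ### Frames of flags, and functions on flags read on frames. -/

section FlagVariety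

variable {n : ℕ} {s : FlagShape n}

/-- Orthonormal vectors adapted to the smallest spaces of a flag. -/
theorem Flag.exists_adapted_orthonormal (Δ : Flag s) (i : Fin (s.len + 1)) :
    ∃ v : Fin (s.dim i) → EuclideanSpace ℝ (Fin n), Orthonormal ℝ v ∧
      ∀ j, i ≤ j → Submodule.span ℝ (v '' {k | (k : ℕ) < s.dim j}) =
        (Δ.space j).comap (WithLp.linearEquiv 2 ℝ (Fin n → ℝ)).toLinearMap := by
  have hfin : ∀ j, Module.finrank ℝ
      ((Δ.space j).comap (WithLp.linearEquiv 2 ℝ (Fin n → ℝ)).toLinearMap) = s.dim j := fun j => by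
    rw [← Δ.finrank_eq j]
    exact LinearEquiv.finrank_eq
      (((WithLp.linearEquiv 2 ℝ (Fin n → ℝ)).ofSubmodule' (Δ.space j)))
  have hspan : ∀ j, ∀ b : OrthonormalBasis (Fin (s.dim j)) ℝ
      ((Δ.space j).comap (WithLp.linearEquiv 2 ℝ (Fin n → ℝ)).toLinearMap),
      Submodule.span ℝ ((fun k => (b k : EuclideanSpace ℝ (Fin n))) ''
        {k | (k : ℕ) < s.dim j}) =
        (Δ.space j).comap (WithLp.linearEquiv 2 ℝ (Fin n → ℝ)).toLinearMap := fun j b => by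
    have h1 : ((fun k => (b k : EuclideanSpace ℝ (Fin n))) '' {k | (k : ℕ) < s.dim j}) =
        (Submodule.subtype _) '' (Set.range b) := by
      rw [← Set.range_comp, ← Set.image_univ]
      congr 1
      ext k; simp
    rw [h1, Submodule.span_image, ← b.coe_toBasis, b.toBasis.span_eq, Submodule.map_top,
      Submodule.range_subtype]
  have horth : ∀ j, ∀ b : OrthonormalBasis (Fin (s.dim j)) ℝ
      ((Δ.space j).comap (WithLp.linearEquiv 2 ℝ (Fin n → ℝ)).toLinearMap),
      Orthonormal ℝ (fun k => (b k : EuclideanSpace ℝ (Fin n))) := fun j b => by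
    rw [orthonormal_iff_ite]
    intro k l
    rw [← Submodule.coe_inner]
    exact orthonormal_iff_ite.1 b.orthonormal k l
  -- The smallest space has the last index; each step extends the orthonormal family to a basis of
  -- the next larger space.
  induction i using Fin.reverseInduction with
  | last =>
    refine ⟨fun k => ((stdOrthonormalBasis ℝ ((Δ.space (Fin.last s.len)).comap
      (WithLp.linearEquiv 2 ℝ (Fin n → ℝ)).toLinearMap)).reindex (finCongr (hfin _)) k),
      ?_, ?_⟩
    · exact horth _ _
    · intro j hj
      obtain rfl : j = Fin.last s.len := le_antisymm (Fin.le_last j) hj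
      exact hspan _ _
  | cast i ih =>
    obtain ⟨v, hv, hvs⟩ := ih
    have hlt : s.dim i.succ < s.dim i.castSucc := s.strictAnti (Fin.castSucc_lt_succ)
    have hmem : ∀ k, v k ∈ (Δ.space i.castSucc).comap
        (WithLp.linearEquiv 2 ℝ (Fin n → ℝ)).toLinearMap := fun k => by
      have : v k ∈ (Δ.space i.succ).comap (WithLp.linearEquiv 2 ℝ (Fin n → ℝ)).toLinearMap := by
        rw [← hvs _ le_rfl]
        exact Submodule.subset_span ⟨k, k.2, rfl⟩
      exact Δ.antitone (Fin.castSucc_lt_succ).le this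
    -- Only the first `s.dim i.succ` vectors are prescribed; the value 0 is a filler outside the set
    -- where orthonormality is required.
    let u : Fin (s.dim i.castSucc) → ((Δ.space i.castSucc).comap
        (WithLp.linearEquiv 2 ℝ (Fin n → ℝ)).toLinearMap) := fun k =>
      if h : (k : ℕ) < s.dim i.succ then ⟨v ⟨k, h⟩, hmem _⟩ else 0
    have hu : Orthonormal ℝ (Set.domRestrict
        {k : Fin (s.dim i.castSucc) | (k : ℕ) < s.dim i.succ} u) := by
      rw [orthonormal_iff_ite]
      rintro ⟨a, ha⟩ ⟨b, hb⟩
      have := (orthonormal_iff_ite.1 hv) ⟨a, ha⟩ ⟨b, hb⟩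
      have hu' : ∀ (c : Fin (s.dim i.castSucc)) (hc : (c : ℕ) < s.dim i.succ),
          u c = ⟨v ⟨c, hc⟩, hmem _⟩ := fun c hc => dif_pos hc
      change inner ℝ (u a) (u b) = _
      rw [hu' a ha, hu' b hb, Submodule.coe_inner, this]
      simp [Fin.ext_iff]
    obtain ⟨b, hb⟩ := hu.exists_orthonormalBasis_extension_of_card_eq
      (by rw [hfin, Fintype.card_fin])
    refine ⟨fun k => (b k : EuclideanSpace ℝ (Fin n)), ?_, ?_⟩
    · exact horth _ b
    · intro j hj
      rcases hj.eq_or_lt with rfl | hj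
      · exact hspan _ _
      · have hj' : i.succ ≤ j := Fin.castSucc_lt_iff_succ_le.1 hj
        rw [← hvs j hj']
        have hd : s.dim j ≤ s.dim i.succ := s.strictAnti.antitone hj'
        congr 1
        ext x
        constructor
        · rintro ⟨k, hk, rfl⟩
          have hk' : (k : ℕ) < s.dim i.succ := lt_of_lt_of_le hk hd
          refine ⟨⟨k, hk'⟩, hk, ?_⟩
          simp [hb k hk', u, hk']
        · rintro ⟨k, hk, rfl⟩
          refine ⟨⟨k, k.2.trans hlt⟩, hk, ?_⟩
          have := hb ⟨k, k.2.trans hlt⟩ k.2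
          simp [this, u]

theorem Flag.ofFrame_surjective : Function.Surjective (Flag.ofFrame (s := s)) := by
  intro Δ
  obtain ⟨v, hv, hvs⟩ := Δ.exists_adapted_orthonormal 0
  refine ⟨⟨Matrix.of fun i (j : Fin s.top) => v j i, ?_⟩, ?_⟩
  · ext j k
    have := (orthonormal_iff_ite.1 hv) j k
    rw [PiLp.inner_apply] at this
    rw [Matrix.mul_apply, Matrix.one_apply]
    refine Eq.trans (Finset.sum_congr rfl fun i _ => ?_) this
    exact mul_comm _ _
  · refine Flag.ext (funext fun i => ?_)
    have h := congrArg (Submodule.map (WithLp.linearEquiv 2 ℝ (Fin n → ℝ)).toLinearMap)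
      (hvs i (Fin.zero_le i))
    rw [Submodule.map_comap_eq_of_surjective (WithLp.linearEquiv 2 ℝ (Fin n → ℝ)).surjective,
      ← Submodule.span_image, ← Set.image_comp] at h
    rw [← h]
    change Submodule.span ℝ _ = _
    congr 1
    ext x
    constructor
    · rintro ⟨⟨j, hj⟩, rfl⟩
      exact ⟨j, hj, rfl⟩
    · rintro ⟨j, hj, rfl⟩
      exact ⟨⟨j, hj⟩, rfl⟩

/-- `X Xᵀ` is the orthogonal projection onto `V_1`, the span of all the columns since `d_1 = m`; it
fixes the columns of any other frame of the same flag. -/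
theorem Frame.mul_transpose_mul_of_span_le (X X' : Frame s)
    (h : ∀ i, X'.span i = X.span i) : X.1 * (X.1ᵀ * X'.1) = X'.1 := by
  ext a k
  have hk : X'.1.col k ∈ X.span 0 := by
    rw [← h 0]
    exact Submodule.subset_span ⟨⟨k, k.2⟩, rfl⟩
  have hP : ∀ y ∈ X.span 0, X.1 *ᵥ (X.1ᵀ *ᵥ y) = y := by
    intro y hy
    have hle : X.span 0 ≤ LinearMap.eqLocus
        ((Matrix.mulVecLin X.1) ∘ₗ (Matrix.mulVecLin X.1ᵀ)) LinearMap.id := by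
      refine Submodule.span_le.2 ?_
      rintro _ ⟨j, rfl⟩
      change X.1 *ᵥ (X.1ᵀ *ᵥ X.1.col j) = X.1.col j
      have : X.1.col j = X.1 *ᵥ Pi.single (j : Fin s.top) 1 := by simp
      rw [this, Matrix.mulVec_mulVec _ X.1ᵀ, show X.1ᵀ * X.1 = 1 from X.2, Matrix.one_mulVec]
    exact hle hy
  have := congrFun (hP _ hk) a
  rw [Matrix.mulVec_mulVec] at this
  rw [← Matrix.mul_assoc]
  exact this

/-- Two frames that mark the same flag differ by a block diagonal orthogonal matrix. -/
theorem Frame.exists_isBlockDiagonal (X X' : Frame s) (h : Flag.ofFrame X = Flag.ofFrame X') :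
    ∃ g : O s.top, IsBlockDiagonal s g ∧
      X'.1 = X.1 * (g : Matrix (Fin s.top) (Fin s.top) ℝ) := by
  have hs : ∀ i, X'.span i = X.span i := fun i => (congrFun (congrArg Flag.space h) i).symm
  have hX := X.mul_transpose_mul_of_span_le X' hs
  -- The columns of index at least `d_i` are orthogonal to `V_i`. Used for both frames, this kills
  -- the entries of `XᵀX'` on either side of the block diagonal.
  have horth : ∀ (Y : Frame s) (i) (k : Fin s.top), ¬ ((k : ℕ) < s.dim i) → ∀ y ∈ Y.span i,
      Y.1.col k ⬝ᵥ y = 0 := by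
    intro Y i k hk y hy
    induction hy using Submodule.span_induction with
    | mem y hy =>
      obtain ⟨⟨j, hj⟩, rfl⟩ := hy
      have := congrFun (congrFun Y.2 k) j
      rw [Matrix.one_apply_ne (by rintro rfl; exact hk hj)] at this
      exact this
    | zero => simp
    | add y z _ _ hy hz => rw [dotProduct_add, hy, hz, add_zero]
    | smul c y _ hy => rw [dotProduct_smul, hy, smul_zero]
  refine ⟨⟨X.1ᵀ * X'.1, ?_⟩, ?_, hX.symm⟩
  · refine Matrix.mem_unitaryGroup_iff'.2 ?_
    change (X.1ᵀ * X'.1)ᵀ * (X.1ᵀ * X'.1) = 1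
    rw [Matrix.transpose_mul, Matrix.transpose_transpose, Matrix.mul_assoc, hX, X'.2]
  · rintro j k ⟨i, hi⟩
    change (X.1ᵀ * X'.1) j k = 0
    have he : (X.1ᵀ * X'.1) j k = X.1.col j ⬝ᵥ X'.1.col k := rfl
    rw [he]
    by_cases hj : (j : ℕ) < s.dim i
    · have hk : ¬ (k : ℕ) < s.dim i := fun hk => hi (by simp [hj, hk])
      rw [dotProduct_comm]
      refine horth X' i k hk _ ?_
      rw [hs]
      exact Submodule.subset_span ⟨⟨j, hj⟩, rfl⟩
    · have hk : (k : ℕ) < s.dim i := by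
        by_contra hk; exact hi (by simp [hj, hk])
      refine horth X i j hj _ ?_
      rw [← hs]
      exact Submodule.subset_span ⟨⟨k, hk⟩, rfl⟩

variable {μ : YoungDiagram}

theorem continuous_schurPoly {k : ℕ} (v : Tensor μ n) (w : Tensor μ k) :
    Continuous (schurPoly v w) := by
  unfold schurPoly tensorMap
  simp only [LinearMap.coe_mk, AddHom.coe_mk]
  fun_prop

theorem continuous_of_mem_polyComponent {P : Matrix (Fin n) (Fin s.top) ℝ → ℝ}
    (hP : P ∈ polyComponent s μ) : Continuous P := by
  induction hP using Submodule.span_induction with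
  | mem P h => obtain ⟨v, _, w, _, rfl⟩ := h; exact continuous_schurPoly v w
  | zero => exact continuous_const
  | add P Q _ _ hP hQ => exact hP.add hQ
  | smul c P _ hP => exact hP.const_smul c

theorem exists_continuous_of_mem_flagPolynomials {t : ℕ} {f : Flag s → ℝ}
    (hf : f ∈ flagPolynomials s t) :
    ∃ P : Matrix (Fin n) (Fin s.top) ℝ → ℝ, Continuous P ∧
      ∀ X : Frame s, f (Flag.ofFrame X) = P X.1 := by
  unfold flagPolynomials at hf
  induction hf using Submodule.iSup_induction' with
  | mem μ f h =>
    obtain ⟨P, hP, h⟩ := h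
    exact ⟨P, continuous_of_mem_polyComponent hP, h⟩
  | zero => exact ⟨0, continuous_const, fun _ => rfl⟩
  | add f g _ _ hf hg =>
    obtain ⟨P, hP, h⟩ := hf
    obtain ⟨Q, hQ, h'⟩ := hg
    exact ⟨P + Q, hP.add hQ, fun X => by simp [h, h']⟩

/-- The function induced on the flag variety by `φ(v ⊗ w)`. -/
theorem exists_flagComponent_eq {v : Tensor μ n} (hv : v ∈ orthSchur μ n) {w : Tensor μ s.top}
    (hw : w ∈ blockInvariants s μ) :
    ∃ f ∈ flagComponent s μ, ∀ X : Frame s, f (Flag.ofFrame X) = schurPoly v w X.1 := by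
  have key : ∀ X : Frame s, schurPoly v w
      (Function.surjInv Flag.ofFrame_surjective (Flag.ofFrame X)).1 = schurPoly v w X.1 := by
    intro X
    obtain ⟨g, hg, h⟩ := Frame.exists_isBlockDiagonal X _
      (Function.surjInv_eq Flag.ofFrame_surjective (Flag.ofFrame X)).symm
    rw [h]
    -- The change of frame is absorbed by `w`, so the value depends on the flag only.
    have hgw : tensorMap μ (g : Matrix (Fin s.top) (Fin s.top) ℝ) w = w := hw.2 g hg
    simp only [schurPoly, tensorMap_mul, LinearMap.comp_apply, hgw]
  exact ⟨fun Δ => schurPoly v w (Function.surjInv Flag.ofFrame_surjective Δ).1,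
    ⟨_, Submodule.subset_span ⟨v, hv, w, hw, rfl⟩, key⟩, key⟩

end FlagVariety

/-! ### Integration over the flag variety by means of Haar measure. -/

section Integration

variable {n : ℕ} {s : FlagShape n} {t : ℕ}

instance : IsProbabilityMeasure (haarO n) :=
  ⟨by
    have : (⊤ : TopologicalSpace.PositiveCompacts (O n)) = (Set.univ : Set (O n)) := rfl
    rw [haarO, ← this, Measure.haarMeasure_self]⟩

instance : Measure.IsMulLeftInvariant (haarO n) :=
  inferInstanceAs (Measure.IsMulLeftInvariant (Measure.haarMeasure ⊤))

theorem measurable_smul_standard : Measurable fun g : O n => g • Flag.standard s :=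
  fun _ h => h

theorem continuous_comp_smul_standard {f : Flag s → ℝ} (hf : f ∈ flagPolynomials s t) :
    Continuous fun g : O n => f (g • Flag.standard s) := by
  obtain ⟨P, hP, h⟩ := exists_continuous_of_mem_flagPolynomials hf
  have : (fun g : O n => f (g • Flag.standard s)) = fun g : O n =>
      P ((g : Matrix (Fin n) (Fin n) ℝ) * (Frame.standard s).1) := by
    funext g
    rw [Flag.standard, Flag.smul_ofFrame, h]
    rfl
  rw [this]
  exact hP.comp (continuous_subtype_val.matrix_mul continuous_const)

theorem integral_flagMeasure {f : Flag s → ℝ} (hf : f ∈ flagPolynomials s t) :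
    ∫ Δ, f Δ ∂(flagMeasure s) = ∫ g, f (g • Flag.standard s) ∂(haarO n) := by
  -- The σ-algebra on flags is the quotient one, so measurability of the pullback to `O(n)` is
  -- enough.
  have hm : Measurable f := fun _ hS => (continuous_comp_smul_standard hf).measurable hS
  exact integral_map measurable_smul_standard.aemeasurable hm.aestronglyMeasurable

theorem integrable_comp_inv_smul {f : Flag s → ℝ} (hf : f ∈ flagPolynomials s t) (g : O n) :
    Integrable (fun h : O n => f (g⁻¹ • h • Flag.standard s)) (haarO n) := by
  have hc : Continuous fun h : O n => f (g⁻¹ • h • Flag.standard s) := by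
    simp only [← mul_smul]
    exact (continuous_comp_smul_standard hf).comp (continuous_const_mul g⁻¹)
  exact hc.integrable_of_hasCompactSupport (HasCompactSupport.of_compactSpace _)

theorem integral_flagFunctionRep {f : Flag s → ℝ} (hf : f ∈ flagPolynomials s t) (g : O n) :
    ∫ h, f (g⁻¹ • h • Flag.standard s) ∂(haarO n) = ∫ Δ, f Δ ∂(flagMeasure s) := by
  rw [integral_flagMeasure hf]
  simp only [← mul_smul]
  exact integral_mul_left_eq_self (fun h : O n => f (h • Flag.standard s)) g⁻¹

instance : IsProbabilityMeasure (flagMeasure s) :=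
  Measure.isProbabilityMeasure_map measurable_smul_standard.aemeasurable

end Integration

end Vexillar

namespace Vexillar

/-! ### The empty partition, which contributes the constants. -/

section EmptyDiagram

instance : IsEmpty (Box ⊥) := ⟨fun b => Finset.notMem_empty _ b.2⟩

theorem schur_bot (k : ℕ) : schur ⊥ k = ⊤ := by
  have h : ∀ t : Tensor ⊥ k, (colAlt ⊥ k ∘ₗ rowSym ⊥ k) t = t := fun t => by
    funext T
    simp [colAlt, rowSym, permMap, Finset.filter_true_of_mem, LinearMap.funLeft_apply]
  exact LinearMap.range_eq_top.2 fun t => ⟨t, h t⟩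

theorem orthSchur_bot (k : ℕ) : orthSchur ⊥ k = ⊤ := by
  rw [orthSchur, schur_bot, top_inf_eq, eq_top_iff]
  exact fun t _ b => isEmptyElim b

theorem tensorMap_bot {k l : ℕ} (A : Matrix (Fin k) (Fin l) ℝ) (t : Tensor ⊥ l) (T : Box ⊥ → Fin k)
    (S : Box ⊥ → Fin l) : tensorMap ⊥ A t T = t S := by
  simp only [tensorMap, LinearMap.coe_mk, AddHom.coe_mk, Fintype.sum_unique, Finset.univ_eq_empty,
    Finset.prod_empty, one_mul]
  congr 1
  exact Subsingleton.elim _ _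

theorem blockInvariants_bot {n : ℕ} (s : FlagShape n) : blockInvariants s ⊥ = ⊤ := by
  rw [eq_top_iff]
  refine fun t _ => ⟨by simp [schur_bot], fun h _ => ?_⟩
  funext T
  exact tensorMap_bot _ _ _ _

theorem finrank_tensor_bot (k : ℕ) : Module.finrank ℝ (Tensor ⊥ k) = 1 := by
  rw [Module.finrank_fintype_fun_eq_card, Fintype.card_unique]

theorem blockMult_bot {n : ℕ} (s : FlagShape n) : blockMult s ⊥ = 1 := by
  rw [blockMult, blockInvariants_bot, finrank_top, finrank_tensor_bot]

theorem schurPoly_bot {n k : ℕ} (v : Tensor ⊥ n) (w : Tensor ⊥ k) (X X' : Matrix (Fin n) (Fin k) ℝ) :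
    schurPoly v w X = schurPoly v w X' := by
  simp only [schurPoly]
  exact Finset.sum_congr rfl fun T _ => by
    rw [tensorMap_bot X w T isEmptyElim, tensorMap_bot X' w T isEmptyElim]

end EmptyDiagram

/-! ### Orbits are designs exactly when the invariants are constant. -/

section Designs

variable {n : ℕ} {s : FlagShape n} {t : ℕ}

theorem const_mem_flagPolynomials (c : ℝ) : (fun _ : Flag s => c) ∈ flagPolynomials s t := by
  refine Submodule.mem_iSup_of_mem (⟨⊥, Nat.zero_le t, ?_⟩ : Shapes s t) ?_
  · rw [YoungDiagram.colLen_eq_card]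
    simp [YoungDiagram.col]
  · refine ⟨schurPoly (fun _ => c) (fun _ => 1), Submodule.subset_span
      ⟨_, by simp [orthSchur_bot], _, by simp [blockInvariants_bot], rfl⟩, fun X => ?_⟩
    simp only [schurPoly, Fintype.sum_unique]
    rw [tensorMap_bot _ _ _ isEmptyElim, mul_one]

/-- The only polynomial functions of degree at most `t` invariant under `G` are the constants. -/
def InvariantsConstant (s : FlagShape n) (t : ℕ) (G : Subgroup (O n)) : Prop :=
  ∀ f ∈ flagPolynomials s t, (∀ g ∈ G, ∀ Δ, f (g • Δ) = f Δ) → ∀ Δ Δ', f Δ = f Δ'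

variable {G : Subgroup (O n)}

/-- The function 1 is a nonzero invariant, so the dimension is one exactly when all invariants are
its multiples. -/
theorem trivialMult_flagPolynomialRep_eq_one_iff :
    trivialMult ((flagPolynomialRep s t).comp G.subtype) = 1 ↔ InvariantsConstant s t G := by
  have hinv : ∀ x : flagPolynomials s t,
      x ∈ Representation.invariants ((flagPolynomialRep s t).comp G.subtype) ↔
        ∀ g ∈ G, ∀ Δ, x.1 (g • Δ) = x.1 Δ := by
    intro x
    constructor
    · intro h g hg Δ
      have := congrFun (congrArg Subtype.val (h (⟨g, hg⟩⁻¹ : G))) Δ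
      change x.1 ((g⁻¹)⁻¹ • Δ) = x.1 Δ at this
      rwa [inv_inv] at this
    · intro h g
      refine Subtype.ext (funext fun Δ => ?_)
      exact h g⁻¹ (inv_mem g.2) Δ
  let e : Representation.invariants ((flagPolynomialRep s t).comp G.subtype) :=
    ⟨⟨fun _ => 1, const_mem_flagPolynomials 1⟩, (hinv _).2 fun _ _ _ => rfl⟩
  have he : e ≠ 0 := fun h => by
    have := congrFun (congrArg (fun x => x.1.1) h) (Flag.standard s)
    exact one_ne_zero (α := ℝ) this
  rw [trivialMult, finrank_eq_one_iff_of_nonzero' e he]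
  constructor
  · intro h f hf hG Δ Δ'
    obtain ⟨c, hc⟩ := h ⟨⟨f, hf⟩, (hinv _).2 hG⟩
    have hf' : f = fun _ => c * 1 := (congrArg (fun x => x.1.1) hc).symm
    rw [hf']
  · intro h w
    refine ⟨w.1.1 (Flag.standard s), Subtype.ext (Subtype.ext (funext fun Δ => ?_))⟩
    change w.1.1 (Flag.standard s) * 1 = w.1.1 Δ
    rw [mul_one]
    exact h w.1.1 w.1.2 ((hinv _).1 w.2) _ _

theorem finsum_mem_orbit_smul {H α : Type*} [Group H] [MulAction H α] (g : H) (x : α)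
    (f : α → ℝ) : ∑ᶠ y ∈ MulAction.orbit H x, f (g • y) = ∑ᶠ y ∈ MulAction.orbit H x, f y := by
  refine finsum_mem_eq_of_bijOn (fun y => g • y) ⟨?_, ?_, ?_⟩ fun _ _ => rfl
  · exact fun y hy => MulAction.mapsTo_smul_orbit g x hy
  · exact (MulAction.injective g).injOn
  · exact fun y hy => ⟨g⁻¹ • y, MulAction.mapsTo_smul_orbit g⁻¹ x hy, smul_inv_smul g y⟩

/-- Each group element permutes the orbit, so every translate of `f` has the same sum over it. -/
theorem finsum_mem_orbit_sum_inv_smul {H α : Type*} [Group H] [Fintype H] [MulAction H α] (x : α)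
    (f : α → ℝ) : ∑ᶠ y ∈ MulAction.orbit H x, ∑ g : H, f (g⁻¹ • y) =
      Fintype.card H * ∑ᶠ y ∈ MulAction.orbit H x, f y := by
  have hfin : (MulAction.orbit H x).Finite := Set.finite_range _
  have h (g : H) : ∑ y ∈ hfin.toFinset, f (g⁻¹ • y) = ∑ᶠ y ∈ MulAction.orbit H x, f y :=
    (finsum_mem_eq_finite_toFinset_sum _ hfin).symm.trans (finsum_mem_orbit_smul g⁻¹ x f)
  rw [finsum_mem_eq_finite_toFinset_sum _ hfin, Finset.sum_comm,
    Finset.sum_congr rfl fun g _ => h g, Finset.sum_const, nsmul_eq_mul, Finset.card_univ]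

theorem invariantsConstant_iff_isVexillarDesign [Finite G] :
    InvariantsConstant s t G ↔ ∀ Δ₀ : Flag s, IsVexillarDesign s t (MulAction.orbit G Δ₀) := by
  classical
  have := Fintype.ofFinite G
  have hfin : ∀ Δ₀ : Flag s, (MulAction.orbit G Δ₀).Finite := fun Δ₀ => Set.finite_range _
  have hcard : ∀ Δ₀ : Flag s, ((MulAction.orbit G Δ₀).ncard : ℝ) ≠ 0 := fun Δ₀ => by
    exact Nat.cast_ne_zero.2
      (Set.ncard_ne_zero_of_mem (MulAction.mem_orbit_self (M := G) Δ₀) (hfin Δ₀))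
  have hconst : ∀ (Δ₀ : Flag s) (f : Flag s → ℝ) (c : ℝ), (∀ Δ ∈ MulAction.orbit G Δ₀, f Δ = c) →
      ∑ᶠ Δ ∈ MulAction.orbit G Δ₀, f Δ = (MulAction.orbit G Δ₀).ncard * c := by
    intro Δ₀ f c h
    rw [finsum_mem_congr rfl h, finsum_mem_eq_finite_toFinset_sum _ (hfin Δ₀), Finset.sum_const,
      Set.ncard_eq_toFinset_card _ (hfin Δ₀), nsmul_eq_mul]
  constructor
  · intro h Δ₀
    refine ⟨hfin Δ₀, fun f hf => ?_⟩
    -- `F` is the sum over `G`, not the average; the factor `|G|` appears in both the integral and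
    -- the orbit sum and is cancelled.
    let F : Flag s → ℝ := ∑ g : G, flagFunctionRep s g f
    have hFg : ∀ g : G, flagFunctionRep s g f ∈ flagPolynomials s t := fun g =>
      (flagPolynomialRep s t g ⟨f, hf⟩).2
    have hF : F ∈ flagPolynomials s t := Submodule.sum_mem _ fun g _ => hFg g
    have hFapp : ∀ Δ, F Δ = ∑ g : G, f ((g : O n)⁻¹ • Δ) := fun Δ => by
      simp only [F, Finset.sum_apply]; rfl
    have hFinv : ∀ g ∈ G, ∀ Δ, F (g • Δ) = F Δ := by
      intro g hg Δ
      rw [hFapp, hFapp]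
      refine Fintype.sum_equiv (Equiv.mulLeft (⟨g, hg⟩⁻¹ : G)) _ _ fun x => ?_
      rw [smul_smul]
      congr 2
      simp
    have hFc : ∀ Δ, F Δ = F (Flag.standard s) := fun Δ => h F hF hFinv _ _
    have hint : ∫ Δ, F Δ ∂(flagMeasure s) = Fintype.card G * ∫ Δ, f Δ ∂(flagMeasure s) := by
      rw [integral_flagMeasure hF]
      simp only [hFapp]
      rw [integral_finsetSum]
      · have h1 : ∀ g : G, ∫ h, f ((g : O n)⁻¹ • h • Flag.standard s) ∂(haarO n) =
            ∫ Δ, f Δ ∂(flagMeasure s) := fun g => integral_flagFunctionRep hf g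
        rw [Finset.sum_congr rfl fun g _ => h1 g, Finset.sum_const, nsmul_eq_mul, Finset.card_univ]
      · intro g _
        exact integrable_comp_inv_smul hf (g : O n)
    have hsum : ∑ᶠ Δ ∈ MulAction.orbit G Δ₀, F Δ =
        Fintype.card G * ∑ᶠ Δ ∈ MulAction.orbit G Δ₀, f Δ :=
      (finsum_mem_congr rfl fun Δ _ => hFapp Δ).trans (finsum_mem_orbit_sum_inv_smul Δ₀ f)
    have hG : (Fintype.card G : ℝ) ≠ 0 := Nat.cast_ne_zero.2 Fintype.card_ne_zero
    refine mul_left_cancel₀ hG ?_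
    rw [← hint, mul_left_comm, ← hsum, hconst Δ₀ F (F (Flag.standard s)) fun Δ _ => hFc Δ,
      ← mul_assoc, one_div, inv_mul_cancel₀ (hcard Δ₀), one_mul]
    simp [hFc]
  · intro h f hf hG
    -- The invariant `f` is constant on the orbit of `Δ₀`, so its average there is `f Δ₀`.
    have : ∀ Δ₀, f Δ₀ = ∫ Δ, f Δ ∂(flagMeasure s) := by
      intro Δ₀
      rw [(h Δ₀).2 f hf, hconst Δ₀ f (f Δ₀), ← mul_assoc, one_div, inv_mul_cancel₀ (hcard Δ₀),
        one_mul]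
      rintro _ ⟨g, rfl⟩
      exact hG g g.2 Δ₀
    intro Δ Δ'
    rw [this Δ, this Δ']

end Designs

end Vexillar

noncomputable section

namespace Vexillar

/-! ### Fixed vectors in the external direct sum. -/

section ExternalSum

variable {n : ℕ} {s : FlagShape n} {t : ℕ} {G : Subgroup (O n)}

/-- No `S^[μ](ℝⁿ)` occurring in degree at most `t`, other than that of the empty partition,
contains a nonzero vector fixed by `G`. -/
def NoFixedVectors (s : FlagShape n) (t : ℕ) (G : Subgroup (O n)) : Prop :=
  ∀ μ : Shapes s t, μ.1 ≠ ⊥ → blockMult s μ.1 ≠ 0 → ∀ v ∈ orthSchur μ.1 n,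
    (∀ g ∈ G, tensorMap μ.1 (g : Matrix (Fin n) (Fin n) ℝ) v = v) → v = 0

/-- The empty partition, as an index of the sum. -/
def botShape (s : FlagShape n) (t : ℕ) : Shapes s t :=
  ⟨⊥, Nat.zero_le t, by rw [YoungDiagram.colLen_eq_card]; simp [YoungDiagram.col]⟩

/-- The components of an element of the external direct sum. -/
def SchurSum.coord (x : SchurSum s t) (i : Σ μ : Shapes s t, Fin (blockMult s μ.1)) :
    orthSchur i.1.1 n :=
  DFunLike.coe (F := ⨁ i : (Σ μ : Shapes s t, Fin (blockMult s μ.1)), orthSchur i.1.1 n) x i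

theorem SchurSum.ext {x y : SchurSum s t} (h : ∀ i, x.coord i = y.coord i) : x = y :=
  DFinsupp.ext h

theorem mem_invariants_schurSumRep (x : SchurSum s t) :
    x ∈ Representation.invariants ((schurSumRep s t).comp G.subtype) ↔
      ∀ i, ∀ g ∈ G, tensorMap i.1.1 (g : Matrix (Fin n) (Fin n) ℝ) (x.coord i) =
          (x.coord i : Tensor i.1.1 n) := by
  constructor
  · intro h i g hg
    exact congrArg (fun y : SchurSum s t => (y.coord i : Tensor i.1.1 n)) (h ⟨g, hg⟩)
  · intro h g
    refine SchurSum.ext fun i => Subtype.ext ?_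
    exact h i g g.2

/-- The empty partition contributes exactly one fixed line, so multiplicity one leaves no room for
fixed vectors in the other summands. -/
theorem trivialMult_schurSumRep_eq_one_iff :
    trivialMult ((schurSumRep s t).comp G.subtype) = 1 ↔ NoFixedVectors s t G := by
  classical
  let V : (Σ μ : Shapes s t, Fin (blockMult s μ.1)) → Type := fun i => orthSchur i.1.1 n
  have hb : 0 < blockMult s (botShape s t).1 := by
    rw [botShape, blockMult_bot]; exact Nat.one_pos
  let i₀ : Σ μ : Shapes s t, Fin (blockMult s μ.1) := ⟨botShape s t, ⟨0, hb⟩⟩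
  let e₀ : orthSchur i₀.1.1 n := ⟨fun _ => 1, by
    change _ ∈ orthSchur ⊥ n
    rw [orthSchur_bot]; trivial⟩
  let x₀ : SchurSum s t := DirectSum.of (fun i : (Σ μ : Shapes s t, Fin (blockMult s μ.1)) =>
    orthSchur i.1.1 n) i₀ e₀
  have hx₀ : x₀.coord i₀ = e₀ := DirectSum.of_eq_same _ _
  have hx₀' : ∀ i, i ≠ i₀ → x₀.coord i = 0 := fun i hi => DirectSum.of_eq_of_ne _ _ _ hi
  have hbot : ∀ (g : O n) (u : Tensor ⊥ n), tensorMap ⊥ (g : Matrix (Fin n) (Fin n) ℝ) u = u :=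
    fun g u => funext fun T => tensorMap_bot _ _ _ _
  have hinv₀ : x₀ ∈ Representation.invariants ((schurSumRep s t).comp G.subtype) := by
    rw [mem_invariants_schurSumRep]
    intro i g _
    by_cases hi : i = i₀
    · subst hi
      exact hbot g _
    · rw [hx₀' i hi]; exact map_zero _
  have hne : (⟨x₀, hinv₀⟩ :
      Representation.invariants ((schurSumRep s t).comp G.subtype)) ≠ 0 := fun h => by
    have h1 : x₀.coord i₀ = 0 := congrArg (fun y => y.1.coord i₀) h
    rw [hx₀] at h1
    exact one_ne_zero (α := ℝ) (congrFun (congrArg Subtype.val h1) fun b : Box ⊥ => isEmptyElim b)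
  rw [trivialMult, finrank_eq_one_iff_of_nonzero' _ hne]
  constructor
  · intro h μ hμ hm v hv hG
    let i : Σ μ : Shapes s t, Fin (blockMult s μ.1) := ⟨μ, ⟨0, Nat.pos_of_ne_zero hm⟩⟩
    have hi : i ≠ i₀ := fun h => hμ (congrArg (fun j => j.1.1) h)
    let x : SchurSum s t := DirectSum.of (fun i : (Σ μ : Shapes s t, Fin (blockMult s μ.1)) =>
      orthSchur i.1.1 n) i ⟨v, hv⟩
    have hxi : x.coord i = ⟨v, hv⟩ := DirectSum.of_eq_same _ _
    have hx : x ∈ Representation.invariants ((schurSumRep s t).comp G.subtype) := by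
      rw [mem_invariants_schurSumRep]
      intro j g hg
      by_cases hj : j = i
      · subst hj
        rw [hxi]
        exact hG g hg
      · rw [show x.coord j = 0 from DirectSum.of_eq_of_ne _ _ _ hj]; exact map_zero _
    obtain ⟨c, hc⟩ := h ⟨x, hx⟩
    have h1 : c • x₀.coord i = x.coord i := congrArg (fun y => y.1.coord i) hc
    rw [hx₀' i hi, smul_zero, hxi] at h1
    exact (congrArg Subtype.val h1).symm
  · intro h w
    refine ⟨(w.1.coord i₀).1 fun b : Box ⊥ => isEmptyElim b, Subtype.ext (SchurSum.ext fun i => ?_)⟩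
    change (_ : ℝ) • x₀.coord i = w.1.coord i
    by_cases hi : i = i₀
    · subst hi
      rw [hx₀]
      refine Subtype.ext (funext fun T => ?_)
      change ((w.1.coord i₀).1 fun b : Box ⊥ => isEmptyElim b) * 1 = (w.1.coord i₀).1 T
      rw [mul_one]
      exact congrArg (w.1.coord i₀).1 (Subsingleton.elim (α := Box ⊥ → Fin n) _ _)
    · rw [hx₀' i hi, smul_zero]
      have hμ : i.1.1 ≠ ⊥ := by
        obtain ⟨⟨μ, hμ⟩, k⟩ := i
        rintro rfl
        refine hi ?_
        -- As `n_∅ = 1`, the empty partition has a single index in the sum.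
        have hk : (k : ℕ) = 0 := by
          have := k.2
          have h1 : blockMult s ⊥ = 1 := blockMult_bot s
          simp only [h1] at this
          omega
        refine Sigma.ext rfl (heq_of_eq (Fin.ext hk))
      refine (Subtype.ext ?_).symm
      exact h i.1 hμ (Nat.ne_of_gt i.2.pos) _ (w.1.coord i).2
        ((mem_invariants_schurSumRep w.1).1 w.2 i)

/-- The group elements can be moved onto `v`, and `∑ g v` is a fixed vector of `S^[μ](ℝⁿ)`, hence
zero. -/
theorem sum_polyComponent_eq_zero [Fintype G] (h : NoFixedVectors s t G) (μ : Shapes s t)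
    (hμ : μ.1 ≠ ⊥) {P : Matrix (Fin n) (Fin s.top) ℝ → ℝ} (hP : P ∈ polyComponent s μ.1)
    (X : Matrix (Fin n) (Fin s.top) ℝ) :
    ∑ g : G, P (((g : O n) : Matrix (Fin n) (Fin n) ℝ) * X) = 0 := by
  induction hP using Submodule.span_induction with
  | mem P hP =>
    obtain ⟨v, hv, w, hw, rfl⟩ := hP
    by_cases hw0 : w = 0
    · simp [hw0, schurPoly]
    have hm : blockMult s μ.1 ≠ 0 := by
      have : Nontrivial (blockInvariants s μ.1) := ⟨⟨w, hw⟩, 0, fun h => hw0 (congrArg Subtype.val h)⟩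
      exact Module.finrank_pos.ne'
    have hinv : ∀ g : G, ((g⁻¹ : G) : O n) = (g : O n)⁻¹ := fun g => rfl
    have hfix : ∑ g : G, tensorMap μ.1 ((g : O n) : Matrix (Fin n) (Fin n) ℝ) v = 0 := by
      refine h μ hμ hm _ (Submodule.sum_mem _ fun g _ => tensorRep_mem_orthSchur _ hv) ?_
      intro g hg
      rw [map_sum]
      refine Fintype.sum_equiv (Equiv.mulLeft (⟨g, hg⟩ : G)) _ _ fun x => ?_
      exact (LinearMap.congr_fun (tensorMap_mul (μ := μ.1) (g : Matrix (Fin n) (Fin n) ℝ)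
        ((x : O n) : Matrix (Fin n) (Fin n) ℝ)) v).symm
    -- Moving `g` across the pairing transposes it; inversion of `G` reindexes the sum.
    have hT : ∑ g : G, tensorMap μ.1 ((g : O n) : Matrix (Fin n) (Fin n) ℝ)ᵀ v = 0 := by
      rw [← hfix]
      refine Fintype.sum_equiv (Equiv.inv G) _ _ fun g => ?_
      rw [Equiv.inv_apply, hinv, O.coe_inv]
    simp only [schurPoly_mul]
    have : ∀ u : Tensor μ.1 n, schurPoly u w X = ∑ T, u T * tensorMap μ.1 X w T := fun _ => rfl
    simp only [this]
    rw [Finset.sum_comm]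
    refine Finset.sum_eq_zero fun T _ => ?_
    rw [← Finset.sum_mul]
    have := congrFun hT T
    rw [Finset.sum_apply] at this
    rw [this, Pi.zero_apply, zero_mul]
  | zero => simp
  | add P Q _ _ hP hQ => simp [Finset.sum_add_distrib, hP, hQ]
  | smul c P _ hP => simp [← Finset.mul_sum, hP]

theorem polyComponent_bot_apply {P : Matrix (Fin n) (Fin s.top) ℝ → ℝ}
    (hP : P ∈ polyComponent s ⊥) (X X' : Matrix (Fin n) (Fin s.top) ℝ) : P X = P X' := by
  induction hP using Submodule.span_induction with
  | mem P hP => obtain ⟨v, _, w, _, rfl⟩ := hP; exact schurPoly_bot v w X X'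
  | zero => rfl
  | add P Q _ _ hP hQ => rw [Pi.add_apply, Pi.add_apply, hP, hQ]
  | smul c P _ hP => rw [Pi.smul_apply, Pi.smul_apply, hP]

/-- The sum of the translates of any polynomial function is constant: the part from the empty
partition is constant and the others sum to zero. For an invariant `f` this sum is `|G| f`. -/
theorem NoFixedVectors.invariantsConstant [Finite G] (h : NoFixedVectors s t G) :
    InvariantsConstant s t G := by
  have := Fintype.ofFinite G
  have hsum : ∀ f ∈ flagPolynomials s t, ∃ c : ℝ, ∀ X : Frame s,
      ∑ g : G, f ((g : O n) • Flag.ofFrame X) = c := by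
    intro f hf
    unfold flagPolynomials at hf
    induction hf using Submodule.iSup_induction' with
    | mem μ f hf =>
      obtain ⟨P, hP, hPf⟩ := hf
      have hg : ∀ (X : Frame s) (g : G), f ((g : O n) • Flag.ofFrame X) =
          P (((g : O n) : Matrix (Fin n) (Fin n) ℝ) * X.1) := fun X g => by
        rw [Flag.smul_ofFrame, hPf]; rfl
      by_cases hμ : μ.1 = ⊥
      · rw [hμ] at hP
        refine ⟨∑ g : G, P 0, fun X => Finset.sum_congr rfl fun g _ => ?_⟩
        rw [hg]
        exact polyComponent_bot_apply hP _ _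
      · refine ⟨0, fun X => ?_⟩
        rw [Finset.sum_congr rfl fun g _ => hg X g]
        exact sum_polyComponent_eq_zero h μ hμ hP X.1
    | zero => exact ⟨0, fun X => by simp⟩
    | add f f' _ _ hf hf' =>
      obtain ⟨c, hc⟩ := hf
      obtain ⟨c', hc'⟩ := hf'
      exact ⟨c + c', fun X => by simp only [Pi.add_apply, Finset.sum_add_distrib, hc, hc']⟩
  intro f hf hG
  obtain ⟨c, hc⟩ := hsum f hf
  have h1 : ∀ Δ, (Fintype.card G : ℝ) * f Δ = c := fun Δ => by
    obtain ⟨X, rfl⟩ := Flag.ofFrame_surjective Δ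
    rw [← hc X, Finset.sum_congr rfl fun (g : G) _ => hG g g.2 (Flag.ofFrame X), Finset.sum_const,
      nsmul_eq_mul, Finset.card_univ]
  intro Δ Δ'
  exact mul_left_cancel₀ (Nat.cast_ne_zero.2 Fintype.card_ne_zero) ((h1 Δ).trans (h1 Δ').symm)

/-- The converse holds as soon as no nonzero `φ(v ⊗ w)` of positive degree is constant. -/
theorem InvariantsConstant.noFixedVectors
    (hs : ∀ μ : YoungDiagram, μ ≠ ⊥ → μ.colLen 0 ≤ s.top → ∀ v ∈ orthSchur μ n,
      ∀ w ∈ schur μ s.top, ∀ c : ℝ, (∀ X : Frame s, schurPoly v w X.1 = c) → w ≠ 0 → v = 0)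
    (h : InvariantsConstant s t G) : NoFixedVectors s t G := by
  intro μ hμ hm v hv hG
  have : Nontrivial (blockInvariants s μ.1) := Module.nontrivial_of_finrank_pos
    (R := ℝ) (Nat.pos_of_ne_zero hm)
  obtain ⟨w, hw0⟩ := exists_ne (0 : blockInvariants s μ.1)
  obtain ⟨f, hf, hfX⟩ := exists_flagComponent_eq hv w.2
  have hconst := h f (Submodule.mem_iSup_of_mem μ hf) fun g hg Δ => by
    obtain ⟨X, rfl⟩ := Flag.ofFrame_surjective Δ
    rw [Flag.smul_ofFrame, hfX, hfX]
    change schurPoly v w.1 ((g : Matrix (Fin n) (Fin n) ℝ) * X.1) = _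
    rw [schurPoly_mul, ← O.coe_inv, hG _ (inv_mem hg)]
  exact hs μ.1 hμ μ.2.2 v hv w.1 w.2.1 (f (Flag.standard s))
    (fun X => by rw [← hfX, hconst _ (Flag.standard s)]) fun h0 => hw0 (Subtype.ext h0)

end ExternalSum

end Vexillar

end

namespace Vexillar

/-! ### Alternation and transposition sums on Schur modules. -/

section YoungSymmetrizer

variable {μ : YoungDiagram} {k : ℕ}

theorem permMap_apply (σ : Equiv.Perm (Box μ)) (t : Tensor μ k) (T : Box μ → Fin k) :
    permMap σ t T = t (T ∘ σ) := rfl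

theorem permMap_permMap (σ τ : Equiv.Perm (Box μ)) (t : Tensor μ k) :
    permMap σ (permMap τ t) = permMap (σ * τ) t := rfl

theorem perm_apply_inv {α : Type*} (σ : Equiv.Perm α) (x : α) : σ (σ⁻¹ x) = x :=
  σ.apply_symm_apply x

theorem permMap_rowSym {σ : Equiv.Perm (Box μ)} (hσ : ∀ b, (σ b).1.1 = b.1.1) (t : Tensor μ k) :
    permMap σ (rowSym μ k t) = rowSym μ k t := by
  classical
  simp only [rowSym, LinearMap.sum_apply, map_sum, permMap_permMap]
  refine Finset.sum_bij' (fun τ _ => σ * τ) (fun τ _ => σ⁻¹ * τ) ?_ ?_ ?_ ?_ ?_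
  · intro τ hτ
    simp only [Finset.mem_filter, Finset.mem_univ, true_and] at hτ ⊢
    exact fun b => by rw [Equiv.Perm.mul_apply, hσ, hτ]
  · intro τ hτ
    simp only [Finset.mem_filter, Finset.mem_univ, true_and] at hτ ⊢
    exact fun b => by rw [Equiv.Perm.mul_apply, ← hσ, perm_apply_inv, hτ]
  · intro τ _; simp
  · intro τ _; simp
  · intro τ _; rfl

theorem permMap_colAlt {σ : Equiv.Perm (Box μ)} (hσ : ∀ b, (σ b).1.2 = b.1.2) (t : Tensor μ k) :
    permMap σ (colAlt μ k t) = ((σ.sign : ℤ) : ℝ) • colAlt μ k t := by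
  classical
  simp only [colAlt, LinearMap.sum_apply, map_sum, LinearMap.smul_apply, map_smul,
    permMap_permMap, Finset.smul_sum, smul_smul]
  refine Finset.sum_bij' (fun τ _ => σ * τ) (fun τ _ => σ⁻¹ * τ) ?_ ?_ ?_ ?_ ?_
  · intro τ hτ
    simp only [Finset.mem_filter, Finset.mem_univ, true_and] at hτ ⊢
    exact fun b => by rw [Equiv.Perm.mul_apply, hσ, hτ]
  · intro τ hτ
    simp only [Finset.mem_filter, Finset.mem_univ, true_and] at hτ ⊢
    exact fun b => by rw [Equiv.Perm.mul_apply, ← hσ, perm_apply_inv, hτ]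
  · intro τ _; simp
  · intro τ _; simp
  · intro τ _
    rw [Equiv.Perm.sign_mul, ← Int.cast_mul, ← Units.val_mul, ← mul_assoc, Int.units_mul_self,
      one_mul]

theorem colAlt_permMap {σ : Equiv.Perm (Box μ)} (hσ : ∀ b, (σ b).1.2 = b.1.2) (t : Tensor μ k) :
    colAlt μ k (permMap σ t) = ((σ.sign : ℤ) : ℝ) • colAlt μ k t := by
  classical
  simp only [colAlt, LinearMap.sum_apply, LinearMap.smul_apply,
    permMap_permMap, Finset.smul_sum, smul_smul]
  refine Finset.sum_bij' (fun τ _ => τ * σ) (fun τ _ => τ * σ⁻¹) ?_ ?_ ?_ ?_ ?_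
  · intro τ hτ
    simp only [Finset.mem_filter, Finset.mem_univ, true_and] at hτ ⊢
    exact fun b => by rw [Equiv.Perm.mul_apply, hτ, hσ]
  · intro τ hτ
    simp only [Finset.mem_filter, Finset.mem_univ, true_and] at hτ ⊢
    exact fun b => by rw [Equiv.Perm.mul_apply, hτ, ← hσ, perm_apply_inv]
  · intro τ _; simp
  · intro τ _; simp
  · intro τ _
    rw [Equiv.Perm.sign_mul, ← Int.cast_mul, ← Units.val_mul, mul_comm τ.sign, ← mul_assoc,
      Int.units_mul_self, one_mul]

theorem schur_alternating {t : Tensor μ k} (ht : t ∈ schur μ k) {σ : Equiv.Perm (Box μ)}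
    (hσ : ∀ b, (σ b).1.2 = b.1.2) (T : Box μ → Fin k) :
    t (T ∘ σ) = ((σ.sign : ℤ) : ℝ) * t T := by
  obtain ⟨u, rfl⟩ := ht
  exact congrFun (permMap_colAlt hσ (rowSym μ k u)) T

theorem swap_row {b c : Box μ} (h : b.1.1 = c.1.1) (a : Box μ) :
    (Equiv.swap b c a).1.1 = a.1.1 := by
  by_cases hb : a = b
  · rw [hb, Equiv.swap_apply_left, h]
  · by_cases hc : a = c
    · rw [hc, Equiv.swap_apply_right, h]
    · rw [Equiv.swap_apply_of_ne_of_ne hb hc]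

theorem swap_col {b c : Box μ} (h : b.1.2 = c.1.2) (a : Box μ) :
    (Equiv.swap b c a).1.2 = a.1.2 := by
  by_cases hb : a = b
  · rw [hb, Equiv.swap_apply_left, h]
  · by_cases hc : a = c
    · rw [hc, Equiv.swap_apply_right, h]
    · rw [Equiv.swap_apply_of_ne_of_ne hb hc]

/-- The box `x` in the row of `b` and the column of `c` belongs to `μ`. The column swap of `c` and
`x` changes the sign; moved past the swap of `b` and `c` it becomes the row swap of `b` and `x`,
absorbed by the row symmetrizer. So the tensor equals its opposite. -/
theorem colAlt_swap_rowSym_of_lt {b c : Box μ} (hr : b.1.1 < c.1.1) (hc : b.1.2 ≠ c.1.2)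
    (t : Tensor μ k) : colAlt μ k (permMap (Equiv.swap b c) (rowSym μ k t)) = 0 := by
  have hx : (b.1.1, c.1.2) ∈ μ.cells := by
    have : (c.1.1, c.1.2) ∈ μ := (YoungDiagram.mem_cells _).1 c.2
    exact (YoungDiagram.mem_cells _).2 (μ.up_left_mem hr.le le_rfl this)
  let x : Box μ := ⟨(b.1.1, c.1.2), hx⟩
  have hxb : x ≠ b := fun h => hc (congrArg (fun y => y.1.2) h).symm
  have hxc : x ≠ c := fun h => hr.ne (congrArg (fun y => y.1.1) h)
  have hcomm : Equiv.swap c x * Equiv.swap b c = Equiv.swap b c * Equiv.swap b x := by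
    rw [Equiv.mul_swap_eq_swap_mul (Equiv.swap b c) b x, Equiv.swap_apply_left, Equiv.swap_apply_of_ne_of_ne hxb hxc]
  have h1 := colAlt_permMap (k := k) (swap_col (μ := μ) (b := c) (c := x) rfl)
    (permMap (Equiv.swap b c) (rowSym μ k t))
  rw [permMap_permMap, hcomm, ← permMap_permMap,
    permMap_rowSym (swap_row (μ := μ) (b := b) (c := x) rfl), Equiv.Perm.sign_swap hxc.symm] at h1
  simp only [Units.val_neg, Units.val_one, Int.cast_neg, Int.cast_one, neg_smul, one_smul] at h1
  exact self_eq_neg.1 h1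

open scoped Classical in
/-- The scalar by which the sum of all the `swap b c` acts on the Schur module. -/
noncomputable def swapEigenvalue (μ : YoungDiagram) : ℝ :=
  ∑ b : Box μ, ∑ c : Box μ, if b.1.1 = c.1.1 then 1 else if b.1.2 = c.1.2 then -1 else 0

theorem colAlt_swap_rowSym (b c : Box μ) (t : Tensor μ k) :
    colAlt μ k (permMap (Equiv.swap b c) (rowSym μ k t)) =
      (if b.1.1 = c.1.1 then (1 : ℝ) else if b.1.2 = c.1.2 then -1 else 0) •
        colAlt μ k (rowSym μ k t) := by
  split_ifs with h h'
  · rw [permMap_rowSym (swap_row h), one_smul]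
  · have hne : b ≠ c := fun h'' => h (by rw [h''])
    rw [colAlt_permMap (swap_col h'), Equiv.Perm.sign_swap hne]
    simp
  · rw [zero_smul]
    rcases lt_or_gt_of_ne h with h1 | h1
    · exact colAlt_swap_rowSym_of_lt h1 h' t
    · rw [Equiv.swap_comm]
      exact colAlt_swap_rowSym_of_lt h1 (Ne.symm h') t

/-- The sum of all the transpositions of two tensor factors. -/
noncomputable def swapSum (μ : YoungDiagram) (k : ℕ) : Tensor μ k →ₗ[ℝ] Tensor μ k :=
  ∑ b, ∑ c, permMap (Equiv.swap b c)

/-- Conjugation permutes the transpositions, so their sum is central. -/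
theorem swapSum_permMap (σ : Equiv.Perm (Box μ)) (t : Tensor μ k) :
    swapSum μ k (permMap σ t) = permMap σ (swapSum μ k t) := by
  simp only [swapSum, LinearMap.sum_apply, map_sum, permMap_permMap]
  symm
  refine Fintype.sum_equiv σ _ _ fun b => Fintype.sum_equiv σ _ _ fun c => ?_
  rw [Equiv.mul_swap_eq_swap_mul]

/-- Being central, the sum of the swaps may be inserted between `colAlt` and `rowSym`, where each
swap acts by 1, -1 or 0. This identity and `schur_alternating` are all that is kept of the Schur
module in `weylModule`. -/
theorem schur_sum_swap {t : Tensor μ k} (ht : t ∈ schur μ k) (T : Box μ → Fin k) :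
    ∑ b, ∑ c, t (T ∘ Equiv.swap b c) = swapEigenvalue μ * t T := by
  obtain ⟨u, rfl⟩ := ht
  have h1 (w : Tensor μ k) : swapSum μ k (colAlt μ k w) = colAlt μ k (swapSum μ k w) := by
    simp only [colAlt, LinearMap.sum_apply, LinearMap.smul_apply, map_sum, map_smul,
      swapSum_permMap]
  have h2 : swapSum μ k (colAlt μ k (rowSym μ k u)) =
      swapEigenvalue μ • colAlt μ k (rowSym μ k u) := by
    rw [h1]
    simp only [swapSum, LinearMap.sum_apply, map_sum, colAlt_swap_rowSym, swapEigenvalue,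
      Finset.sum_smul]
  have h3 := congrFun h2 T
  simp only [swapSum, LinearMap.sum_apply, Finset.sum_apply] at h3
  exact h3

end YoungSymmetrizer

end Vexillar

noncomputable section

namespace Vexillar

/-! ### Complex tensors and contractions against a bilinear form. -/

section ComplexTensors

/-- Complex tensors whose factors are indexed by the boxes of `μ`. -/
abbrev CTensor (μ : YoungDiagram) (k : ℕ) := (Box μ → Fin k) → ℂ

variable {μ : YoungDiagram} {k l p : ℕ}

/-- The complexification of a real tensor. -/
def Tensor.toComplex (t : Tensor μ k) : CTensor μ k := fun T => (t T : ℂ)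

/-- The action `A ⊗ ⋯ ⊗ A` of a complex matrix on complex tensors. -/
def ctMap (μ : YoungDiagram) (A : Matrix (Fin k) (Fin l) ℂ) : CTensor μ l →ₗ[ℂ] CTensor μ k where
  toFun t := fun T => ∑ S : Box μ → Fin l, (∏ b, A (T b) (S b)) * t S
  map_add' t u := by
    funext T; simp [mul_add, Finset.sum_add_distrib]
  map_smul' c t := by
    funext T; simp only [Pi.smul_apply, smul_eq_mul, RingHom.id_apply, Finset.mul_sum]
    exact Finset.sum_congr rfl fun S _ => by ring

theorem ctMap_apply (A : Matrix (Fin k) (Fin l) ℂ) (t : CTensor μ l) (T : Box μ → Fin k) :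
    ctMap μ A t T = ∑ S : Box μ → Fin l, (∏ b, A (T b) (S b)) * t S := rfl

theorem ctMap_mul (A : Matrix (Fin k) (Fin l) ℂ) (B : Matrix (Fin l) (Fin p) ℂ) (t : CTensor μ p) :
    ctMap μ (A * B) t = ctMap μ A (ctMap μ B t) := by
  funext T
  simp only [ctMap_apply, Matrix.mul_apply,
    Finset.prod_univ_sum, Fintype.piFinset_univ, Finset.mul_sum, Finset.sum_mul]
  rw [Finset.sum_comm]
  exact Finset.sum_congr rfl fun _ _ => Finset.sum_congr rfl fun _ _ => by
    rw [Finset.prod_mul_distrib]; ring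

theorem ctMap_one (t : CTensor μ k) : ctMap μ (1 : Matrix (Fin k) (Fin k) ℂ) t = t := by
  funext T
  rw [ctMap_apply, Finset.sum_eq_single T]
  · simp
  · intro S _ hS
    obtain ⟨b, hb⟩ := Function.ne_iff.1 hS
    rw [Finset.prod_eq_zero (Finset.mem_univ b), zero_mul]
    exact Matrix.one_apply_ne hb.symm
  · simp

theorem ctMap_smul (c : ℂ) (A : Matrix (Fin k) (Fin l) ℂ) (t : CTensor μ l) :
    ctMap μ (c • A) t = c ^ μ.card • ctMap μ A t := by
  funext T
  simp only [ctMap_apply, Pi.smul_apply, smul_eq_mul, Matrix.smul_apply, Finset.prod_mul_distrib,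
    Finset.prod_const, Finset.mul_sum]
  refine Finset.sum_congr rfl fun S _ => ?_
  rw [Finset.card_univ, Fintype.card_coe, mul_assoc]

theorem ctMap_toComplex (A : Matrix (Fin k) (Fin l) ℝ) (t : Tensor μ l) :
    ctMap μ (A.map Complex.ofReal) t.toComplex = (tensorMap μ A t).toComplex := by
  funext T
  simp [ctMap_apply, Tensor.toComplex, tensorMap]

theorem ctMap_comp (A : Matrix (Fin k) (Fin l) ℂ) (t : CTensor μ l) (σ : Equiv.Perm (Box μ))
    (T : Box μ → Fin k) : ctMap μ A t (T ∘ σ) = ctMap μ A (fun S => t (S ∘ σ)) T := by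
  rw [ctMap_apply, ctMap_apply]
  refine (Fintype.sum_equiv (Equiv.arrowCongr σ.symm (Equiv.refl _)) _ _ fun S => ?_).symm
  have : (∏ b, A (T b) (S b)) = ∏ b, A (T (σ b)) (S (σ b)) :=
    (Equiv.prod_comp σ fun b => A (T b) (S b)).symm
  rw [this]
  rfl

theorem dotProduct_ctMap (A : Matrix (Fin k) (Fin l) ℂ) (t : CTensor μ k) (u : CTensor μ l) :
    t ⬝ᵥ ctMap μ A u = ctMap μ Aᵀ t ⬝ᵥ u := by
  simp only [dotProduct, ctMap_apply, Finset.mul_sum, Finset.sum_mul, Matrix.transpose_apply]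
  rw [Finset.sum_comm]
  exact Finset.sum_congr rfl fun _ _ => Finset.sum_congr rfl fun _ _ => by ring

theorem star_ctMap (A : Matrix (Fin k) (Fin l) ℂ) (t : CTensor μ l) :
    star (ctMap μ A t) = ctMap μ (A.map star) (star t) := by
  funext T
  simp [ctMap_apply]

theorem sum_update_swap {M : Type*} [AddCommMonoid M] (b : Box μ)
    (g : (Box μ → Fin k) → Fin k → M) :
    ∑ S, ∑ x, g (Function.update S b x) (S b) = ∑ S, ∑ x, g S x := by
  rw [← Fintype.sum_prod_type', ← Fintype.sum_prod_type']
  have hinv : Function.Involutive fun q : (Box μ → Fin k) × Fin k =>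
      (Function.update q.1 b q.2, q.1 b) := fun q => by simp
  exact Fintype.sum_equiv hinv.toPerm _ _ fun q => rfl

/-- Summing the double sums over all `S` counts every tableau `k²` times; for `k = 0` there is no
tableau, since `b` is a box. -/
theorem sum_eq_zero_of_sum_update (b c : Box μ) (h : (Box μ → Fin k) → ℂ)
    (h0 : ∀ S, ∑ x, ∑ y, h (Function.update (Function.update S b x) c y) = 0) : ∑ S, h S = 0 := by
  rcases Nat.eq_zero_or_pos k with rfl | hk
  · have : IsEmpty (Box μ → Fin 0) := ⟨fun S => (S b).elim0⟩
    simp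
  have h1 (d : Box μ) (g : (Box μ → Fin k) → ℂ) :
      ∑ S, ∑ x, g (Function.update S d x) = k * ∑ S, g S := by
    rw [sum_update_swap d fun S _ => g S]
    simp [Finset.mul_sum]
  have h2 : (k : ℂ) * (k * ∑ S, h S) = 0 := by
    rw [← h1 c h, ← h1 b fun S => ∑ y, h (Function.update S c y)]
    exact Finset.sum_eq_zero fun S _ => h0 S
  have hk' : (k : ℂ) ≠ 0 := Nat.cast_ne_zero.2 hk.ne'
  simpa [hk'] using h2

theorem prod_update_update (A : Matrix (Fin k) (Fin l) ℂ) {b c : Box μ} (hbc : b ≠ c)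
    (T : Box μ → Fin k) (S : Box μ → Fin l) (x y : Fin k) :
    ∏ a, A (Function.update (Function.update T b x) c y a) (S a) =
      (∏ a ∈ (Finset.univ.erase b).erase c, A (T a) (S a)) * (A x (S b) * A y (S c)) := by
  have hcm : c ∈ (Finset.univ : Finset (Box μ)).erase b := by simp [hbc.symm]
  rw [← Finset.mul_prod_erase Finset.univ _ (Finset.mem_univ b),
    ← Finset.mul_prod_erase _ _ hcm]
  have : ∏ a ∈ (Finset.univ.erase b).erase c,
      A (Function.update (Function.update T b x) c y a) (S a) =
      ∏ a ∈ (Finset.univ.erase b).erase c, A (T a) (S a) :=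
    Finset.prod_congr rfl fun a ha => by
      simp only [Finset.mem_erase] at ha
      rw [Function.update_of_ne ha.1, Function.update_of_ne ha.2.1]
  rw [this, Function.update_self, Function.update_of_ne hbc, Function.update_self]
  ring

/-- The contraction of two factors against the bilinear form `K`. -/
def contraction (K : Matrix (Fin k) (Fin k) ℂ) (b c : Box μ) (t : CTensor μ k)
    (T : Box μ → Fin k) : ℂ :=
  ∑ x, ∑ y, K x y * t (Function.update (Function.update T b x) c y)

/-- Contracting the image by `K` weights `t S` by the entry of `AᵀKA` at `S b, S c`. The remaining
factors do not involve these two entries, so summing over them produces a contraction of `t`. -/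
theorem contraction_ctMap (K : Matrix (Fin k) (Fin k) ℂ) (A : Matrix (Fin k) (Fin l) ℂ)
    {b c : Box μ} (hbc : b ≠ c) (t : CTensor μ l)
    (ht : ∀ S, contraction (Aᵀ * K * A) b c t S = 0) (T : Box μ → Fin k) :
    contraction K b c (ctMap μ A t) T = 0 := by
  have h1 : contraction K b c (ctMap μ A t) T = ∑ S : Box μ → Fin l,
      (∏ a ∈ (Finset.univ.erase b).erase c, A (T a) (S a)) *
        ((Aᵀ * K * A) (S b) (S c) * t S) := by
    simp only [contraction, ctMap_apply, prod_update_update A hbc, Finset.mul_sum]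
    rw [Finset.sum_congr rfl fun x _ => Finset.sum_comm, Finset.sum_comm]
    refine Finset.sum_congr rfl fun S _ => ?_
    simp only [Matrix.mul_apply, Finset.sum_mul, Finset.mul_sum, Matrix.transpose_apply]
    rw [Finset.sum_comm]
    exact Finset.sum_congr rfl fun _ _ => Finset.sum_congr rfl fun _ _ => by ring
  rw [h1]
  refine sum_eq_zero_of_sum_update b c _ fun S => ?_
  have hR : ∀ x y, (∏ a ∈ (Finset.univ.erase b).erase c,
      A (T a) (Function.update (Function.update S b x) c y a)) =
      ∏ a ∈ (Finset.univ.erase b).erase c, A (T a) (S a) := fun x y =>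
    Finset.prod_congr rfl fun a ha => by
      simp only [Finset.mem_erase] at ha
      rw [Function.update_of_ne ha.1, Function.update_of_ne ha.2.1]
  simp only [hR, ← Finset.mul_sum, Function.update_self, Function.update_of_ne hbc]
  rw [show (∑ x, ∑ y, (Aᵀ * K * A) x y * t (Function.update (Function.update S b x) c y)) = 0
    from ht S, mul_zero]

/-- The tensors alternating along columns, on which the sum of the transpositions acts as on the
Schur module, and whose contractions against the bilinear form `K` vanish. -/
def weylModule (μ : YoungDiagram) (K : Matrix (Fin k) (Fin k) ℂ) : Submodule ℂ (CTensor μ k) where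
  carrier := {t | (∀ σ : Equiv.Perm (Box μ), (∀ b, (σ b).1.2 = b.1.2) →
      ∀ T, t (T ∘ σ) = ((σ.sign : ℤ) : ℂ) * t T) ∧
    (∀ T, ∑ b, ∑ c, t (T ∘ Equiv.swap b c) = swapEigenvalue μ * t T) ∧
    ∀ b c, b ≠ c → ∀ T, contraction K b c t T = 0}
  zero_mem' := by simp [contraction]
  add_mem' := by
    rintro t u ⟨h1, h2, h3⟩ ⟨h1', h2', h3'⟩
    refine ⟨fun σ hσ T => ?_, fun T => ?_, fun b c hbc T => ?_⟩
    · simp only [Pi.add_apply, h1 σ hσ, h1' σ hσ, mul_add]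
    · simp only [Pi.add_apply, Finset.sum_add_distrib, h2, h2', mul_add]
    · have := congrArg₂ (· + ·) (h3 b c hbc T) (h3' b c hbc T)
      simpa only [contraction, Pi.add_apply, mul_add, Finset.sum_add_distrib, add_zero] using this
  smul_mem' := by
    rintro r t ⟨h1, h2, h3⟩
    refine ⟨fun σ hσ T => ?_, fun T => ?_, fun b c hbc T => ?_⟩
    · simp only [Pi.smul_apply, smul_eq_mul, h1 σ hσ]; ring
    · simp only [Pi.smul_apply, smul_eq_mul, ← Finset.mul_sum, h2]; ring
    · have := congrArg (r * ·) (h3 b c hbc T)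
      simpa only [contraction, Pi.smul_apply, smul_eq_mul, Finset.mul_sum, mul_left_comm r,
        mul_zero] using this

/-- Permuting factors commutes with `A ⊗ ⋯ ⊗ A`, and contractions pull back to `AᵀKA`. Rectangular
`A` and arbitrary `L` are allowed so as to cover an isotropic frame, for which `L = 0`. -/
theorem ctMap_mem_weylModule {K : Matrix (Fin k) (Fin k) ℂ} {L : Matrix (Fin l) (Fin l) ℂ}
    {A : Matrix (Fin k) (Fin l) ℂ} (hA : Aᵀ * K * A = L) {t : CTensor μ l}
    (ht : t ∈ weylModule μ L) : ctMap μ A t ∈ weylModule μ K := by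
  subst hA
  obtain ⟨h1, h2, h3⟩ := ht
  refine ⟨fun σ hσ T => ?_, fun T => ?_, fun b c hbc T =>
    contraction_ctMap K A hbc t (h3 b c hbc) T⟩
  · rw [ctMap_comp, show (fun S => t (S ∘ σ)) = ((σ.sign : ℤ) : ℂ) • t from
      funext fun S => h1 σ hσ S, map_smul]
    rfl
  · simp only [ctMap_comp]
    have : (∑ b, ∑ c, fun S => t (S ∘ Equiv.swap b c)) = (swapEigenvalue μ : ℂ) • t := by
      funext S
      simp only [Finset.sum_apply, h2, Pi.smul_apply, smul_eq_mul]
    have h4 := congrFun (congrArg (ctMap μ A) this) T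
    simpa only [map_sum, Finset.sum_apply, map_smul, Pi.smul_apply, smul_eq_mul] using h4

theorem toComplex_mem_weylModule {t : Tensor μ k} (ht : t ∈ schur μ k)
    {K : Matrix (Fin k) (Fin k) ℂ}
    (hK : ∀ b c, b ≠ c → ∀ T, contraction K b c t.toComplex T = 0) :
    t.toComplex ∈ weylModule μ K := by
  refine ⟨fun σ hσ T => ?_, fun T => ?_, hK⟩
  · simp [Tensor.toComplex, schur_alternating ht hσ T]
  · have := congrArg Complex.ofReal (schur_sum_swap ht T)
    simpa [Tensor.toComplex] using this

theorem orthSchur_toComplex {t : Tensor μ k} (ht : t ∈ orthSchur μ k) :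
    t.toComplex ∈ weylModule μ (1 : Matrix (Fin k) (Fin k) ℂ) := by
  refine toComplex_mem_weylModule ht.1 fun b c hbc T => ?_
  have := congrArg Complex.ofReal (ht.2 b c hbc T)
  simpa [contraction, Tensor.toComplex, Matrix.one_apply] using this

end ComplexTensors

/-! ### The action of matrices by derivations. -/

section Derivations

variable {μ : YoungDiagram} {k : ℕ}

/-- The action of a matrix on tensors by derivation. -/
def ctDer (μ : YoungDiagram) (A : Matrix (Fin k) (Fin k) ℂ) (t : CTensor μ k) : CTensor μ k :=
  fun T => ∑ b, ∑ x, A (T b) x * t (Function.update T b x)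

theorem ctDer_add (A B : Matrix (Fin k) (Fin k) ℂ) (t : CTensor μ k) :
    ctDer μ (A + B) t = ctDer μ A t + ctDer μ B t := by
  funext T
  simp [ctDer, add_mul, Finset.sum_add_distrib]

theorem ctDer_smul (r : ℂ) (A : Matrix (Fin k) (Fin k) ℂ) (t : CTensor μ k) :
    ctDer μ (r • A) t = r • ctDer μ A t := by
  funext T
  simp [ctDer, mul_assoc, Finset.mul_sum]

/-- When both derivations hit the same box they compose to that of `A * B`; the double sum collects
the pairs of distinct boxes. It is symmetric in `A` and `B`, hence cancels in commutators. -/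
theorem ctDer_mul_apply (A B : Matrix (Fin k) (Fin k) ℂ) (t : CTensor μ k) (T : Box μ → Fin k) :
    ctDer μ A (ctDer μ B t) T = ctDer μ (A * B) t T +
      ∑ b, ∑ c ∈ Finset.univ.erase b, ∑ x, ∑ y, A (T b) x * B (T c) y *
        t (Function.update (Function.update T b x) c y) := by
  simp only [ctDer, ← Finset.sum_add_distrib]
  refine Finset.sum_congr rfl fun b _ => ?_
  have h1 : ∀ x, ∑ c, ∑ y, B (Function.update T b x c) y *
      t (Function.update (Function.update T b x) c y) =
      ∑ y, B x y * t (Function.update T b y) + ∑ c ∈ Finset.univ.erase b, ∑ y, B (T c) y *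
        t (Function.update (Function.update T b x) c y) := by
    intro x
    rw [← Finset.add_sum_erase _ _ (Finset.mem_univ b)]
    congr 1
    · simp
    · refine Finset.sum_congr rfl fun c hc => ?_
      rw [Function.update_of_ne (Finset.ne_of_mem_erase hc)]
  simp only [h1, mul_add, Finset.sum_add_distrib]
  congr 1
  · simp only [Matrix.mul_apply, Finset.mul_sum, Finset.sum_mul]
    rw [Finset.sum_comm]
    exact Finset.sum_congr rfl fun _ _ => Finset.sum_congr rfl fun _ _ => by ring
  · simp only [Finset.mul_sum]
    rw [Finset.sum_comm]
    exact Finset.sum_congr rfl fun _ _ => Finset.sum_congr rfl fun _ _ =>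
      Finset.sum_congr rfl fun _ _ => by ring

theorem ctDer_commutator (A B : Matrix (Fin k) (Fin k) ℂ) (t : CTensor μ k) :
    ctDer μ A (ctDer μ B t) = ctDer μ B (ctDer μ A t) + ctDer μ (A * B - B * A) t := by
  have hs : ctDer μ (A * B - B * A) t = ctDer μ (A * B) t - ctDer μ (B * A) t := by
    rw [sub_eq_add_neg, ctDer_add, ← neg_one_smul ℂ (B * A), ctDer_smul, neg_one_smul,
      sub_eq_add_neg]
  funext T
  rw [hs, Pi.add_apply, Pi.sub_apply, ctDer_mul_apply, ctDer_mul_apply B A]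
  have : ∑ b, ∑ c ∈ Finset.univ.erase b, ∑ x, ∑ y, A (T b) x * B (T c) y *
        t (Function.update (Function.update T b x) c y) =
      ∑ b, ∑ c ∈ Finset.univ.erase b, ∑ x, ∑ y, B (T b) x * A (T c) y *
        t (Function.update (Function.update T b x) c y) := by
    rw [Finset.sum_comm' (t' := Finset.univ) (s' := fun c => Finset.univ.erase c)
      (by intro x y; simp [eq_comm])]
    refine Finset.sum_congr rfl fun b _ => Finset.sum_congr rfl fun c hc => ?_
    rw [Finset.sum_comm]
    refine Finset.sum_congr rfl fun x _ => Finset.sum_congr rfl fun y _ => ?_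
    rw [Function.update_comm (Finset.ne_of_mem_erase hc), mul_comm (A _ _)]
  rw [this]
  ring

theorem hasDerivAt_ctMap {γ : ℝ → Matrix (Fin k) (Fin k) ℂ} {A : Matrix (Fin k) (Fin k) ℂ}
    (h0 : γ 0 = 1) (hγ : ∀ i j, HasDerivAt (fun θ => γ θ i j) (A i j) 0) (t : CTensor μ k) :
    HasDerivAt (fun θ => ctMap μ (γ θ) t) (ctDer μ A t) 0 := by
  rw [hasDerivAt_pi]
  intro T
  have h1 : HasDerivAt (fun θ => ctMap μ (γ θ) t T)
      (∑ S : Box μ → Fin k, (∑ b, (∏ a ∈ Finset.univ.erase b, γ 0 (T a) (S a)) •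
        A (T b) (S b)) * t S) 0 := by
    simp only [ctMap_apply]
    refine HasDerivAt.fun_sum fun S _ => HasDerivAt.mul_const ?_ _
    exact HasDerivAt.fun_finsetProd fun b _ => hγ (T b) (S b)
  refine h1.congr_deriv ?_
  simp only [h0, ctDer, Finset.sum_mul]
  rw [Finset.sum_comm]
  refine Finset.sum_congr rfl fun b _ => ?_
  -- At the identity, the undifferentiated factors force `S` to agree with `T` away from `b`.
  have h2 : ∀ S : Box μ → Fin k, (∏ a ∈ Finset.univ.erase b,
      (1 : Matrix (Fin k) (Fin k) ℂ) (T a) (S a)) =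
      if S = Function.update T b (S b) then 1 else 0 := by
    intro S
    split_ifs with h
    · refine Finset.prod_eq_one fun a ha => ?_
      rw [h, Function.update_of_ne (Finset.ne_of_mem_erase ha), Matrix.one_apply_eq]
    · have : ∃ a, a ≠ b ∧ T a ≠ S a := by
        by_contra! hc
        refine h (funext fun a => ?_)
        by_cases ha : a = b
        · rw [ha, Function.update_self]
        · rw [Function.update_of_ne ha, hc a ha]
      obtain ⟨a, ha, hne⟩ := this
      exact Finset.prod_eq_zero (Finset.mem_erase.2 ⟨ha, Finset.mem_univ a⟩)
        (Matrix.one_apply_ne hne)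
  simp only [h2, ite_smul, one_smul, zero_smul, ite_mul, zero_mul]
  rw [← Finset.sum_filter]
  symm
  refine Finset.sum_bij (fun (x : Fin k) _ => Function.update T b x) ?_ ?_ ?_ ?_
  · intro x _; simp
  · intro x _ y _ h
    exact Function.update_injective T b h
  · intro S hS
    simp only [Finset.mem_filter, Finset.mem_univ, true_and] at hS
    exact ⟨S b, Finset.mem_univ _, hS.symm⟩
  · intro x _; simp

/-- The difference quotients stay in `M`, which is closed by finite dimension. -/
theorem ctDer_mem_of_curve {M : Submodule ℂ (CTensor μ k)} {γ : ℝ → Matrix (Fin k) (Fin k) ℂ}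
    {A : Matrix (Fin k) (Fin k) ℂ} (h0 : γ 0 = 1)
    (hγ : ∀ i j, HasDerivAt (fun θ => γ θ i j) (A i j) 0)
    (hM : ∀ θ, ∀ t ∈ M, ctMap μ (γ θ) t ∈ M) {t : CTensor μ k} (ht : t ∈ M) :
    ctDer μ A t ∈ M := by
  have h1 := hasDerivAt_iff_tendsto_slope.1 (hasDerivAt_ctMap h0 hγ t)
  have hc : IsClosed (M : Set (CTensor μ k)) := M.closed_of_finiteDimensional
  refine hc.mem_of_tendsto h1 (Filter.Eventually.of_forall fun θ => ?_)
  rw [slope_def_module]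
  have h2 : ((θ - 0)⁻¹ : ℝ) • (ctMap μ (γ θ) t - ctMap μ (γ 0) t) =
      (((θ - 0)⁻¹ : ℝ) : ℂ) • (ctMap μ (γ θ) t - ctMap μ (γ 0) t) := by
    funext T; simp
  rw [h2]
  exact M.smul_mem _ (M.sub_mem (hM θ t ht) (hM 0 t ht))

end Derivations

end Vexillar

end

noncomputable section

namespace Vexillar

/-! ### The Lie algebra and the Casimir operator of the split form. -/

section SplitForm

variable {μ : YoungDiagram} {k : ℕ}

/-- The matrix of the split symmetric bilinear form `∑ xᵢ y_{rev i}`. -/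
def revForm (k : ℕ) : Matrix (Fin k) (Fin k) ℂ := Matrix.of fun i j => if j = i.rev then 1 else 0

theorem revForm_apply (i j : Fin k) : revForm k i j = if j = i.rev then 1 else 0 := rfl

theorem revForm_mul_apply {l : ℕ} (A : Matrix (Fin k) (Fin l) ℂ) (i : Fin k) (j : Fin l) :
    (revForm k * A) i j = A i.rev j := by
  simp [Matrix.mul_apply, revForm_apply]

theorem mul_revForm_apply {l : ℕ} (A : Matrix (Fin l) (Fin k) ℂ) (i : Fin l) (j : Fin k) :
    (A * revForm k) i j = A i j.rev := by
  have (x : Fin k) : (j = x.rev) ↔ (x = j.rev) := by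
    constructor <;> rintro rfl <;> simp
  simp [Matrix.mul_apply, revForm_apply, this]

theorem revForm_mul_self : revForm k * revForm k = 1 := by
  ext i j
  rw [revForm_mul_apply, revForm_apply, Fin.rev_rev, Matrix.one_apply]
  simp [eq_comm]

theorem revForm_transpose : (revForm k)ᵀ = revForm k := by
  ext i j
  rw [Matrix.transpose_apply, revForm_apply, revForm_apply]
  congr 1
  simp only [eq_iff_iff]
  constructor <;> rintro rfl <;> simp

/-- A space of tensors stable under the compact form of the orthogonal group of the split form. -/
def IsSplitStable (M : Submodule ℂ (CTensor μ k)) : Prop :=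
  ∀ γ : Matrix (Fin k) (Fin k) ℂ, γᴴ * γ = 1 → γᵀ * revForm k * γ = revForm k →
    ∀ t ∈ M, ctMap μ γ t ∈ M

/-- The curve `exp (θX)` stays in the compact group: the first condition makes it unitary, and the
second, `Xᵀ = J(-X)J⁻¹` with `J = revForm k`, makes it preserve the form. -/
theorem IsSplitStable.ctDer_mem_of_skew {M : Submodule ℂ (CTensor μ k)} (hM : IsSplitStable M)
    {X : Matrix (Fin k) (Fin k) ℂ} (hX : Xᴴ = -X) (hXJ : Xᵀ * revForm k = -(revForm k * X))
    {t : CTensor μ k} (ht : t ∈ M) : ctDer μ X t ∈ M := by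
  let _ : NormedRing (Matrix (Fin k) (Fin k) ℂ) := Matrix.linftyOpNormedRing
  let _ : NormedAlgebra ℝ (Matrix (Fin k) (Fin k) ℂ) := Matrix.linftyOpNormedAlgebra
  have hU : IsUnit (revForm k) := IsUnit.of_mul_eq_one _ revForm_mul_self
  have hinv : (revForm k)⁻¹ = revForm k := Matrix.inv_eq_right_inv revForm_mul_self
  have hexp (θ : ℝ) : NormedSpace.exp (-(θ • X)) * NormedSpace.exp (θ • X) = 1 := by
    rw [← Matrix.exp_add_of_commute _ _ ((Commute.refl (θ • X)).neg_left), neg_add_cancel,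
      NormedSpace.exp_zero]
  refine ctDer_mem_of_curve (γ := fun θ => NormedSpace.exp (θ • X)) (by simp) ?_ ?_ ht
  · intro i j
    have h1 := hasDerivAt_exp_smul_const (𝕂 := ℝ) X (0 : ℝ)
    rw [zero_smul, NormedSpace.exp_zero, one_mul] at h1
    have h2 := (LinearMap.toContinuousLinearMap
      (Matrix.entryLinearMap ℝ ℂ i j)).hasFDerivAt.comp_hasDerivAt (0 : ℝ) h1
    exact h2
  · intro θ t ht
    refine hM _ ?_ ?_ t ht
    · rw [← Matrix.exp_conjTranspose, Matrix.conjTranspose_smul, hX, star_trivial, smul_neg, hexp]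
    · rw [← Matrix.exp_transpose, Matrix.transpose_smul]
      have h1 : Xᵀ = revForm k * (-X) * (revForm k)⁻¹ := by
        rw [hinv, Matrix.mul_neg, ← hXJ, Matrix.mul_assoc, revForm_mul_self, Matrix.mul_one]
      have h2 : θ • Xᵀ = revForm k * (-(θ • X)) * (revForm k)⁻¹ := by
        rw [h1]; simp
      rw [h2, Matrix.exp_conj _ _ hU, hinv, Matrix.mul_assoc _ (revForm k) (revForm k),
        revForm_mul_self, Matrix.mul_one, Matrix.mul_assoc, hexp, Matrix.mul_one]

/-- The generators of the Lie algebra of the orthogonal group of the split form. -/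
def soGen (i j : Fin k) : Matrix (Fin k) (Fin k) ℂ :=
  Matrix.single i j 1 - Matrix.single j.rev i.rev 1

theorem soGen_transpose (i j : Fin k) : (soGen i j)ᵀ = soGen j i := by
  simp [soGen, Matrix.transpose_sub, Matrix.transpose_single]

theorem soGen_conjTranspose (i j : Fin k) : (soGen i j)ᴴ = soGen j i := by
  simp [soGen, Matrix.conjTranspose_sub, Matrix.conjTranspose_single]

theorem soGen_apply (i j p x : Fin k) : soGen i j p x =
    (if i = p ∧ j = x then 1 else 0) - (if j = p.rev ∧ i = x.rev then 1 else 0) := by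
  have h (a b : Fin k) : a.rev = b ↔ a = b.rev := by
    constructor <;> rintro rfl <;> simp
  simp [soGen, Matrix.single_apply, h]

theorem soGen_rev (i j : Fin k) : soGen j.rev i.rev = -soGen i j := by
  simp [soGen]

theorem soGen_transpose_mul (i j : Fin k) :
    (soGen i j)ᵀ * revForm k = -(revForm k * soGen i j) := by
  rw [soGen_transpose]
  ext p x
  rw [Matrix.neg_apply, mul_revForm_apply, revForm_mul_apply, soGen_apply, soGen_apply,
    Fin.rev_rev, Fin.rev_rev]
  ring

/-- With `F_ij = soGen i j`, the matrices `F_ij - F_ji` and `i(F_ij + F_ji)` lie in the Lie algebra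
of the compact group, and `F_ij` is a complex combination of them. -/
theorem IsSplitStable.ctDer_soGen_mem {M : Submodule ℂ (CTensor μ k)} (hM : IsSplitStable M)
    (i j : Fin k) {t : CTensor μ k} (ht : t ∈ M) : ctDer μ (soGen i j) t ∈ M := by
  have h1 : ctDer μ (soGen i j - soGen j i) t ∈ M := by
    refine hM.ctDer_mem_of_skew ?_ ?_ ht
    · rw [Matrix.conjTranspose_sub, soGen_conjTranspose, soGen_conjTranspose, neg_sub]
    · rw [Matrix.transpose_sub, Matrix.sub_mul, soGen_transpose_mul, soGen_transpose_mul,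
        Matrix.mul_sub, neg_sub, sub_neg_eq_add, neg_add_eq_sub]
  have h2 : ctDer μ (Complex.I • (soGen i j + soGen j i)) t ∈ M := by
    refine hM.ctDer_mem_of_skew ?_ ?_ ht
    · rw [Matrix.conjTranspose_smul, Matrix.conjTranspose_add, soGen_conjTranspose,
        soGen_conjTranspose, add_comm, ← neg_smul]
      simp
    · rw [Matrix.transpose_smul, Matrix.transpose_add, Matrix.smul_mul, Matrix.add_mul,
        soGen_transpose_mul, soGen_transpose_mul, Matrix.mul_smul, Matrix.mul_add,
        ← neg_add, smul_neg]
  have h3 : soGen i j = (1 / 2 : ℂ) • (soGen i j - soGen j i) +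
      (-Complex.I / 2) • (Complex.I • (soGen i j + soGen j i)) := by
    have hI : (-Complex.I / 2) * Complex.I = 1 / 2 := by
      linear_combination (-1 / 2 : ℂ) * Complex.I_mul_I
    rw [smul_smul, hI, ← smul_add]
    have : soGen i j - soGen j i + (soGen i j + soGen j i) = (2 : ℂ) • soGen i j := by
      rw [two_smul]; abel
    rw [this, smul_smul]
    norm_num
  rw [h3, ctDer_add, ctDer_smul, ctDer_smul]
  exact M.add_mem (M.smul_mem _ h1) (M.smul_mem _ h2)

theorem soGen_commutator (i j : Fin k) (hij : i ≠ j) :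
    soGen i j * soGen j i - soGen j i * soGen i j =
      if j = i.rev then 0 else soGen i i - soGen j j := by
  split_ifs with h
  -- Here the generator `soGen i i.rev` is itself zero.
  · subst h
    simp [soGen]
  · have h' : i ≠ j.rev := fun h' => h (by rw [h', Fin.rev_rev])
    have h1 : i.rev ≠ j.rev := fun h => hij (Fin.rev_injective h)
    simp only [soGen, Matrix.sub_mul, Matrix.mul_sub, Matrix.single_mul_single_same]
    rw [Matrix.single_mul_single_of_ne (h := h), Matrix.single_mul_single_of_ne (h := Ne.symm h),
      Matrix.single_mul_single_of_ne (h := h'), Matrix.single_mul_single_of_ne (h := Ne.symm h')]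
    simp only [mul_one]
    abel

theorem ctDer_single_self (i : Fin k) (t : CTensor μ k) (T : Box μ → Fin k) :
    ctDer μ (Matrix.single i i 1) t T = (Finset.univ.filter fun b => T b = i).card * t T := by
  have h : ∀ b, ∑ x, Matrix.single i i (1 : ℂ) (T b) x * t (Function.update T b x) =
      if T b = i then t T else 0 := by
    intro b
    by_cases hb : T b = i
    · rw [if_pos hb, Finset.sum_eq_single i]
      · rw [hb, Matrix.single_apply_same, one_mul, ← hb, Function.update_eq_self]
      · intro x _ hx
        rw [Matrix.single_apply_of_col_ne _ _ (Ne.symm hx), zero_mul]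
      · simp
    · rw [if_neg hb]
      refine Finset.sum_eq_zero fun x _ => ?_
      rw [Matrix.single_apply_of_row_ne (Ne.symm hb), zero_mul]
  simp only [ctDer, h]
  rw [← Finset.sum_filter, Finset.sum_const, nsmul_eq_mul]

/-- The weight of a tableau under the torus of the orthogonal group of the split form. -/
def tabWeight (T : Box μ → Fin k) (i : Fin k) : ℤ :=
  (Finset.univ.filter fun b => T b = i).card - (Finset.univ.filter fun b => T b = i.rev).card

theorem ctDer_soGen_self (i : Fin k) (t : CTensor μ k) (T : Box μ → Fin k) :
    ctDer μ (soGen i i) t T = tabWeight T i * t T := by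
  rw [soGen, sub_eq_add_neg, ctDer_add, ← neg_one_smul ℂ (Matrix.single i.rev i.rev (1 : ℂ)),
    ctDer_smul, Pi.add_apply, Pi.smul_apply, ctDer_single_self, ctDer_single_self, tabWeight]
  push_cast
  rw [smul_eq_mul]
  ring

theorem sum_soGen_mul (G : Fin k → Fin k → ℂ) (p x : Fin k) :
    ∑ i, ∑ j, soGen i j p x * G i j = G p x - G x.rev p.rev := by
  simp only [soGen_apply, sub_mul, Finset.sum_sub_distrib, ite_and, ite_mul, one_mul, zero_mul]
  congr 1
  · simp
  · rw [Finset.sum_comm]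
    simp

/-- On two factors, the Casimir tensor is twice the flip minus twice the contraction against the
split form followed by insertion of the dual tensor. -/
theorem sum_soGen_mul_soGen (p x q y : Fin k) :
    ∑ i, ∑ j, soGen i j p x * soGen j i q y =
      2 * ((if x = q ∧ p = y then 1 else 0) - if p = q.rev ∧ x = y.rev then 1 else 0) := by
  rw [sum_soGen_mul fun i j => soGen j i q y]
  rw [soGen_rev, Matrix.neg_apply, sub_neg_eq_add, soGen_apply]
  ring

/-- The Casimir operator of the orthogonal group of the split form. -/
def casimir (μ : YoungDiagram) (t : CTensor μ k) : CTensor μ k :=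
  ∑ i, ∑ j, ctDer μ (soGen i j) (ctDer μ (soGen j i) t)

theorem ctDer_sum {ι : Type*} (s : Finset ι) (A : ι → Matrix (Fin k) (Fin k) ℂ) (t : CTensor μ k) :
    ctDer μ (∑ i ∈ s, A i) t = ∑ i ∈ s, ctDer μ (A i) t :=
  map_sum (AddMonoidHom.mk' (fun A => ctDer μ A t) fun A B => ctDer_add A B t) A s

theorem sum_sum_sum_rotate {ι κ ν : Type*} [Fintype ι] [Fintype κ] (s : Finset ν)
    (f : ι → κ → ν → ℂ) : ∑ i, ∑ j, ∑ c ∈ s, f i j c = ∑ c ∈ s, ∑ i, ∑ j, f i j c := by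
  rw [Finset.sum_congr rfl fun i _ => Finset.sum_comm, Finset.sum_comm]

/-- Terms on a single box give `2k - 2` each. Terms on two distinct boxes give twice a
transposition, as the contractions of `t` vanish. `swapEigenvalue` also counts the pairs `b = c`,
whence the subtraction of `μ.card`. -/
theorem casimir_eq_smul {t : CTensor μ k} (ht : t ∈ weylModule μ (revForm k)) :
    casimir μ t = ((2 * k - 2) * μ.card + 2 * (swapEigenvalue μ - μ.card) : ℂ) • t := by
  classical
  obtain ⟨-, h2, h3⟩ := ht
  have hA : ∑ i : Fin k, ∑ j : Fin k, soGen i j * soGen j i =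
      (2 * k - 2 : ℂ) • (1 : Matrix (Fin k) (Fin k) ℂ) := by
    ext p y
    simp only [Matrix.sum_apply, Matrix.mul_apply]
    rw [Finset.sum_congr rfl fun i _ => Finset.sum_comm, Finset.sum_comm]
    simp only [sum_soGen_mul_soGen, ← Finset.mul_sum, Finset.sum_sub_distrib]
    have h (x : Fin k) : (p = x.rev ∧ x = y.rev) ↔ (x = y.rev ∧ p = y) := by
      constructor
      · rintro ⟨h1, rfl⟩; simpa using h1
      · rintro ⟨rfl, rfl⟩; simp
    simp only [h]
    by_cases hpy : p = y
    · subst hpy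
      simp
      ring
    · simp [hpy, Matrix.one_apply_ne hpy]
  have hsum : ∀ (A : Fin k → Fin k → Matrix (Fin k) (Fin k) ℂ) (T : Box μ → Fin k),
      ∑ i, ∑ j, ctDer μ (A i j) t T = ctDer μ (∑ i, ∑ j, A i j) t T := by
    intro A T
    simp only [ctDer_sum, Finset.sum_apply]
  have h1 : ∀ T : Box μ → Fin k, ctDer μ (1 : Matrix (Fin k) (Fin k) ℂ) t T = μ.card * t T := by
    intro T
    simp [ctDer, Matrix.one_apply, YoungDiagram.card]
  funext T
  simp only [casimir, Finset.sum_apply, ctDer_mul_apply, Finset.sum_add_distrib]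
  rw [hsum, hA, ctDer_smul, Pi.smul_apply, h1, Pi.smul_apply]
  have h4 : ∑ i : Fin k, ∑ j : Fin k, ∑ b, ∑ c ∈ Finset.univ.erase b, ∑ x, ∑ y,
      soGen i j (T b) x * soGen j i (T c) y * t (Function.update (Function.update T b x) c y) =
      ∑ b, ∑ c ∈ Finset.univ.erase b, 2 * t (T ∘ Equiv.swap b c) := by
    have h5 : ∀ b c, c ∈ Finset.univ.erase b → ∑ x, ∑ y, (∑ i, ∑ j,
        soGen i j (T b) x * soGen j i (T c) y) *
          t (Function.update (Function.update T b x) c y) = 2 * t (T ∘ Equiv.swap b c) := by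
      intro b c hc
      have hcb : c ≠ b := Finset.ne_of_mem_erase hc
      simp only [sum_soGen_mul_soGen, mul_sub, sub_mul, Finset.sum_sub_distrib]
      have h6 : ∑ x, ∑ y, 2 * (if T b = (T c).rev ∧ x = y.rev then (1 : ℂ) else 0) *
          t (Function.update (Function.update T b x) c y) = 0 := by
        by_cases hT : T b = (T c).rev
        · have := h3 b c hcb.symm T
          simp only [contraction, revForm_apply] at this
          have hr (x y : Fin k) : x = y.rev ↔ y = x.rev := by
            constructor <;> rintro rfl <;> simp
          simp only [hT, true_and, mul_assoc, ← Finset.mul_sum, hr]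
          rw [this, mul_zero]
        · simp [hT]
      rw [h6, sub_zero, Finset.sum_eq_single (T c), Finset.sum_eq_single (T b)]
      · have : Function.update (Function.update T b (T c)) c (T b) = T ∘ Equiv.swap b c := by
          funext a
          by_cases hac : a = c
          · subst hac; simp
          · by_cases hab : a = b
            · subst hab; simp [hac]
            · simp [hac, hab, Equiv.swap_apply_of_ne_of_ne]
        rw [this]; simp
      · intro y _ hy; simp [Ne.symm hy]
      · simp
      · intro x _ hx; simp [hx]
      · simp
    rw [sum_sum_sum_rotate]
    refine Finset.sum_congr rfl fun b _ => ?_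
    rw [sum_sum_sum_rotate]
    refine Finset.sum_congr rfl fun c hc => ?_
    rw [← h5 b c hc, sum_sum_sum_rotate]
    refine Finset.sum_congr rfl fun x _ => ?_
    rw [sum_sum_sum_rotate]
    simp only [Finset.sum_mul]
  have h5 : ∑ b, ∑ c ∈ Finset.univ.erase b, t (T ∘ Equiv.swap b c) =
      swapEigenvalue μ * t T - μ.card * t T := by
    rw [← h2 T]
    have : ∀ b : Box μ, ∑ c, t (T ∘ Equiv.swap b c) =
        t T + ∑ c ∈ Finset.univ.erase b, t (T ∘ Equiv.swap b c) := fun b => by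
      rw [← Finset.add_sum_erase _ _ (Finset.mem_univ b)]
      simp
    simp only [this, Finset.sum_add_distrib]
    simp [YoungDiagram.card]
  rw [h4]
  simp only [← Finset.mul_sum]
  rw [h5, smul_eq_mul, smul_eq_mul]
  ring

end SplitForm

end Vexillar

end

noncomputable section

namespace Vexillar

/-! ### Dominant weights are separated by the Casimir value. -/

section Weights

/-- Abel summation: the partial sums of `δ` are nonnegative and their coefficients, the successive
gaps of `κ` down to `c`, are at least 1. The bound `c` is left free because the induction replaces
it by `κ q`. -/
theorem sum_partialSum_le_sum_mul (N : ℕ) (κ δ : ℕ → ℤ) (hκ : ∀ i j, i < j → j < N → κ j < κ i)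
    (hδ : ∀ j ≤ N, 0 ≤ ∑ i ∈ Finset.range j, δ i) :
    ∀ q ≤ N, ∀ c : ℤ, (∀ i < q, c < κ i) →
      ∑ j ∈ Finset.range q, ∑ i ∈ Finset.range (j + 1), δ i ≤
        ∑ i ∈ Finset.range q, δ i * (κ i - c) := by
  intro q
  induction q with
  | zero => simp
  | succ q ih =>
    intro hq c hc
    have h1 := ih (by omega) (κ q) fun i hi => hκ i q hi (by omega)
    have h2 : ∑ i ∈ Finset.range (q + 1), δ i * (κ i - c) =
        ∑ i ∈ Finset.range q, δ i * (κ i - κ q) +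
          (κ q - c) * ∑ i ∈ Finset.range (q + 1), δ i := by
      rw [Finset.sum_range_succ, Finset.sum_range_succ (f := δ), mul_add, Finset.mul_sum,
        ← add_assoc, ← Finset.sum_add_distrib]
      congr 1
      · exact Finset.sum_congr rfl fun i _ => by ring
      · ring
    rw [h2, Finset.sum_range_succ]
    have h3 := hδ (q + 1) hq
    have h4 : 1 ≤ κ q - c := by have := hc q (by omega); omega
    nlinarith

/-- With `δ = b - a` and `κ = a + b + ρ` the last hypothesis reads `∑ δκ = 0`, whereas `κ` is
strictly decreasing and the partial sums of `δ` are nonnegative. -/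
theorem eq_of_sum_mul_add_eq (N : ℕ) (a b ρ : ℕ → ℤ)
    (ha : ∀ i j, i < j → j < N → a j ≤ a i) (hb : ∀ i j, i < j → j < N → b j ≤ b i)
    (ha0 : ∀ i < N, 0 ≤ a i) (hb0 : ∀ i < N, 0 ≤ b i)
    (hρ : ∀ i j, i < j → j < N → ρ j < ρ i) (hρ0 : ∀ i < N, 0 ≤ ρ i)
    (hab : ∀ j ≤ N, ∑ i ∈ Finset.range j, a i ≤ ∑ i ∈ Finset.range j, b i)
    (h : ∑ i ∈ Finset.range N, a i * (a i + ρ i) = ∑ i ∈ Finset.range N, b i * (b i + ρ i)) :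
    ∀ i < N, a i = b i := by
  have hS : ∀ j ≤ N, 0 ≤ ∑ i ∈ Finset.range j, (b i - a i) := fun j hj => by
    rw [Finset.sum_sub_distrib]; linarith [hab j hj]
  have h0 : ∑ i ∈ Finset.range N, (b i - a i) * (a i + b i + ρ i) = 0 := by
    rw [Finset.sum_congr rfl fun i _ => show (b i - a i) * (a i + b i + ρ i) =
      b i * (b i + ρ i) - a i * (a i + ρ i) by ring, Finset.sum_sub_distrib, h, sub_self]
  cases N with
  | zero => intro i hi; omega
  | succ N =>
    -- The last `κ` may be 0, hence `c = -1`. The extra term `∑ δ` this costs is the last partial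
    -- sum, so the earlier ones must vanish.
    have h1 := sum_partialSum_le_sum_mul (N + 1) (fun i => a i + b i + ρ i) (fun i => b i - a i)
      (fun i j hij hj => by linarith [ha i j hij hj, hb i j hij hj, hρ i j hij hj]) hS (N + 1) le_rfl
      (-1) (fun i hi => by linarith [ha0 i hi, hb0 i hi, hρ0 i hi])
    have h2 : ∑ i ∈ Finset.range (N + 1), (b i - a i) * (a i + b i + ρ i - -1) =
        ∑ i ∈ Finset.range (N + 1), (b i - a i) := by
      rw [Finset.sum_congr rfl fun i _ => show (b i - a i) * (a i + b i + ρ i - -1) =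
        (b i - a i) * (a i + b i + ρ i) + (b i - a i) by ring, Finset.sum_add_distrib, h0, zero_add]
    rw [h2, Finset.sum_range_succ] at h1
    have h3 : ∀ j ∈ Finset.range N, ∑ i ∈ Finset.range (j + 1), (b i - a i) = 0 := by
      refine (Finset.sum_eq_zero_iff_of_nonneg fun j hj => hS _ ?_).1 (le_antisymm ?_ ?_)
      · have := Finset.mem_range.1 hj; omega
      · linarith
      · exact Finset.sum_nonneg fun j hj => hS _ (by have := Finset.mem_range.1 hj; omega)
    have h4 : ∀ j ≤ N, ∑ i ∈ Finset.range j, (b i - a i) = 0 := by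
      intro j hj
      cases j with
      | zero => simp
      | succ j => exact h3 j (Finset.mem_range.2 hj)
    have h5 : ∀ i < N, a i = b i := by
      intro i hi
      have h6 := h4 (i + 1) hi
      rw [Finset.sum_range_succ, h4 i hi.le] at h6
      linarith
    intro i hi
    rcases Nat.lt_succ_iff_lt_or_eq.1 hi with hi' | rfl
    · exact h5 i hi'
    · rw [Finset.sum_range_succ, Finset.sum_eq_zero, zero_add] at h0
      -- If the last `κ` vanishes, so do its nonnegative summands `a` and `b`.
      · rcases mul_eq_zero.1 h0 with h6 | h6
        · linarith
        · linarith [ha0 i hi, hb0 i hi, hρ0 i hi]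
      · intro j hj
        rw [h5 j (Finset.mem_range.1 hj)]; simp

variable {k : ℕ}

/-- The eigenvalue of the Casimir operator on a highest weight vector. -/
def casimirValue (a : Fin k → ℤ) : ℤ :=
  ∑ i, ∑ j, if i = j then a i ^ 2 else if i < j ∧ j ≠ i.rev then a i - a j else 0

theorem sum_eq_two_mul_sum_lt_half (g : Fin k → ℤ) (hg : ∀ i, g i.rev = g i)
    (h0 : ∀ i : Fin k, i.rev = i → g i = 0) :
    ∑ i, g i = ∑ i : Fin k, if (i : ℕ) < k / 2 then 2 * g i else 0 := by
  have h1 : ∀ i, g i = (if (i : ℕ) < k / 2 then g i else 0) +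
      if (i.rev : ℕ) < k / 2 then g i.rev else 0 := by
    intro i
    have hr := Fin.val_rev i
    have hi := i.2
    rw [hg]
    by_cases h : i.rev = i
    · simp [h0 i h]
    · have h' : (i.rev : ℕ) ≠ i := fun h' => h (Fin.ext h')
      by_cases h2 : (i : ℕ) < k / 2
      · rw [if_pos h2, if_neg (by omega), add_zero]
      · rw [if_neg h2, if_pos (by omega), zero_add]
  rw [Finset.sum_congr rfl fun i _ => h1 i, Finset.sum_add_distrib,
    show (∑ i : Fin k, if (i.rev : ℕ) < k / 2 then g i.rev else 0) =
      ∑ i : Fin k, if (i : ℕ) < k / 2 then g i else 0 from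
      Equiv.sum_comp Fin.revPerm fun i : Fin k => if (i : ℕ) < k / 2 then g i else 0]
  rw [← Finset.sum_add_distrib]
  exact Finset.sum_congr rfl fun i _ => by split_ifs <;> ring

/-- The classical form `2⟨a, a + 2ρ⟩`, with `2ρ_i = k - 2 - 2i` for `so(k)`; indices `i` and `i.rev`
contribute equally. -/
theorem casimirValue_eq (a : Fin k → ℤ) (ha : ∀ i, a i.rev = -a i) :
    casimirValue a = 2 * ∑ i : Fin k,
      if (i : ℕ) < k / 2 then a i * (a i + (k - 2 - 2 * (i : ℕ))) else 0 := by
  have h1 : ∀ i j : Fin k, (if i = j then a i ^ 2 else if i < j ∧ j ≠ i.rev then a i - a j else 0) =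
      (if i = j then a i ^ 2 else 0) + (if i < j then a i else 0) - (if i < j then a j else 0) -
        if j = i.rev then (if i < i.rev then 2 * a i else 0) else 0 := by
    intro i j
    by_cases hij : i = j
    · subst hij
      by_cases hr : i = i.rev
      · have : ¬ i < i.rev := by rw [← hr]; exact lt_irrefl i
        simp [this]
      · simp [hr]
    · by_cases hj : j = i.rev
      · subst hj
        by_cases hl : i < i.rev
        · simp only [hij, if_false, hl, if_true, ne_eq, not_true, and_false, ha]; ring
        · simp [hij, hl]
      · by_cases hl : i < j <;> simp [hij, hj, hl]
  have h2 : ∀ i : Fin k, (Finset.univ.filter fun j => i < j).card = k - 1 - (i : ℕ) := fun i => by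
    rw [show (Finset.univ.filter fun j => i < j) = Finset.Ioi i by ext; simp, Fin.card_Ioi]
  have h3 : ∀ i : Fin k, (Finset.univ.filter fun j => j < i).card = (i : ℕ) := fun i => by
    rw [show (Finset.univ.filter fun j => j < i) = Finset.Iio i by ext; simp, Fin.card_Iio]
  have h4 : ∑ i : Fin k, ∑ j, (if i < j then a j else 0) = ∑ j : Fin k, (j : ℕ) * a j := by
    rw [Finset.sum_comm]
    refine Finset.sum_congr rfl fun j _ => ?_
    rw [← Finset.sum_filter, Finset.sum_const, h3, nsmul_eq_mul]
  have h5 : ∑ i : Fin k, ∑ j, (if i < j then a i else 0) =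
      ∑ i : Fin k, ((k : ℤ) - 1 - (i : ℕ)) * a i := by
    refine Finset.sum_congr rfl fun i _ => ?_
    rw [← Finset.sum_filter, Finset.sum_const, h2, nsmul_eq_mul]
    have := i.2
    congr 1
    omega
  have h6 : ∑ i : Fin k, (a i ^ 2 + ((k : ℤ) - 1 - 2 * (i : ℕ)) * a i) =
      ∑ i : Fin k, if (i : ℕ) < k / 2 then
        2 * (a i ^ 2 + ((k : ℤ) - 1 - 2 * (i : ℕ)) * a i) else 0 := by
    refine sum_eq_two_mul_sum_lt_half _ (fun i => ?_) fun i hi => ?_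
    · rw [ha, Fin.val_rev]
      have : ((k - ((i : ℕ) + 1) : ℕ) : ℤ) = k - 1 - (i : ℕ) := by have := i.2; omega
      rw [this]; ring
    · have : a i = 0 := by have := ha i; rw [hi] at this; linarith
      rw [this]; ring
  have h7 : ∀ i : Fin k, (i < i.rev) ↔ (i : ℕ) < k / 2 := fun i => by
    rw [Fin.lt_def, Fin.val_rev]; omega
  simp only [casimirValue, h1, Finset.sum_sub_distrib, Finset.sum_add_distrib, h4, h5]
  have h8 : ∑ i : Fin k, a i ^ 2 + ∑ i : Fin k, ((k : ℤ) - 1 - (i : ℕ)) * a i -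
      ∑ j : Fin k, (j : ℕ) * a j =
      ∑ i : Fin k, (a i ^ 2 + ((k : ℤ) - 1 - 2 * (i : ℕ)) * a i) := by
    rw [← Finset.sum_add_distrib, ← Finset.sum_sub_distrib]
    exact Finset.sum_congr rfl fun i _ => by ring
  simp only [Finset.sum_ite_eq, Finset.sum_ite_eq', Finset.mem_univ, if_true, h7]
  rw [h8, h6, ← Finset.sum_sub_distrib, Finset.mul_sum]
  refine Finset.sum_congr rfl fun i _ => ?_
  split_ifs <;> ring

theorem sum_lt_half_eq_sum_range (g : ℕ → ℤ) {q : ℕ} (hq : q ≤ k) :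
    ∑ i : Fin k, (if (i : ℕ) < q then g i else 0) = ∑ i ∈ Finset.range q, g i := by
  rw [Fin.sum_univ_eq_sum_range (fun i => if i < q then g i else 0) k, ← Finset.sum_filter]
  congr 1
  ext i
  simp only [Finset.mem_filter, Finset.mem_range]
  omega

theorem eq_of_casimirValue_eq {a b : Fin k → ℤ} (ha : ∀ i, a i.rev = -a i)
    (hb : ∀ i, b i.rev = -b i)
    (ha1 : ∀ i j : Fin k, i < j → (j : ℕ) < k / 2 → a j ≤ a i)
    (hb1 : ∀ i j : Fin k, i < j → (j : ℕ) < k / 2 → b j ≤ b i)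
    (ha0 : ∀ i : Fin k, (i : ℕ) < k / 2 → 0 ≤ a i) (hb0 : ∀ i : Fin k, (i : ℕ) < k / 2 → 0 ≤ b i)
    (hab : ∀ q ≤ k / 2, (∑ i : Fin k, if (i : ℕ) < q then a i else 0) ≤
      ∑ i : Fin k, if (i : ℕ) < q then b i else 0)
    (h : casimirValue a = casimirValue b) : ∀ i : Fin k, (i : ℕ) < k / 2 → a i = b i := by
  let ext (c : Fin k → ℤ) (i : ℕ) : ℤ := if h : i < k then c ⟨i, h⟩ else 0
  have hext (c : Fin k → ℤ) (i : Fin k) : ext c i = c i := dif_pos i.2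
  have hext' (c : Fin k → ℤ) (i : ℕ) (hi : i < k) : ext c i = c ⟨i, hi⟩ := dif_pos hi
  have hk : k / 2 ≤ k := Nat.div_le_self _ _
  have hval (c : Fin k → ℤ) (hc : ∀ i, c i.rev = -c i) : casimirValue c =
      2 * ∑ i ∈ Finset.range (k / 2), ext c i * (ext c i + (k - 2 - 2 * (i : ℤ))) := by
    rw [casimirValue_eq c hc,
      ← sum_lt_half_eq_sum_range (fun i => ext c i * (ext c i + (k - 2 - 2 * (i : ℤ)))) hk]
    simp only [hext]
  have hsum (c : Fin k → ℤ) (q : ℕ) (hq : q ≤ k / 2) :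
      (∑ i : Fin k, if (i : ℕ) < q then c i else 0) = ∑ i ∈ Finset.range q, ext c i := by
    rw [← sum_lt_half_eq_sum_range (ext c) (hq.trans hk)]
    simp only [hext]
  have key := eq_of_sum_mul_add_eq (k / 2) (ext a) (ext b) (fun i => k - 2 - 2 * (i : ℤ))
    (fun i j hij hj => by
      rw [hext' a i (by omega), hext' a j (by omega)]; exact ha1 _ _ hij hj)
    (fun i j hij hj => by
      rw [hext' b i (by omega), hext' b j (by omega)]; exact hb1 _ _ hij hj)
    (fun i hi => by rw [hext' a i (by omega)]; exact ha0 _ hi)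
    (fun i hi => by rw [hext' b i (by omega)]; exact hb0 _ hi)
    (fun i j hij _ => by omega) (fun i hi => by omega)
    (fun q hq => by rw [← hsum a q hq, ← hsum b q hq]; exact hab q hq)
    (by rw [hval a ha, hval b hb] at h; linarith)
  intro i hi
  rw [← hext a i, ← hext b i]
  exact key i hi

end Weights

/-! ### Column-injective tableaux and the dominance order. -/

section Tableaux

variable {μ : YoungDiagram} {k : ℕ}

/-- The entries of each column are distinct. -/
def ColInjective (T : Box μ → Fin k) : Prop :=
  ∀ b c : Box μ, b.1.2 = c.1.2 → T b = T c → b = c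

theorem Box.row_lt (b : Box μ) : b.1.1 < μ.colLen b.1.2 :=
  YoungDiagram.mem_iff_lt_colLen.1 ((YoungDiagram.mem_cells _).1 b.2)

/-- The box of a given column in the row given by the entry of a tableau. -/
theorem box_mem {i j : ℕ} (h : i < μ.colLen j) : (i, j) ∈ μ.cells :=
  (YoungDiagram.mem_cells _).2 (YoungDiagram.mem_iff_lt_colLen.2 h)

/-- In a column of length at most `q` boxes stay in place; in a longer one, a box with entry `x < q`
goes to row `x`. Distinct entries in each column make this injective. -/
theorem ColInjective.exists_injOn {T : Box μ → Fin k} (hT : ColInjective T) (q : ℕ) :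
    ∃ f : Box μ → Box μ, (∀ b, (T b : ℕ) < q → (f b).1.1 < q) ∧
      Set.InjOn f {b | (T b : ℕ) < q} ∧ ∀ b, (f b).1.2 = b.1.2 ∧ (μ.colLen b.1.2 ≤ q → f b = b) := by
  let f : Box μ → Box μ := fun b =>
    if h : μ.colLen b.1.2 ≤ q then b else
      if h' : (T b : ℕ) < q then ⟨(T b, b.1.2), box_mem (by omega)⟩ else b
  have hcol : ∀ b, (f b).1.2 = b.1.2 := fun b => by
    simp only [f]; split_ifs <;> rfl
  have hid : ∀ b, μ.colLen b.1.2 ≤ q → f b = b := fun b hb => dif_pos hb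
  have hlt : ∀ b, ¬ μ.colLen b.1.2 ≤ q → (T b : ℕ) < q → (f b).1.1 = T b := fun b hb hb' => by
    simp only [f, dif_neg hb, dif_pos hb']
  refine ⟨f, fun b hb => ?_, fun b hb c hc h => ?_, fun b => ⟨hcol b, hid b⟩⟩
  · by_cases h : μ.colLen b.1.2 ≤ q
    · rw [hid b h]
      exact b.row_lt.trans_le h
    · rw [hlt b h hb]; exact hb
  · have h2 : b.1.2 = c.1.2 := by rw [← hcol b, h, hcol]
    by_cases hq : μ.colLen b.1.2 ≤ q
    · rw [hid b hq, hid c (h2 ▸ hq)] at h; exact h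
    · have h3 : (T b : ℕ) = T c := by
        rw [← hlt b hq hb, h, hlt c (h2 ▸ hq) hc]
      exact hT b c h2 (Fin.ext h3)

theorem ColInjective.card_lt_le {T : Box μ → Fin k} (hT : ColInjective T) (q : ℕ) :
    (Finset.univ.filter fun b => (T b : ℕ) < q).card ≤
      (Finset.univ.filter fun b : Box μ => b.1.1 < q).card := by
  obtain ⟨f, h1, h2, -⟩ := hT.exists_injOn q
  refine Finset.card_le_card_of_injOn f (fun b hb => ?_) ?_
  · simp only [Finset.coe_filter, Finset.mem_univ, true_and] at hb ⊢
    exact h1 b hb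
  · simpa using h2

/-- Equality of the counts makes the injection onto the first `q` rows; as it fixes the boxes of
short columns, such a box is its own preimage. -/
theorem ColInjective.lt_of_card_eq {T : Box μ → Fin k} (hT : ColInjective T) {q : ℕ}
    (hq : (Finset.univ.filter fun b : Box μ => b.1.1 < q).card ≤
      (Finset.univ.filter fun b => (T b : ℕ) < q).card) {b : Box μ} (hb : μ.colLen b.1.2 ≤ q) :
    (T b : ℕ) < q := by
  obtain ⟨f, h1, h2, h3⟩ := hT.exists_injOn q
  have hs := Finset.surjOn_of_injOn_of_card_le f
    (s := Finset.univ.filter fun b => (T b : ℕ) < q)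
    (t := Finset.univ.filter fun b : Box μ => b.1.1 < q)
    (fun b hb => by
      simp only [Finset.coe_filter, Finset.mem_univ, true_and] at hb ⊢; exact h1 b hb)
    (by simpa using h2) hq
  obtain ⟨c, hc, hcb⟩ := hs (a := b) (by simpa using b.row_lt.trans_le hb)
  have hcol : c.1.2 = b.1.2 := by rw [← (h3 c).1, hcb]
  have : c = b := by rw [← (h3 c).2 (hcol ▸ hb), hcb]
  rw [← this]
  simpa using hc

/-- A tableau with distinct entries in the columns whose columns are filled by the smallest
possible entries is obtained from that inscribed with row indices by permuting the columns. -/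
theorem ColInjective.exists_perm {T : Box μ → Fin k} (hT : ColInjective T)
    (hlt : ∀ b, (T b : ℕ) < μ.colLen b.1.2) :
    ∃ σ : Equiv.Perm (Box μ), (∀ b, (σ b).1.2 = b.1.2) ∧ ∀ b, (σ b).1.1 = T b := by
  let f : Box μ → Box μ := fun b => ⟨(T b, b.1.2), box_mem (hlt b)⟩
  have hf : Function.Injective f := fun b c h =>
    hT b c (congrArg (fun x => x.1.2) h) (Fin.ext (congrArg (fun x => x.1.1) h))
  exact ⟨Equiv.ofBijective f (Finite.injective_iff_bijective.1 hf), fun _ => rfl, fun _ => rfl⟩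

/-- For each box, `f b` and the number of `q < N` with `f b ≤ q` add up to `N`. This turns
inequalities between counts into an inequality between sums of entries. -/
theorem sum_eq_sum_card_gt (f : Box μ → ℕ) {N : ℕ} (hf : ∀ b, f b ≤ N) :
    ∑ b, f b + ∑ q ∈ Finset.range N, (Finset.univ.filter fun b => f b < q + 1).card =
      N * μ.card := by
  simp only [Finset.card_filter]
  rw [Finset.sum_comm, ← Finset.sum_add_distrib]
  have (b : Box μ) : f b + ∑ q ∈ Finset.range N, (if f b < q + 1 then 1 else 0) = N := by
    rw [← Finset.card_filter, show (Finset.range N).filter (fun q => f b < q + 1) =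
      Finset.Ico (f b) N by ext; simp; omega, Nat.card_Ico]
    have := hf b
    omega
  rw [Finset.sum_congr rfl fun b _ => this b]
  simp [YoungDiagram.card, mul_comm]

theorem ColInjective.sum_row_le {T : Box μ → Fin k} (hT : ColInjective T)
    (hk : ∀ b : Box μ, b.1.1 ≤ k) : ∑ b : Box μ, b.1.1 ≤ ∑ b, (T b : ℕ) := by
  have h1 := sum_eq_sum_card_gt (fun b : Box μ => b.1.1) hk
  have h2 := sum_eq_sum_card_gt (fun b : Box μ => (T b : ℕ)) fun b => (T b).2.le
  have h3 : ∑ q ∈ Finset.range k, (Finset.univ.filter fun b => (T b : ℕ) < q + 1).card ≤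
      ∑ q ∈ Finset.range k, (Finset.univ.filter fun b : Box μ => b.1.1 < q + 1).card :=
    Finset.sum_le_sum fun q _ => hT.card_lt_le (q + 1)
  omega

theorem tabWeight_rev (T : Box μ → Fin k) (i : Fin k) : tabWeight T i.rev = -tabWeight T i := by
  simp [tabWeight]

theorem sum_tabWeight_lt (T : Box μ → Fin k) (q : ℕ) :
    (∑ i : Fin k, if (i : ℕ) < q then tabWeight T i else 0) =
      ((Finset.univ.filter fun b => (T b : ℕ) < q).card : ℤ) -
        (Finset.univ.filter fun b => ((T b).rev : ℕ) < q).card := by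
  have h (U : Box μ → Fin k) : (∑ i : Fin k, if (i : ℕ) < q then
      ((Finset.univ.filter fun b => U b = i).card : ℤ) else 0) =
      (Finset.univ.filter fun b => (U b : ℕ) < q).card := by
    simp only [Finset.card_filter, Nat.cast_sum]
    rw [Finset.sum_congr rfl fun (i : Fin k) _ => show (if (i : ℕ) < q then
      ∑ b, ((if U b = i then 1 else 0 : ℕ) : ℤ) else 0) =
        ∑ b, if U b = i then (if (i : ℕ) < q then 1 else 0) else 0 by
        split_ifs <;> simp, Finset.sum_comm]
    simp
  have h2 := h fun b => (T b).rev
  rw [← h T, ← h2, ← Finset.sum_sub_distrib]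
  refine Finset.sum_congr rfl fun i _ => ?_
  have h3 (b : Box μ) : (T b).rev = i ↔ T b = i.rev := by
    constructor
    · rintro rfl; simp
    · intro h; rw [h, Fin.rev_rev]
  simp only [h3]
  split_ifs
  · rfl
  · rfl

end Tableaux

end Vexillar

end

noncomputable section

namespace Vexillar

/-! ### Highest weight vectors as tensors of least entry sum. -/

section HighestWeight

variable {μ : YoungDiagram} {k : ℕ}

theorem weylModule_isSplitStable : IsSplitStable (weylModule μ (revForm k)) :=
  fun _ _ hγ _ ht => ctMap_mem_weylModule hγ ht

theorem colInjective_of_ne_zero {K : Matrix (Fin k) (Fin k) ℂ} {t : CTensor μ k}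
    (ht : t ∈ weylModule μ K) {T : Box μ → Fin k} (hT : t T ≠ 0) : ColInjective T := by
  intro b c hbc h
  by_contra hne
  have h1 := ht.1 (Equiv.swap b c) (swap_col hbc) T
  have h2 : T ∘ Equiv.swap b c = T := by
    funext a
    by_cases hb : a = b
    · simp [hb, h]
    · by_cases hc : a = c
      · simp [hc, h]
      · simp [Equiv.swap_apply_of_ne_of_ne hb hc]
  rw [h2, Equiv.Perm.sign_swap hne] at h1
  simp only [Units.val_neg, Units.val_one, Int.cast_neg, Int.cast_one, neg_mul, one_mul] at h1
  exact hT (self_eq_neg.1 h1)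

theorem abs_tabWeight_le (T : Box μ → Fin k) (i : Fin k) :
    tabWeight T i ∈ Finset.Icc (-(μ.card : ℤ)) μ.card := by
  have h (j : Fin k) : (Finset.univ.filter fun b => T b = j).card ≤ μ.card := by
    refine (Finset.card_le_univ _).trans ?_
    rw [Fintype.card_coe]
  have h1 := h i
  have h2 := h i.rev
  rw [Finset.mem_Icc, tabWeight]
  omega

/-- Lagrange interpolation in the diagonal operators `soGen i i`: the multipliers preserving `M`
form a monoid containing each linear factor, and the product of these is the indicator of the weight
`a`. -/
theorem IsSplitStable.weight_component_mem {M : Submodule ℂ (CTensor μ k)} (hM : IsSplitStable M)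
    (a : Fin k → ℤ) {t : CTensor μ k} (ht : t ∈ M) :
    (fun T => if tabWeight T = a then t T else 0) ∈ M := by
  classical
  let S : Submonoid ((Box μ → Fin k) → ℂ) :=
    { carrier := {φ | ∀ u ∈ M, (fun T => φ T * u T) ∈ M}
      one_mem' := fun u hu => by simpa using hu
      mul_mem' := fun {φ ψ} hφ hψ u hu => by
        have := hφ _ (hψ u hu)
        simpa only [Pi.mul_apply, mul_assoc] using this }
  have hS (i : Fin k) (c : ℤ) : (fun T => ((tabWeight T i : ℂ) - c) / ((a i : ℂ) - c)) ∈ S := by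
    intro u hu
    have h1 : ((a i : ℂ) - c)⁻¹ • (ctDer μ (soGen i i) u - (c : ℂ) • u) ∈ M :=
      M.smul_mem _ (M.sub_mem (hM.ctDer_soGen_mem i i hu) (M.smul_mem _ hu))
    convert h1 using 1
    funext T
    simp only [Pi.smul_apply, Pi.sub_apply, ctDer_soGen_self, smul_eq_mul]
    ring
  have h2 := S.prod_mem (t := Finset.univ) fun i _ =>
    S.prod_mem (t := (Finset.Icc (-(μ.card : ℤ)) μ.card).erase (a i)) fun c _ => hS i c
  convert h2 t ht using 1
  funext T
  simp only [Finset.prod_apply]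
  split_ifs with h
  · rw [Finset.prod_eq_one, one_mul]
    intro i _
    refine Finset.prod_eq_one fun c hc => ?_
    rw [h, div_self]
    rw [← Int.cast_sub, Int.cast_ne_zero]
    have := Finset.ne_of_mem_erase hc
    omega
  · obtain ⟨i, hi⟩ := Function.ne_iff.1 h
    rw [Finset.prod_eq_zero (Finset.mem_univ i), zero_mul]
    refine Finset.prod_eq_zero (Finset.mem_erase.2 ⟨hi, abs_tabWeight_le T i⟩) ?_
    rw [sub_self, zero_div]

/-- A permutation of the basis that preserves the split form acts on a stable space. -/
theorem IsSplitStable.comp_perm_mem {M : Submodule ℂ (CTensor μ k)} (hM : IsSplitStable M)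
    (π : Equiv.Perm (Fin k)) (hπ : ∀ i, π i.rev = (π i).rev) {t : CTensor μ k} (ht : t ∈ M) :
    (fun T => t (π ∘ T)) ∈ M := by
  let P : Matrix (Fin k) (Fin k) ℂ := Matrix.of fun i j => if j = π i then 1 else 0
  have hP (i j) : P i j = if j = π i then 1 else 0 := rfl
  have h1 : ctMap μ P t = fun T => t (π ∘ T) := by
    funext T
    rw [ctMap_apply, Finset.sum_eq_single (π ∘ T)]
    · simp [hP]
    · intro S _ hS
      obtain ⟨b, hb⟩ := Function.ne_iff.1 hS
      rw [Finset.prod_eq_zero (Finset.mem_univ b), zero_mul]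
      rw [hP]
      exact if_neg hb
    · simp
  rw [← h1]
  refine hM P ?_ ?_ t ht
  · ext i j
    rw [Matrix.mul_apply, Matrix.one_apply]
    simp only [Matrix.conjTranspose_apply, hP]
    rw [Equiv.sum_comp π fun y => star (if i = y then (1 : ℂ) else 0) * if j = y then 1 else 0]
    by_cases hij : i = j
    · simp [hij]
    · simp [hij, apply_ite star]
  · ext i j
    rw [Matrix.mul_apply]
    simp only [mul_revForm_apply, Matrix.transpose_apply, hP, hπ, revForm_apply]
    rw [Equiv.sum_comp π fun y => (if i = y.rev then (1 : ℂ) else 0) * if j = y then 1 else 0]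
    have hr (x : Fin k) : i = x.rev ↔ x = i.rev := by
      constructor <;> rintro rfl <;> simp
    simp [hr]

/-- Shows that the weight determines the sum of the entries, which is therefore constant on a weight
vector. -/
theorem sum_mul_tabWeight (T : Box μ → Fin k) :
    ∑ i : Fin k, (i : ℤ) * tabWeight T i = 2 * ∑ b, (T b : ℤ) - (k - 1) * μ.card := by
  have h (f : Fin k → ℤ) : ∑ i : Fin k, f i * ((Finset.univ.filter fun b => T b = i).card : ℤ) =
      ∑ b, f (T b) := by
    simp only [Finset.card_filter, Nat.cast_sum, Finset.mul_sum]
    rw [Finset.sum_comm]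
    simp
  have h1 : ∑ i : Fin k, (i : ℤ) * ((Finset.univ.filter fun b => T b = i.rev).card : ℤ) =
      ∑ b, ((T b).rev : ℤ) := by
    rw [← h fun i => (i.rev : ℤ), ← Equiv.sum_comp Fin.revPerm]
    simp
  simp only [tabWeight, mul_sub, Finset.sum_sub_distrib]
  rw [h fun i => (i : ℤ), h1]
  have h2 (b : Box μ) : ((T b).rev : ℤ) = k - 1 - (T b : ℤ) := by
    rw [Fin.val_rev]; have := (T b).2; omega
  simp only [h2, Finset.sum_sub_distrib, Finset.sum_const, Finset.card_univ, Fintype.card_coe,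
    nsmul_eq_mul]
  simp only [YoungDiagram.card]
  ring

theorem sum_perm_sub (T : Box μ → Fin k) (i j : Fin k) (hij : i < j) (hj : (j : ℕ) < k / 2) :
    ∑ b, (((Equiv.swap i j * Equiv.swap i.rev j.rev) (T b) : Fin k) : ℤ) =
      ∑ b, (T b : ℤ) + ((j : ℤ) - i) * (tabWeight T i - tabWeight T j) := by
  have hi := Fin.val_rev i
  have hjr := Fin.val_rev j
  have hij' : (i : ℕ) < j := hij
  have h (x : Fin k) : (((Equiv.swap i j * Equiv.swap i.rev j.rev) x : Fin k) : ℤ) =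
      x + ((j : ℤ) - i) * ((if x = i then 1 else 0) - (if x = i.rev then 1 else 0) -
        ((if x = j then 1 else 0) - if x = j.rev then 1 else 0)) := by
    have e1 : i ≠ i.rev := fun h => by have := congrArg Fin.val h; omega
    have e2 : i ≠ j.rev := fun h => by have := congrArg Fin.val h; omega
    have e3 : j ≠ i.rev := fun h => by have := congrArg Fin.val h; omega
    have e4 : j ≠ j.rev := fun h => by have := congrArg Fin.val h; omega
    have e5 : i ≠ j := hij.ne
    have e6 : i.rev ≠ j.rev := fun h => e5 (Fin.rev_injective h)
    rw [Equiv.Perm.mul_apply]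
    by_cases h1 : x = i
    · subst h1
      rw [Equiv.swap_apply_of_ne_of_ne e1 e2, Equiv.swap_apply_left]
      simp [e1, e2, e5]
    by_cases h2 : x = j
    · subst h2
      rw [Equiv.swap_apply_of_ne_of_ne e3 e4, Equiv.swap_apply_right]
      simp [e3, e4, e5.symm]
    by_cases h3 : x = i.rev
    · subst h3
      rw [Equiv.swap_apply_left, Equiv.swap_apply_of_ne_of_ne e2.symm e4.symm]
      simp only [e1.symm, e3.symm, e6, if_true, if_false]
      omega
    by_cases h4 : x = j.rev
    · subst h4
      rw [Equiv.swap_apply_right, Equiv.swap_apply_of_ne_of_ne e1.symm e3.symm]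
      simp only [e2.symm, e4.symm, e6.symm, if_true, if_false]
      omega
    rw [Equiv.swap_apply_of_ne_of_ne h3 h4, Equiv.swap_apply_of_ne_of_ne h1 h2]
    simp [h1, h2, h3, h4]
  simp only [h, Finset.sum_add_distrib, ← Finset.mul_sum, Finset.sum_sub_distrib]
  simp only [tabWeight, Finset.card_filter, Nat.cast_sum, Nat.cast_ite, Nat.cast_one,
    Nat.cast_zero]

theorem sum_perm_rev (T : Box μ → Fin k) (i : Fin k) :
    ∑ b, ((Equiv.swap i i.rev (T b) : Fin k) : ℤ) =
      ∑ b, (T b : ℤ) + ((i.rev : ℤ) - i) * tabWeight T i := by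
  have h (x : Fin k) : ((Equiv.swap i i.rev x : Fin k) : ℤ) =
      x + ((i.rev : ℤ) - i) * ((if x = i then 1 else 0) - (if x = i.rev then 1 else 0)) := by
    by_cases h1 : x = i
    · subst h1
      by_cases e : x = x.rev
      · rw [Equiv.swap_apply_left, ← e]; simp
      · rw [Equiv.swap_apply_left]; simp [e]
    by_cases h2 : x = i.rev
    · subst h2
      rw [Equiv.swap_apply_right]; simp [h1]
    rw [Equiv.swap_apply_of_ne_of_ne h1 h2]
    simp [h1, h2]
  simp only [h, Finset.sum_add_distrib, ← Finset.mul_sum, Finset.sum_sub_distrib]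
  simp only [tabWeight, Finset.card_filter, Nat.cast_sum, Nat.cast_ite, Nat.cast_one,
    Nat.cast_zero]

/-- For `i < j` the generator is strictly upper triangular: it can only lower entries, so it kills a
vector of least entry sum. -/
theorem soGen_lt_of_ne_zero {i j p x : Fin k} (hij : i < j) (h : soGen i j p x ≠ 0) : p < x := by
  rw [soGen_apply] at h
  by_cases h1 : i = p ∧ j = x
  · rw [← h1.1, ← h1.2]; exact hij
  · by_cases h2 : j = p.rev ∧ i = x.rev
    · rw [h2.1, h2.2] at hij
      exact Fin.rev_lt_rev.1 hij
    · simp [h1, h2] at h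

/-- A weight vector of a stable space whose tableaux have the least possible sum of entries. -/
structure IsExtremal (M : Submodule ℂ (CTensor μ k)) (v : CTensor μ k) (N : ℕ) (a : Fin k → ℤ) :
    Prop where
  mem : v ∈ M
  ne_zero : v ≠ 0
  le_sum : ∀ u ∈ M, ∀ T, u T ≠ 0 → N ≤ ∑ b, (T b : ℕ)
  sum_eq : ∀ T, v T ≠ 0 → ∑ b, (T b : ℕ) = N
  weight_eq : ∀ T, v T ≠ 0 → tabWeight T = a

variable {M : Submodule ℂ (CTensor μ k)} {v : CTensor μ k} {N : ℕ} {a : Fin k → ℤ}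

theorem IsExtremal.exists_ne_zero (h : IsExtremal M v N a) : ∃ T, v T ≠ 0 :=
  Function.ne_iff.1 h.ne_zero

/-- Among all supports of tensors of `M`, choose a tableau of least entry sum and project its tensor
onto the weight of that tableau. -/
theorem exists_isExtremal (hM : IsSplitStable M) (h0 : M ≠ ⊥) :
    ∃ v N a, IsExtremal M v N a := by
  classical
  obtain ⟨u, hu, hu0⟩ := M.ne_bot_iff.1 h0
  obtain ⟨T, hT⟩ := Function.ne_iff.1 hu0
  have hex : ∃ N, ∃ v ∈ M, ∃ T : Box μ → Fin k, v T ≠ 0 ∧ ∑ b, (T b : ℕ) = N :=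
    ⟨_, u, hu, T, hT, rfl⟩
  obtain ⟨v, hv, T₁, hT₁, hN⟩ := Nat.find_spec hex
  refine ⟨fun T => if tabWeight T = tabWeight T₁ then v T else 0, Nat.find hex, tabWeight T₁,
    hM.weight_component_mem _ hv, ?_, ?_, ?_, ?_⟩
  · refine Function.ne_iff.2 ⟨T₁, ?_⟩
    simpa using hT₁
  · exact fun u hu T hT => Nat.find_min' hex ⟨u, hu, T, hT, rfl⟩
  · intro T hT
    have hw : tabWeight T = tabWeight T₁ := by
      by_contra hw; simp [hw] at hT
    have h1 := sum_mul_tabWeight T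
    rw [hw, sum_mul_tabWeight T₁] at h1
    have h2 : ∑ b, (T b : ℤ) = ∑ b, (T₁ b : ℤ) := by linarith
    rw [← hN]
    exact_mod_cast h2
  · intro T hT
    by_contra hw; simp [hw] at hT

theorem IsExtremal.ctDer_eq_zero (h : IsExtremal M v N a) (hM : IsSplitStable M) {i j : Fin k}
    (hij : i < j) : ctDer μ (soGen i j) v = 0 := by
  by_contra hne
  obtain ⟨T, hT⟩ := Function.ne_iff.1 hne
  have h1 := h.le_sum _ (hM.ctDer_soGen_mem i j h.mem) T hT
  obtain ⟨b, -, hb⟩ := Finset.exists_ne_zero_of_sum_ne_zero hT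
  obtain ⟨x, -, hx⟩ := Finset.exists_ne_zero_of_sum_ne_zero hb
  have h2 := soGen_lt_of_ne_zero hij (left_ne_zero_of_mul hx)
  have h3 := h.sum_eq _ (right_ne_zero_of_mul hx)
  have h4 : ∑ c, (T c : ℕ) < ∑ c, (Function.update T b x c : ℕ) := by
    refine Finset.sum_lt_sum (fun c _ => ?_) ⟨b, Finset.mem_univ b, by simpa using h2⟩
    by_cases hc : c = b
    · subst hc; simpa using h2.le
    · rw [Function.update_of_ne hc]
  omega

theorem IsExtremal.sum_le_sum_perm (h : IsExtremal M v N a) (hM : IsSplitStable M)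
    {T : Box μ → Fin k} (hT : v T ≠ 0) (π : Equiv.Perm (Fin k)) (hπ : ∀ i, π i.rev = (π i).rev)
    (hπ2 : ∀ i, π (π i) = i) : ∑ b, (T b : ℤ) ≤ ∑ b, (π (T b) : ℤ) := by
  have h1 := h.le_sum _ (hM.comp_perm_mem π hπ h.mem) (π ∘ T) (by
    rwa [show π ∘ π ∘ T = T from funext fun b => hπ2 _])
  rw [← h.sum_eq T hT] at h1
  exact_mod_cast h1

/-- Exchanging `i` with `j`, and their reverses, preserves the form and changes the entry sum by `(j
- i)(a i - a j)`, which minimality makes nonnegative. -/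
theorem IsExtremal.weight_antitone (h : IsExtremal M v N a) (hM : IsSplitStable M) (i j : Fin k)
    (hij : i < j) (hj : (j : ℕ) < k / 2) : a j ≤ a i := by
  obtain ⟨T, hT⟩ := h.exists_ne_zero
  have hi := Fin.val_rev i
  have hjr := Fin.val_rev j
  have hij' : (i : ℕ) < j := hij
  have e1 : i ≠ i.rev := fun h => by have := congrArg Fin.val h; omega
  have e2 : i ≠ j.rev := fun h => by have := congrArg Fin.val h; omega
  have e3 : j ≠ i.rev := fun h => by have := congrArg Fin.val h; omega
  have e4 : j ≠ j.rev := fun h => by have := congrArg Fin.val h; omega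
  have hcomm : Equiv.swap i j * Equiv.swap i.rev j.rev =
      Equiv.swap i.rev j.rev * Equiv.swap i j := by
    rw [Equiv.mul_swap_eq_swap_mul, Equiv.swap_apply_of_ne_of_ne e1.symm e3.symm,
      Equiv.swap_apply_of_ne_of_ne e2.symm e4.symm]
  have hrev (p q x : Fin k) : (Equiv.swap p q x).rev = Equiv.swap p.rev q.rev x.rev := by
    have := Equiv.mul_swap_eq_swap_mul Fin.revPerm p q
    exact Equiv.congr_fun this x
  have h1 := h.sum_le_sum_perm hM hT (Equiv.swap i j * Equiv.swap i.rev j.rev)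
    (fun x => by
      simp only [Equiv.Perm.mul_apply, hrev, Fin.rev_rev]
      exact Equiv.congr_fun hcomm x.rev)
    (fun x => by
      rw [← Equiv.Perm.mul_apply]
      conv_lhs => enter [1, 2]; rw [hcomm]
      simp [Equiv.Perm.mul_apply])
  rw [sum_perm_sub T i j hij hj, h.weight_eq T hT] at h1
  have h2 : (0 : ℤ) < (j : ℤ) - i := by omega
  nlinarith

/-- The exchange of `i` and `i.rev` plays the same role. Its determinant is -1, so stability under
the full orthogonal group is used here. -/
theorem IsExtremal.weight_nonneg (h : IsExtremal M v N a) (hM : IsSplitStable M) (i : Fin k)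
    (hi : (i : ℕ) < k / 2) : 0 ≤ a i := by
  obtain ⟨T, hT⟩ := h.exists_ne_zero
  have hr := Fin.val_rev i
  have h1 := h.sum_le_sum_perm hM hT (Equiv.swap i i.rev)
    (fun x => by
      have := Equiv.congr_fun (Equiv.mul_swap_eq_swap_mul Fin.revPerm i i.rev) x
      have h3 : (Equiv.swap i i.rev x).rev = Equiv.swap i.rev i.rev.rev x.rev := this
      rw [h3, Fin.rev_rev, Equiv.swap_comm])
    (fun x => by rw [← Equiv.Perm.mul_apply, Equiv.swap_mul_self, Equiv.Perm.one_apply])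
  rw [sum_perm_rev, h.weight_eq T hT] at h1
  have h2 : (0 : ℤ) < (i.rev : ℤ) - i := by omega
  nlinarith

theorem IsExtremal.weight_rev (h : IsExtremal M v N a) (i : Fin k) : a i.rev = -a i := by
  obtain ⟨T, hT⟩ := h.exists_ne_zero
  rw [← h.weight_eq T hT, tabWeight_rev]

/-- For `i > j` the inner factor already kills `v`; for `i < j` only the commutator survives, and it
acts by a difference of weights. -/
theorem IsExtremal.casimir_eq (h : IsExtremal M v N a) (hM : IsSplitStable M) :
    casimir μ v = (casimirValue a : ℂ) • v := by
  have hD (i : Fin k) : ctDer μ (soGen i i) v = (a i : ℂ) • v := by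
    funext T
    rw [ctDer_soGen_self, Pi.smul_apply, smul_eq_mul]
    by_cases hT : v T = 0
    · rw [hT, mul_zero, mul_zero]
    · rw [h.weight_eq T hT]
  have h0 (A : Matrix (Fin k) (Fin k) ℂ) : ctDer μ A (0 : CTensor μ k) = 0 := by
    funext T; simp [ctDer]
  have hsm (A : Matrix (Fin k) (Fin k) ℂ) (r : ℂ) : ctDer μ A (r • v) = r • ctDer μ A v := by
    funext T; simp [ctDer, Finset.mul_sum, mul_left_comm]
  have hsub (A B : Matrix (Fin k) (Fin k) ℂ) : ctDer μ (A - B) v = ctDer μ A v - ctDer μ B v := by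
    rw [sub_eq_add_neg, ctDer_add, ← neg_one_smul ℂ B, ctDer_smul, neg_one_smul, sub_eq_add_neg]
  have hij (i j : Fin k) : ctDer μ (soGen i j) (ctDer μ (soGen j i) v) =
      ((if i = j then a i ^ 2 else if i < j ∧ j ≠ i.rev then a i - a j else 0 : ℤ) : ℂ) • v := by
    rcases lt_trichotomy i j with hlt | rfl | hlt
    · rw [ctDer_commutator, h.ctDer_eq_zero hM hlt, h0, zero_add, soGen_commutator i j hlt.ne,
        if_neg hlt.ne]
      by_cases hr : j = i.rev
      · rw [if_pos hr, if_neg (by simp [hr]), ← sub_self (0 : Matrix (Fin k) (Fin k) ℂ), hsub]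
        simp
      · rw [if_neg hr, if_pos ⟨hlt, hr⟩, hsub, hD, hD, ← sub_smul]
        push_cast; rfl
    · rw [if_pos rfl, hD, hsm, hD, smul_smul]
      push_cast; rw [sq]
    · rw [h.ctDer_eq_zero hM hlt, h0, if_neg hlt.ne', if_neg fun h => absurd h.1 hlt.not_gt]
      simp
  simp only [casimir, hij, casimirValue, ← Finset.sum_smul]
  push_cast
  rfl

end HighestWeight

end Vexillar

end

noncomputable section

namespace Vexillar

/-! ### The extremal tensor of shape `μ` and uniqueness of its line. -/

section RowTensor

variable {μ : YoungDiagram} {k : ℕ}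

theorem Box.row_lt_half (hμ : 2 * μ.colLen 0 ≤ k) (b : Box μ) : b.1.1 < k / 2 := by
  have h1 := b.row_lt
  have h2 := μ.colLen_anti 0 b.1.2 (Nat.zero_le _)
  omega

/-- The tableau whose entries are the row indices. -/
def rowTab (hμ : 2 * μ.colLen 0 ≤ k) : Box μ → Fin k :=
  fun b => ⟨b.1.1, (b.row_lt_half hμ).trans_le (Nat.div_le_self k 2)⟩

/-- The tableaux obtained from `rowTab` by permuting the columns. -/
def IsRowTab (hμ : 2 * μ.colLen 0 ≤ k) (T : Box μ → Fin k) : Prop :=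
  ∃ σ : Equiv.Perm (Box μ), (∀ b, (σ b).1.2 = b.1.2) ∧ T = rowTab hμ ∘ σ

/-- The Young symmetrizer applied to `rowTab`. -/
def rowTensor (hμ : 2 * μ.colLen 0 ≤ k) : Tensor μ k :=
  colAlt μ k (rowSym μ k (Pi.single (rowTab hμ) 1))

theorem rowTab_comp_row (hμ : 2 * μ.colLen 0 ≤ k) (τ : Equiv.Perm (Box μ))
    (hτ : ∀ b, (τ b).1.1 = b.1.1) : rowTab hμ ∘ τ = rowTab hμ :=
  funext fun b => Fin.ext (hτ b)

/-- Row permutations fix `rowTab`, so the row symmetrizer only multiplies by their number. -/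
theorem rowTensor_apply (hμ : 2 * μ.colLen 0 ≤ k) : ∃ c : ℝ, c ≠ 0 ∧
    rowTensor hμ = c • colAlt μ k (Pi.single (rowTab hμ) 1) := by
  classical
  refine ⟨(Finset.univ.filter fun σ : Equiv.Perm (Box μ) => ∀ b, (σ b).1.1 = b.1.1).card, ?_, ?_⟩
  · rw [Nat.cast_ne_zero]
    exact Finset.card_ne_zero_of_mem (Finset.mem_filter.2 ⟨Finset.mem_univ 1, fun _ => rfl⟩)
  · rw [rowTensor, ← map_smul]
    congr 1
    have h : ∀ τ : Equiv.Perm (Box μ), (∀ b, (τ b).1.1 = b.1.1) →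
        permMap τ (Pi.single (rowTab hμ) (1 : ℝ)) = Pi.single (rowTab hμ) 1 := by
      intro τ hτ
      funext T
      rw [permMap_apply, Pi.single_apply, Pi.single_apply]
      congr 1
      rw [eq_iff_iff]
      constructor
      · intro h
        rw [← rowTab_comp_row hμ τ hτ] at h
        funext b
        have := congrFun h (τ.symm b)
        simpa using this
      · rintro rfl
        exact rowTab_comp_row hμ τ hτ
    rw [rowSym, LinearMap.sum_apply, Finset.sum_congr rfl fun τ hτ =>
      h τ (Finset.mem_filter.1 hτ).2, Finset.sum_const, Nat.cast_smul_eq_nsmul]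

theorem rowTensor_isRowTab (hμ : 2 * μ.colLen 0 ≤ k) {T : Box μ → Fin k}
    (hT : rowTensor hμ T ≠ 0) : IsRowTab hμ T := by
  classical
  obtain ⟨c, -, h⟩ := rowTensor_apply hμ
  rw [h, Pi.smul_apply, colAlt, LinearMap.sum_apply, Finset.sum_apply] at hT
  obtain ⟨σ, hσ, hne⟩ := Finset.exists_ne_zero_of_sum_ne_zero (right_ne_zero_of_mul hT)
  rw [LinearMap.smul_apply, Pi.smul_apply, permMap_apply, Pi.single_apply] at hne
  have h1 : T ∘ σ = rowTab hμ := by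
    by_contra h1; simp [h1] at hne
  refine ⟨σ⁻¹, fun b => ?_, ?_⟩
  · have := (Finset.mem_filter.1 hσ).2 (σ⁻¹ b)
    rw [perm_apply_inv] at this
    exact this.symm
  · rw [← h1]
    funext b
    simp

theorem rowTensor_ne_zero (hμ : 2 * μ.colLen 0 ≤ k) : rowTensor hμ ≠ 0 := by
  classical
  obtain ⟨c, hc, h⟩ := rowTensor_apply hμ
  refine Function.ne_iff.2 ⟨rowTab hμ, ?_⟩
  rw [h, Pi.smul_apply, colAlt, LinearMap.sum_apply, Finset.sum_apply, Finset.sum_eq_single 1]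
  · simp only [LinearMap.smul_apply, Pi.smul_apply, permMap_apply, Equiv.Perm.coe_one,
      Function.comp_id, Pi.single_eq_same]
    simpa using hc
  · intro σ hσ hne
    rw [LinearMap.smul_apply, Pi.smul_apply, permMap_apply, Pi.single_eq_of_ne, smul_zero]
    intro h1
    -- A permutation preserving both rows and columns is the identity.
    refine hne (Equiv.ext fun b => Subtype.ext (Prod.ext ?_ ((Finset.mem_filter.1 hσ).2 b)))
    exact congrArg Fin.val (congrFun h1 b)
  · simp

theorem IsRowTab.lt_half {hμ : 2 * μ.colLen 0 ≤ k} {T : Box μ → Fin k} (hT : IsRowTab hμ T)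
    (b : Box μ) : (T b : ℕ) < k / 2 := by
  obtain ⟨σ, -, rfl⟩ := hT
  exact (σ b).row_lt_half hμ

/-- All entries in the support lie below `k / 2`, where no two are reverse to each other, so the
contractions vanish term by term. -/
theorem rowTensor_mem_weylModule (hμ : 2 * μ.colLen 0 ≤ k) :
    (rowTensor hμ).toComplex ∈ weylModule μ (revForm k) := by
  refine toComplex_mem_weylModule (t := rowTensor hμ) ⟨_, rfl⟩ fun b c hbc T => ?_
  refine Finset.sum_eq_zero fun x _ => Finset.sum_eq_zero fun y _ => ?_
  rw [revForm_apply]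
  split_ifs with h
  · rw [one_mul]
    by_contra hne
    have h1 : rowTensor hμ (Function.update (Function.update T b x) c y) ≠ 0 := fun h0 =>
      hne (by rw [Tensor.toComplex, h0, Complex.ofReal_zero])
    have h2 := (rowTensor_isRowTab hμ h1).lt_half b
    have h3 := (rowTensor_isRowTab hμ h1).lt_half c
    rw [Function.update_of_ne hbc, Function.update_self] at h2
    rw [Function.update_self, h, Fin.val_rev] at h3
    omega
  · rw [zero_mul]

theorem card_filter_comp_perm (σ : Equiv.Perm (Box μ)) (p : Box μ → Prop) [DecidablePred p] :
    (Finset.univ.filter fun b => p (σ b)).card = (Finset.univ.filter p).card := by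
  rw [Finset.card_filter, Finset.card_filter]
  exact Equiv.sum_comp σ fun b => if p b then 1 else 0

theorem IsRowTab.tabWeight_eq {hμ : 2 * μ.colLen 0 ≤ k} {T : Box μ → Fin k}
    (hT : IsRowTab hμ T) : tabWeight T = tabWeight (rowTab hμ) := by
  obtain ⟨σ, -, rfl⟩ := hT
  funext i
  simp only [tabWeight, Function.comp_apply]
  rw [card_filter_comp_perm σ fun b => rowTab hμ b = i,
    card_filter_comp_perm σ fun b => rowTab hμ b = i.rev]

theorem rowTensor_isExtremal (hμ : 2 * μ.colLen 0 ≤ k) :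
    IsExtremal (weylModule μ (revForm k)) (rowTensor hμ).toComplex (∑ b : Box μ, b.1.1)
      (tabWeight (rowTab hμ)) := by
  have hne (T : Box μ → Fin k) (hT : (rowTensor hμ).toComplex T ≠ 0) : IsRowTab hμ T :=
    rowTensor_isRowTab hμ fun h0 => hT (by rw [Tensor.toComplex, h0, Complex.ofReal_zero])
  refine ⟨rowTensor_mem_weylModule hμ, fun h0 => rowTensor_ne_zero hμ (funext fun T => ?_),
    fun u hu T hT => (colInjective_of_ne_zero hu hT).sum_row_le fun b => ?_, fun T hT => ?_,
    fun T hT => (hne T hT).tabWeight_eq⟩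
  · exact Complex.ofReal_eq_zero.1 (congrFun h0 T)
  · have := b.row_lt_half hμ
    omega
  · obtain ⟨σ, -, rfl⟩ := hne T hT
    exact Equiv.sum_comp σ fun b => b.1.1

/-- Every nonzero stable space of traceless tensors contains a nonzero multiple of the extremal
tensor. -/
theorem exists_mem_isRowTab (hμ : 2 * μ.colLen 0 ≤ k) {M : Submodule ℂ (CTensor μ k)}
    (hM : IsSplitStable M) (hW : M ≤ weylModule μ (revForm k)) (h0 : M ≠ ⊥) :
    ∃ v ∈ M, v ≠ 0 ∧ ∀ T, v T ≠ 0 → IsRowTab hμ T := by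
  obtain ⟨v, N, a, hv⟩ := exists_isExtremal hM h0
  refine ⟨v, hv.mem, hv.ne_zero, fun T hT => ?_⟩
  have hz := rowTensor_isExtremal hμ
  have hS : IsSplitStable (weylModule μ (revForm k)) := weylModule_isSplitStable
  -- Both vectors lie in `weylModule`, on which the Casimir operator is one scalar.
  have hcas : casimirValue a = casimirValue (tabWeight (rowTab hμ)) := by
    have h1 := (hv.casimir_eq hM).symm.trans (casimir_eq_smul (hW hv.mem))
    have h2 := (hz.casimir_eq hS).symm.trans (casimir_eq_smul hz.mem)
    have h3 := (smul_left_injective ℂ hv.ne_zero h1).trans (smul_left_injective ℂ hz.ne_zero h2).symm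
    exact_mod_cast h3
  have hcol := colInjective_of_ne_zero (hW hv.mem) hT
  have hrowsum (q : ℕ) (hq : q ≤ k / 2) :
      (∑ i : Fin k, if (i : ℕ) < q then tabWeight (rowTab hμ) i else 0) =
        (Finset.univ.filter fun b : Box μ => b.1.1 < q).card := by
    rw [sum_tabWeight_lt]
    have h1 : (Finset.univ.filter fun b => ((rowTab hμ b).rev : ℕ) < q) = ∅ := by
      refine Finset.filter_eq_empty_iff.2 fun b _ => ?_
      have h2 := b.row_lt_half hμ
      have h3 : ((rowTab hμ b).rev : ℕ) = k - (b.1.1 + 1) := Fin.val_rev _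
      omega
    rw [h1, Finset.card_empty, Nat.cast_zero, sub_zero]
    rfl
  -- Entries whose reverse is below `q` can only lower the partial sum of the weight.
  have hsum (q : ℕ) : (∑ i : Fin k, if (i : ℕ) < q then a i else 0) ≤
      ((Finset.univ.filter fun b => (T b : ℕ) < q).card : ℤ) := by
    rw [← hv.weight_eq T hT, sum_tabWeight_lt]
    omega
  have heq := eq_of_casimirValue_eq hv.weight_rev hz.weight_rev (hv.weight_antitone hM)
    (hz.weight_antitone hS) (hv.weight_nonneg hM) (hz.weight_nonneg hS)
    (fun q hq => by
      rw [hrowsum q hq]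
      exact (hsum q).trans (Nat.cast_le.2 (hcol.card_lt_le q))) hcas
  have hcard (q : ℕ) (hq : q ≤ k / 2) : (Finset.univ.filter fun b : Box μ => b.1.1 < q).card ≤
      (Finset.univ.filter fun b => (T b : ℕ) < q).card := by
    have h1 := hsum q
    rw [Finset.sum_congr rfl fun (i : Fin k) _ => show (if (i : ℕ) < q then a i else 0) =
      if (i : ℕ) < q then tabWeight (rowTab hμ) i else 0 by
        split_ifs with h
        · exact heq i (by omega)
        · rfl, hrowsum q hq] at h1
    exact_mod_cast h1
  have hlt (b : Box μ) : (T b : ℕ) < μ.colLen b.1.2 := by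
    have h2 := μ.colLen_anti 0 b.1.2 (Nat.zero_le _)
    -- The counts are compared with `q` equal to the length of the column of `b`.
    exact hcol.lt_of_card_eq (hcard _ (by omega)) le_rfl
  obtain ⟨σ, hσ, hσT⟩ := hcol.exists_perm hlt
  exact ⟨σ, hσ, funext fun b => Fin.ext (hσT b).symm⟩

/-- Two nonzero stable spaces of traceless tensors are not orthogonal. -/
theorem exists_star_dotProduct_ne_zero (hμ : 2 * μ.colLen 0 ≤ k) {M M' : Submodule ℂ (CTensor μ k)}
    (hM : IsSplitStable M) (hW : M ≤ weylModule μ (revForm k)) (h0 : M ≠ ⊥)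
    (hM' : IsSplitStable M') (hW' : M' ≤ weylModule μ (revForm k)) (h0' : M' ≠ ⊥) :
    ∃ x ∈ M, ∃ y ∈ M', star y ⬝ᵥ x ≠ 0 := by
  classical
  obtain ⟨x, hx, hx0, hxT⟩ := exists_mem_isRowTab hμ hM hW h0
  obtain ⟨y, hy, hy0, hyT⟩ := exists_mem_isRowTab hμ hM' hW' h0'
  refine ⟨x, hx, y, hy, ?_⟩
  have hne {u : CTensor μ k} (hu : u ∈ weylModule μ (revForm k)) (hu0 : u ≠ 0)
      (huT : ∀ T, u T ≠ 0 → IsRowTab hμ T) : u (rowTab hμ) ≠ 0 := by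
    obtain ⟨T, hT⟩ := Function.ne_iff.1 hu0
    obtain ⟨σ, hσ, rfl⟩ := huT T hT
    intro h
    exact hT (by rw [hu.1 σ hσ, h, mul_zero]; rfl)
  -- The signs of the column permutation cancel between `x` and `y`, so all nonzero terms are equal.
  have hterm (T : Box μ → Fin k) : star y T * x T =
      if IsRowTab hμ T then star (y (rowTab hμ)) * x (rowTab hμ) else 0 := by
    split_ifs with h
    · obtain ⟨σ, hσ, rfl⟩ := h
      rw [Pi.star_apply, (hW hx).1 σ hσ, (hW' hy).1 σ hσ, star_mul']
      have h1 : star (((σ.sign : ℤ) : ℂ)) * ((σ.sign : ℤ) : ℂ) = 1 := by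
        rcases Int.units_eq_one_or σ.sign with h | h <;> simp [h]
      linear_combination (star (y (rowTab hμ)) * x (rowTab hμ)) * h1
    · have : x T = 0 := by
        by_contra hT; exact h (hxT T hT)
      rw [this, mul_zero]
  rw [dotProduct, Finset.sum_congr rfl fun T _ => hterm T, ← Finset.sum_filter, Finset.sum_const,
    nsmul_eq_mul]
  refine mul_ne_zero (Nat.cast_ne_zero.2 ?_) (mul_ne_zero ?_ (hne (hW hx) hx0 hxT))
  · exact Finset.card_ne_zero_of_mem (a := rowTab hμ)
      (Finset.mem_filter.2 ⟨Finset.mem_univ _, 1, fun _ => rfl, rfl⟩)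
  · exact star_ne_zero.2 (hne (hW' hy) hy0 hyT)

end RowTensor

end Vexillar

end

noncomputable section

namespace Vexillar

/-! ### From the split form back to the real orthogonal group. -/

section CompactForm

variable {μ : YoungDiagram} {n : ℕ}

/-- A space of tensors stable under the real orthogonal group. -/
def IsOrthogonalStable (M : Submodule ℂ (CTensor μ n)) : Prop :=
  ∀ g : O n, ∀ t ∈ M, ctMap μ ((g : Matrix (Fin n) (Fin n) ℝ).map Complex.ofReal) t ∈ M

/-- A unitary matrix that takes the standard bilinear form to the split one. -/
def splitMatrix (n : ℕ) : Matrix (Fin n) (Fin n) ℂ :=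
  ((1 + Complex.I) / 2) • (1 : Matrix (Fin n) (Fin n) ℂ) + ((1 - Complex.I) / 2) • revForm n

theorem splitMatrix_transpose : (splitMatrix n)ᵀ = splitMatrix n := by
  simp [splitMatrix, revForm_transpose]

theorem revForm_mul_splitMatrix : revForm n * splitMatrix n =
    ((1 - Complex.I) / 2) • (1 : Matrix (Fin n) (Fin n) ℂ) + ((1 + Complex.I) / 2) • revForm n := by
  rw [splitMatrix, Matrix.mul_add, Matrix.mul_smul, Matrix.mul_smul, revForm_mul_self,
    Matrix.mul_one, add_comm]

theorem splitMatrix_mul_revForm : splitMatrix n * revForm n = revForm n * splitMatrix n := by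
  rw [revForm_mul_splitMatrix, splitMatrix, Matrix.add_mul, Matrix.smul_mul, Matrix.smul_mul,
    revForm_mul_self, Matrix.one_mul, add_comm]

theorem splitMatrix_conjTranspose : (splitMatrix n)ᴴ = revForm n * splitMatrix n := by
  have hJ : (revForm n)ᴴ = revForm n := by
    ext i j
    rw [Matrix.conjTranspose_apply, ← Matrix.transpose_apply (revForm n), revForm_transpose,
      revForm_apply]
    split_ifs <;> simp
  rw [revForm_mul_splitMatrix, splitMatrix, Matrix.conjTranspose_add, Matrix.conjTranspose_smul,
    Matrix.conjTranspose_smul, hJ, Matrix.conjTranspose_one]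
  congr 2
  · simp [sub_eq_add_neg]
  · simp [sub_eq_add_neg]

/-- The coefficients are chosen so that the matrix is 1 where `revForm n` is 1 and `i` where it is
-1: a unitary square root. -/
theorem splitMatrix_mul_self : splitMatrix n * splitMatrix n = revForm n := by
  nth_rw 1 [splitMatrix]
  rw [Matrix.add_mul, Matrix.smul_mul, Matrix.smul_mul, revForm_mul_splitMatrix, Matrix.one_mul,
    splitMatrix, smul_add, smul_add, smul_smul, smul_smul, smul_smul, smul_smul]
  have h1 : (1 + Complex.I) / 2 * ((1 + Complex.I) / 2) = Complex.I / 2 := by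
    linear_combination (1 / 4 : ℂ) * Complex.I_mul_I
  have h2 : (1 - Complex.I) / 2 * ((1 - Complex.I) / 2) = -(Complex.I / 2) := by
    linear_combination (1 / 4 : ℂ) * Complex.I_mul_I
  have h3 : (1 + Complex.I) / 2 * ((1 - Complex.I) / 2) = 1 / 2 := by
    linear_combination (-1 / 4 : ℂ) * Complex.I_mul_I
  have h4 : (1 - Complex.I) / 2 * ((1 + Complex.I) / 2) = 1 / 2 := by
    rw [mul_comm, h3]
  rw [h1, h2, h3, h4]
  module

theorem splitMatrix_conjTranspose_mul_self : (splitMatrix n)ᴴ * splitMatrix n = 1 := by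
  rw [splitMatrix_conjTranspose, Matrix.mul_assoc, splitMatrix_mul_self, revForm_mul_self]

theorem splitMatrix_mul_conjTranspose : splitMatrix n * (splitMatrix n)ᴴ = 1 :=
  mul_eq_one_comm.1 splitMatrix_conjTranspose_mul_self

theorem splitMatrix_transpose_mul_revForm_mul :
    (splitMatrix n)ᵀ * revForm n * splitMatrix n = 1 := by
  rw [splitMatrix_transpose, splitMatrix_mul_revForm, Matrix.mul_assoc, splitMatrix_mul_self,
    revForm_mul_self]

/-- The compact form of the split orthogonal group is conjugate to the real orthogonal group. -/
theorem exists_orthogonal_of_split {γ : Matrix (Fin n) (Fin n) ℂ} (h1 : γᴴ * γ = 1)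
    (h2 : γᵀ * revForm n * γ = revForm n) : ∃ g : O n,
      splitMatrix n * (g : Matrix (Fin n) (Fin n) ℝ).map Complex.ofReal = γ * splitMatrix n := by
  set B := splitMatrix n with hB
  let C := Bᴴ * γ * B
  have hC1 : Cᴴ * C = 1 := by
    calc Cᴴ * C = Bᴴ * (γᴴ * ((B * Bᴴ) * γ)) * B := by
          simp only [C, Matrix.conjTranspose_mul, Matrix.conjTranspose_conjTranspose,
            Matrix.mul_assoc]
      _ = 1 := by
          rw [splitMatrix_mul_conjTranspose, Matrix.one_mul, h1, Matrix.mul_one,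
            splitMatrix_conjTranspose_mul_self]
  have hBt : (Bᴴ)ᵀ = Bᴴ := by
    rw [splitMatrix_conjTranspose, Matrix.transpose_mul, splitMatrix_transpose, revForm_transpose,
      splitMatrix_mul_revForm]
  have hBB : Bᴴ * Bᴴ = revForm n := by
    have h3 : Bᴴ * Bᴴ = (B * B)ᴴ := (Matrix.conjTranspose_mul B B).symm
    rw [h3, splitMatrix_mul_self]
    ext i j
    rw [Matrix.conjTranspose_apply, ← Matrix.transpose_apply (revForm n), revForm_transpose,
      revForm_apply]
    split_ifs <;> simp
  have hC2 : Cᵀ * C = 1 := by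
    calc Cᵀ * C = Bᵀ * (γᵀ * (Bᴴ * Bᴴ) * γ) * B := by
          simp only [C, Matrix.transpose_mul, hBt, Matrix.mul_assoc]
      _ = 1 := by rw [hBB, h2, splitMatrix_transpose_mul_revForm_mul]
  -- `C` is both unitary and complex orthogonal, so its two inverses agree and its entries are real.
  have hCC : Cᴴ = Cᵀ := by
    have h3 := mul_eq_one_comm.1 hC1
    rw [← Matrix.one_mul Cᴴ, ← hC2, Matrix.mul_assoc, h3, Matrix.mul_one]
  have hreal (i j) : ((C i j).re : ℂ) = C i j := by
    have h3 : star (C i j) = C i j := by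
      have := congrFun (congrFun hCC j) i
      rwa [Matrix.conjTranspose_apply, Matrix.transpose_apply] at this
    exact Complex.conj_eq_iff_re.1 h3
  let R : Matrix (Fin n) (Fin n) ℝ := C.map Complex.re
  have hR : R.map Complex.ofReal = C := by
    ext i j; exact hreal i j
  have hRo : Rᵀ * R = 1 := by
    have hinj : Function.Injective fun A : Matrix (Fin n) (Fin n) ℝ => A.map Complex.ofReal :=
      Matrix.map_injective Complex.ofReal_injective
    refine hinj ?_
    change (Rᵀ * R).map Complex.ofRealHom = (1 : Matrix (Fin n) (Fin n) ℝ).map Complex.ofRealHom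
    rw [Matrix.map_mul, Matrix.map_one _ (map_zero _) (map_one _), ← Matrix.transpose_map]
    change (R.map Complex.ofReal)ᵀ * R.map Complex.ofReal = 1
    rw [hR, hC2]
  refine ⟨⟨R, Matrix.mem_unitaryGroup_iff'.2 hRo⟩, ?_⟩
  change B * R.map Complex.ofReal = γ * B
  rw [hR]
  simp only [C]
  rw [← Matrix.mul_assoc, ← Matrix.mul_assoc, splitMatrix_mul_conjTranspose, Matrix.one_mul]

theorem star_dotProduct_splitMatrix (x y : CTensor μ n) :
    star (ctMap μ (splitMatrix n) y) ⬝ᵥ ctMap μ (splitMatrix n) x = star y ⬝ᵥ x := by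
  rw [star_ctMap, dotProduct_ctMap, ← ctMap_mul]
  have : (splitMatrix n)ᵀ * (splitMatrix n).map star = 1 := by
    have h := congrArg Matrix.transpose (splitMatrix_conjTranspose_mul_self (n := n))
    rw [Matrix.transpose_mul, Matrix.transpose_one] at h
    exact h
  rw [this, ctMap_one]

theorem IsOrthogonalStable.exists_star_dotProduct_ne_zero (hμ : 2 * μ.colLen 0 ≤ n)
    {M M' : Submodule ℂ (CTensor μ n)} (hM : IsOrthogonalStable M) (hW : M ≤ weylModule μ 1)
    (h0 : M ≠ ⊥) (hM' : IsOrthogonalStable M') (hW' : M' ≤ weylModule μ 1) (h0' : M' ≠ ⊥) :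
    ∃ x ∈ M, ∃ y ∈ M', star y ⬝ᵥ x ≠ 0 := by
  have hst {L : Submodule ℂ (CTensor μ n)} (hL : IsOrthogonalStable L) :
      IsSplitStable (L.map (ctMap μ (splitMatrix n))) := by
    rintro γ h1 h2 _ ⟨t, ht, rfl⟩
    obtain ⟨g, hg⟩ := exists_orthogonal_of_split h1 h2
    refine ⟨_, hL g t ht, ?_⟩
    rw [← ctMap_mul, hg, ctMap_mul]
  have hle {L : Submodule ℂ (CTensor μ n)} (hL : L ≤ weylModule μ 1) :
      L.map (ctMap μ (splitMatrix n)) ≤ weylModule μ (revForm n) := by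
    rintro _ ⟨t, ht, rfl⟩
    exact ctMap_mem_weylModule splitMatrix_transpose_mul_revForm_mul (hL ht)
  have hne {L : Submodule ℂ (CTensor μ n)} (hL : L ≠ ⊥) :
      L.map (ctMap μ (splitMatrix n)) ≠ ⊥ := by
    obtain ⟨t, ht, ht0⟩ := L.ne_bot_iff.1 hL
    refine (Submodule.ne_bot_iff _).2 ⟨_, ⟨t, ht, rfl⟩, fun h => ht0 ?_⟩
    rw [← ctMap_one t, ← splitMatrix_conjTranspose_mul_self, ctMap_mul, h, map_zero]
  obtain ⟨_, ⟨x, hx, rfl⟩, _, ⟨y, hy, rfl⟩, h⟩ := Vexillar.exists_star_dotProduct_ne_zero hμ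
    (hst hM) (hle hW) (hne h0) (hst hM') (hle hW') (hne h0')
  rw [star_dotProduct_splitMatrix] at h
  exact ⟨x, hx, y, hy, h⟩

end CompactForm

/-! ### Constancy on a circle of frames and the isotropic frame. -/

section Isotropic

variable {μ : YoungDiagram} {n m : ℕ}

theorem infinite_unit_circle :
    {z : ℂ | ∃ a b : ℝ, a ^ 2 + b ^ 2 = 1 ∧ z = a + Complex.I * b}.Infinite := by
  refine Set.infinite_of_injOn_mapsTo
    (f := fun a : ℝ => (a : ℂ) + Complex.I * (Real.sqrt (1 - a ^ 2) : ℝ)) (s := Set.Icc 0 1) ?_ ?_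
    (Set.Icc_infinite one_pos)
  · intro a _ b _ h
    have := congrArg Complex.re h
    simpa using this
  · intro a ha
    refine ⟨a, Real.sqrt (1 - a ^ 2), ?_, rfl⟩
    rw [Real.sq_sqrt (by nlinarith [ha.1, ha.2])]
    ring

open Polynomial in
/-- A homogeneous form of positive degree that is constant along a circle of matrices vanishes
at the corresponding isotropic matrix. -/
theorem dotProduct_ctMap_isotropic_eq_zero (hμ : μ.card ≠ 0) (v : CTensor μ n) (w : CTensor μ m)
    (U V : Matrix (Fin n) (Fin m) ℂ) (c : ℂ)
    (h : ∀ a b : ℝ, a ^ 2 + b ^ 2 = 1 → v ⬝ᵥ ctMap μ ((a : ℂ) • U + (b : ℂ) • V) w = c) :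
    v ⬝ᵥ ctMap μ (U + Complex.I • V) w = 0 := by
  -- On the circle put `z = a + ib`; then `2z(aU + bV) = z²(U - iV) + (U + iV)`, a polynomial in `z`
  -- with value `U + iV` at 0.
  let p : ℂ[X] := ∑ T : Box μ → Fin n, C (v T) * ∑ S : Box μ → Fin m,
    (∏ b, (C ((U - Complex.I • V) (T b) (S b)) * X ^ 2 + C ((U + Complex.I • V) (T b) (S b)))) *
      C (w S)
  have hp (z : ℂ) : p.eval z =
      v ⬝ᵥ ctMap μ (z ^ 2 • (U - Complex.I • V) + (U + Complex.I • V)) w := by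
    simp only [p, dotProduct, ctMap_apply, eval_finsetSum, eval_mul, eval_C, eval_prod, eval_add,
      eval_pow, eval_X, Matrix.add_apply (z ^ 2 • (U - Complex.I • V)), Matrix.smul_apply (z ^ 2),
      smul_eq_mul, mul_comm (z ^ 2)]
  have hpq : p = C (2 ^ μ.card * c) * X ^ μ.card := by
    refine eq_of_infinite_eval_eq _ _ (infinite_unit_circle.mono ?_)
    rintro z ⟨a, b, hab, rfl⟩
    have hmat : ((a : ℂ) + Complex.I * b) ^ 2 • (U - Complex.I • V) + (U + Complex.I • V) =
        (2 * ((a : ℂ) + Complex.I * b)) • ((a : ℂ) • U + (b : ℂ) • V) := by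
      have hab' : (a : ℂ) ^ 2 + (b : ℂ) ^ 2 = 1 := by exact_mod_cast hab
      ext i j
      simp only [Matrix.add_apply, Matrix.sub_apply, Matrix.smul_apply, smul_eq_mul]
      linear_combination (-(U i j + Complex.I * V i j)) * hab' +
        ((b : ℂ) ^ 2 * U i j - 2 * a * b * V i j - Complex.I * b ^ 2 * V i j) * Complex.I_mul_I
    change p.eval _ = _
    rw [hp, hmat, ctMap_smul, dotProduct_smul, h a b hab, eval_mul, eval_C, eval_pow, eval_X,
      mul_pow, smul_eq_mul]
    ring
  -- `p` is a multiple of a monomial of positive degree, so it vanishes at 0.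
  have h0 := hp 0
  rw [hpq, eval_mul, eval_pow, eval_X, zero_pow hμ, mul_zero, zero_pow two_ne_zero, zero_smul,
    zero_add] at h0
  exact h0.symm

variable {s : FlagShape n}

theorem Frame.standard_apply (i : Fin n) (j : Fin s.top) :
    (Frame.standard s).1 i j = if (i : ℕ) = j then 1 else 0 := rfl

/-- The frame made of the last vectors of the canonical basis, in reverse order. -/
def revStandard (s : FlagShape n) : Matrix (Fin n) (Fin s.top) ℝ :=
  (Frame.standard s).1.submatrix Fin.rev id

theorem revStandard_transpose_mul_self : (revStandard s)ᵀ * revStandard s = 1 := by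
  rw [← (Frame.standard s).2]
  ext i j
  exact Equiv.sum_comp Fin.revPerm fun x : Fin n =>
    ((Frame.standard s).1 x i * (Frame.standard s).1 x j : ℝ)

/-- The first `m` and the last `m` indices are disjoint because `2m ≤ n`. -/
theorem standard_transpose_mul_revStandard (hs : 2 * s.top ≤ n) :
    (Frame.standard s).1ᵀ * revStandard s = 0 := by
  ext i j
  change ∑ x : Fin n, (Frame.standard s).1 x i * (Frame.standard s).1 x.rev j = 0
  refine Finset.sum_eq_zero fun x _ => ?_
  rw [Frame.standard_apply, Frame.standard_apply, Fin.val_rev]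
  have hi := i.2
  have hj := j.2
  have hx := x.2
  split_ifs
  · omega
  all_goals simp

theorem revStandard_transpose_mul_standard (hs : 2 * s.top ≤ n) :
    (revStandard s)ᵀ * (Frame.standard s).1 = 0 := by
  have h := congrArg Matrix.transpose (standard_transpose_mul_revStandard hs)
  rwa [Matrix.transpose_mul, Matrix.transpose_transpose, Matrix.transpose_zero] at h

/-- A circle of frames. -/
def circleFrame (hs : 2 * s.top ≤ n) (a b : ℝ) (hab : a ^ 2 + b ^ 2 = 1) : Frame s :=
  ⟨a • (Frame.standard s).1 + b • revStandard s, by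
    have h1 : (Frame.standard s).1ᵀ * (Frame.standard s).1 = 1 := (Frame.standard s).2
    simp only [Matrix.transpose_add, Matrix.transpose_smul, Matrix.add_mul, Matrix.mul_add,
      Matrix.smul_mul, Matrix.mul_smul, h1, revStandard_transpose_mul_self,
      standard_transpose_mul_revStandard hs, revStandard_transpose_mul_standard hs, smul_zero,
      add_zero, zero_add, smul_smul]
    rw [← add_smul, ← sq, ← sq, hab, one_smul]⟩

theorem toComplex_dotProduct (v u : Tensor μ n) :
    v.toComplex ⬝ᵥ u.toComplex = ((∑ T, v T * u T : ℝ) : ℂ) := by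
  simp [dotProduct, Tensor.toComplex]

/-- The isotropic frame made of the vectors `eⱼ + i e_{rev j}`. -/
def isotropicFrame (s : FlagShape n) : Matrix (Fin n) (Fin s.top) ℂ :=
  (Frame.standard s).1.map Complex.ofReal + Complex.I • (revStandard s).map Complex.ofReal

theorem map_ofReal_mul {p q r : ℕ} (A : Matrix (Fin p) (Fin q) ℝ) (B : Matrix (Fin q) (Fin r) ℝ) :
    (A * B).map Complex.ofReal = A.map Complex.ofReal * B.map Complex.ofReal :=
  Matrix.map_mul (f := Complex.ofRealHom)

theorem map_ofReal_one {p : ℕ} :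
    (1 : Matrix (Fin p) (Fin p) ℝ).map Complex.ofReal = 1 :=
  Matrix.map_one _ Complex.ofReal_zero Complex.ofReal_one

theorem map_ofReal_zero {p q : ℕ} :
    (0 : Matrix (Fin p) (Fin q) ℝ).map Complex.ofReal = 0 :=
  Matrix.map_zero _ Complex.ofReal_zero

theorem transpose_mul_map_ofReal {p q r : ℕ} {A : Matrix (Fin q) (Fin p) ℝ}
    {B : Matrix (Fin q) (Fin r) ℝ} {C : Matrix (Fin p) (Fin r) ℝ} (h : Aᵀ * B = C) :
    (A.map Complex.ofReal)ᵀ * B.map Complex.ofReal = C.map Complex.ofReal := by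
  rw [← h, map_ofReal_mul, Matrix.transpose_map]

theorem isotropicFrame_transpose_mul_self (hs : 2 * s.top ≤ n) :
    (isotropicFrame s)ᵀ * (1 : Matrix (Fin n) (Fin n) ℂ) * isotropicFrame s = 0 := by
  rw [Matrix.mul_one, isotropicFrame, Matrix.transpose_add, Matrix.transpose_smul, Matrix.add_mul,
    Matrix.mul_add, Matrix.mul_add, Matrix.smul_mul, Matrix.smul_mul, Matrix.mul_smul,
    Matrix.mul_smul, transpose_mul_map_ofReal (Frame.standard s).2,
    transpose_mul_map_ofReal revStandard_transpose_mul_self,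
    transpose_mul_map_ofReal (standard_transpose_mul_revStandard hs),
    transpose_mul_map_ofReal (revStandard_transpose_mul_standard hs), map_ofReal_one,
    map_ofReal_zero, smul_zero, add_zero, zero_add, smul_smul, Complex.I_mul_I, neg_smul, one_smul,
    add_neg_cancel]

/-- This left inverse shows that the isotropic frame does not kill `w`. -/
theorem standard_transpose_mul_isotropicFrame (hs : 2 * s.top ≤ n) :
    ((Frame.standard s).1.map Complex.ofReal)ᵀ * isotropicFrame s = 1 := by
  rw [isotropicFrame, Matrix.mul_add, Matrix.mul_smul,
    transpose_mul_map_ofReal (Frame.standard s).2,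
    transpose_mul_map_ofReal (standard_transpose_mul_revStandard hs), map_ofReal_one,
    map_ofReal_zero, smul_zero, add_zero]

/-- A nonzero `φ(v ⊗ w)` of positive degree is not constant on the frames. -/
theorem eq_zero_of_schurPoly_const (hs : 2 * s.top ≤ n) (hμ0 : μ ≠ ⊥) (hμ : μ.colLen 0 ≤ s.top)
    {v : Tensor μ n} (hv : v ∈ orthSchur μ n) {w : Tensor μ s.top} (hw : w ∈ schur μ s.top) {c : ℝ}
    (h : ∀ X : Frame s, schurPoly v w X.1 = c) (hw0 : w ≠ 0) : v = 0 := by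
  by_contra hv0
  have hcard : μ.card ≠ 0 := fun h0 => hμ0 (by
    have h1 : μ.cells = ∅ := Finset.card_eq_zero.1 h0
    exact SetLike.coe_injective (by ext x; simp [← YoungDiagram.mem_cells, h1]))
  have hvan (g : O n) : v.toComplex ⬝ᵥ ctMap μ ((g : Matrix (Fin n) (Fin n) ℝ).map Complex.ofReal)
      (ctMap μ (isotropicFrame s) w.toComplex) = 0 := by
    rw [← ctMap_mul, isotropicFrame, Matrix.mul_add, Matrix.mul_smul]
    refine dotProduct_ctMap_isotropic_eq_zero hcard _ _ _ _ c fun a b hab => ?_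
    have h1 := h (Frame.mul g (circleFrame hs a b hab))
    have h2 : (a : ℂ) • ((g : Matrix (Fin n) (Fin n) ℝ).map Complex.ofReal *
          (Frame.standard s).1.map Complex.ofReal) +
        (b : ℂ) • ((g : Matrix (Fin n) (Fin n) ℝ).map Complex.ofReal *
          (revStandard s).map Complex.ofReal) =
        (Frame.mul g (circleFrame hs a b hab)).1.map Complex.ofReal := by
      change _ = ((g : Matrix (Fin n) (Fin n) ℝ) *
        (a • (Frame.standard s).1 + b • revStandard s)).map Complex.ofReal
      rw [← map_ofReal_mul, ← map_ofReal_mul, Matrix.mul_add, Matrix.mul_smul, Matrix.mul_smul]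
      ext i j
      simp
    rw [h2, ctMap_toComplex, toComplex_dotProduct]
    exact congrArg Complex.ofReal h1
  -- `M'` gathers the tensors whose whole orbit is orthogonal to `v`, and contains the isotropic
  -- image of `w`; `M`, its orthogonal in `weylModule`, contains `v`. Both are stable and nonzero,
  -- yet orthogonal.
  let M' : Submodule ℂ (CTensor μ n) :=
    { carrier := {y | y ∈ weylModule μ 1 ∧ ∀ g : O n, v.toComplex ⬝ᵥ
        ctMap μ ((g : Matrix (Fin n) (Fin n) ℝ).map Complex.ofReal) y = 0}
      zero_mem' := ⟨zero_mem _, fun g => by simp⟩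
      add_mem' := fun hx hy => ⟨add_mem hx.1 hy.1, fun g => by
        rw [map_add, dotProduct_add, hx.2, hy.2, add_zero]⟩
      smul_mem' := fun r x hx => ⟨Submodule.smul_mem _ r hx.1, fun g => by
        rw [map_smul, dotProduct_smul, hx.2, smul_zero]⟩ }
  let M : Submodule ℂ (CTensor μ n) :=
    { carrier := {x | x ∈ weylModule μ 1 ∧ ∀ y ∈ M', star y ⬝ᵥ x = 0}
      zero_mem' := ⟨zero_mem _, fun g => by simp⟩
      add_mem' := fun hx hy => ⟨add_mem hx.1 hy.1, fun g hg => by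
        rw [dotProduct_add, hx.2 g hg, hy.2 g hg, add_zero]⟩
      smul_mem' := fun r x hx => ⟨Submodule.smul_mem _ r hx.1, fun g hg => by
        rw [dotProduct_smul, hx.2 g hg, smul_zero]⟩ }
  have hweyl (g : O n) {t : CTensor μ n} (ht : t ∈ weylModule μ 1) :
      ctMap μ ((g : Matrix (Fin n) (Fin n) ℝ).map Complex.ofReal) t ∈ weylModule μ 1 := by
    refine ctMap_mem_weylModule ?_ ht
    rw [Matrix.mul_one, ← Matrix.transpose_map, ← map_ofReal_mul, O.transpose_mul_self,
      map_ofReal_one]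
  have hM' : IsOrthogonalStable M' := fun g t ht => ⟨hweyl g ht.1, fun g' => by
    rw [← ctMap_mul, ← map_ofReal_mul]
    exact ht.2 (g' * g)⟩
  have hM : IsOrthogonalStable M := fun g t ht => ⟨hweyl g ht.1, fun y hy => by
    have h1 := ht.2 _ (hM' g⁻¹ y hy)
    have h2 : (((g⁻¹ : O n) : Matrix (Fin n) (Fin n) ℝ).map Complex.ofReal).map star =
        ((g : Matrix (Fin n) (Fin n) ℝ).map Complex.ofReal)ᵀ := by
      rw [O.coe_inv]
      ext i j
      exact Complex.conj_ofReal _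
    rw [star_ctMap, h2] at h1
    rw [dotProduct_ctMap, h1]⟩
  have hzero : M ≠ ⊥ := by
    refine (Submodule.ne_bot_iff _).2 ⟨v.toComplex, ⟨orthSchur_toComplex hv, fun y hy => ?_⟩,
      fun h0 => hv0 (funext fun T => Complex.ofReal_eq_zero.1 (congrFun h0 T))⟩
    have h1 := hy.2 1
    rw [show ((1 : O n) : Matrix (Fin n) (Fin n) ℝ) = 1 from rfl, map_ofReal_one, ctMap_one] at h1
    have h2 : star v.toComplex = v.toComplex := by
      funext T; simp [Tensor.toComplex]
    rw [← h2, Matrix.star_dotProduct_star, h1, star_zero]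
  have hzero' : M' ≠ ⊥ := by
    refine (Submodule.ne_bot_iff _).2 ⟨ctMap μ (isotropicFrame s) w.toComplex, ⟨?_, hvan⟩,
      fun h0 => hw0 ?_⟩
    -- The form pulls back to 0 along the isotropic frame, so no trace condition on `w` is needed.
    · refine ctMap_mem_weylModule (isotropicFrame_transpose_mul_self hs)
        (toComplex_mem_weylModule hw fun b c _ T => ?_)
      simp [contraction]
    · have h1 : w.toComplex = 0 := by
        rw [← ctMap_one w.toComplex, ← standard_transpose_mul_isotropicFrame hs, ctMap_mul, h0,
          map_zero]
      exact funext fun T => Complex.ofReal_eq_zero.1 (congrFun h1 T)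
  obtain ⟨x, hx, y, hy, hxy⟩ := hM.exists_star_dotProduct_ne_zero (by omega) (fun _ h => h.1) hzero
    hM' (fun _ h => h.1) hzero'
  exact hxy (hx.2 y hy)

end Isotropic

end Vexillar

end

theorem mainTheorem2 (n t : ℕ) (s : Vexillar.FlagShape n) (G : Subgroup (Vexillar.O n)) [Finite G] :
    (Vexillar.trivialMult ((Vexillar.flagPolynomialRep s t).comp G.subtype) = 1 ↔
      ∀ Δ₀ : Vexillar.Flag s, Vexillar.IsVexillarDesign s t (MulAction.orbit G Δ₀)) ∧
    (2 * s.top ≤ n →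
      (Vexillar.trivialMult ((Vexillar.schurSumRep s t).comp G.subtype) = 1 ↔
        ∀ Δ₀ : Vexillar.Flag s, Vexillar.IsVexillarDesign s t (MulAction.orbit G Δ₀))) := by
  rw [Vexillar.trivialMult_flagPolynomialRep_eq_one_iff,
    Vexillar.trivialMult_schurSumRep_eq_one_iff,
    ← Vexillar.invariantsConstant_iff_isVexillarDesign]
  refine ⟨Iff.rfl, fun hs => ⟨fun h => h.invariantsConstant, fun h => h.noFixedVectors ?_⟩⟩
  exact fun μ hμ0 hμ v hv w hw c hc hw0 =>
    Vexillar.eq_zero_of_schurPoly_const hs hμ0 hμ hv hw hc hw0
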